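/- **Model.** A server and $n$ nodes monitor data streams. At each time step $t$ node $i$ privately observes a value $v_i^t\in\mathbb N$ (future values are unknown); then rounds of communication take place. In a round each node may send a message to the server, and the server may send messages to single nodes and one broadcast to all nodes; every message (also a broadcast) costs $1$. Nodes and server may use private random coins. With $M=\max_i v_i^t$, at time $t$ messages have $O(\log n+\log M)$ bits and the number of rounds is polylogarithmic in $n$ and $M$. Let $1\le k\le n$ and $0<\varepsilon<1$. Let $v_k^t$ be the $k$-th largest value at time $t$. A set $F$ of $k$ nodes is a *correct output* at time $t$ if it is the union of $\{i: v_i^t>\frac1{1-\varepsilon}v_k^t\}$ and a subset of the $\varepsilon$-neighbourhood $\mathcal K(t)=\{i:(1-\varepsilon)v_k^t\le v_i^t\le\frac1{1-\varepsilon}v_k^t\}$. Intervals $F_i=[\ell_i,u_i]$ ($\ell_i\in\mathbb N$, $u_i\in\mathbb N\cup\{\infty\}$, one for each node) are a *set of filters* for the output $F$ if $v_i^t\in F_i$ for all $i$, and $\ell_i\ge(1-\varepsilon)u_j$ for all $i\in F$, $j\notin F$. A *filter-based online algorithm for $\varepsilon$-Top-$k$-Position Monitoring* has the server assign an interval to each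 node (a node's interval changes only when the node receives a message) such that with probability $1$, at the end of the communication of each time step, the server knows a correct output and the intervals of the nodes are a set of filters for it; in a time step in which no node observes a value outside its interval, no message is sent. The values are chosen by an adaptive adversary, who knows the algorithm, all states and the results of all past random experiments. A *filter-based offline algorithm* with error $\varepsilon$ knows the whole input and chooses at each time step a correct output and a set of filters for it. It is charged $1$ for each time step at which its filters are updated, including the first assignment of filters at the first time step (this is a lower bound on its number of messages). $\mathrm{OPT}$ is its least possible cost on the input. An online algorithm is *$c$-competitive*, for a function $c$ of the input, if for every adaptive adversary and every number $T$ of time steps $\mathbb E[\#\text{messages}]\le\mathbb E[c\cdot\mathrm{OPT}]$. For an input let $\sigma=\max_t|\mathcal K(t)|$, $v_k=\max_t v_k^t$ and $\Delta=\max_{t,i}v_i^t$. In the bounds below $\log x$ stands for $\max\{1,\log_2 x\}$, and the constants in $O(\cdot)$ (and those in the limits on message sizes and rounds) are absolute. **Theorem.** For all $1\le k\le n$ and $0<\varepsilon<1$ there is a filter-based online algorithm for $\varepsilon$-Top-$k$-Position Monitoring which, against an optimal filter-based offline algorithm with the same error $\varepsilon$, is $$O\!\left(\sigma^2\log(\varepsilon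 v_k)+\sigma\log^2(\varepsilon v_k)+k\log n+\log\log\Delta+\log\tfrac1\varepsilon\right)\text{-competitive},$$ and also $$O\!\left(n^2\log(\varepsilon\Delta)+n\log^2(\varepsilon\Delta)+\log\log\Delta+\log\tfrac1\varepsilon\right)\text{-competitive}.$$ -/

import Mathlib

open scoped ENNReal

noncomputable section

namespace TopK

/-! ### The approximate Top-k problem -/

/-- The values observed by the `n` nodes at one time step. -/
abbrev Values (n : ℕ) : Type := Fin n → ℕ

/-- The `k`-th largest observed value (for `1 ≤ k ≤ n`), counted with multiplicity:
the largest `x` such that at least `k` nodes observe a value that is at least `x`. -/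
def kthLargest {n : ℕ} (k : ℕ) (v : Values n) : ℕ :=
  sSup {x : ℕ | k ≤ (Finset.univ.filter fun i => x ≤ v i).card}

/-- The largest observed value. -/
def maxValue {n : ℕ} (v : Values n) : ℕ := Finset.univ.sup v

open Classical in
/-- The nodes whose value is clearly larger than the `k`-th largest one, i.e. lies in
`(v_k / (1 - ε), ∞]`. -/
def clearlyLarger {n : ℕ} (ε : ℝ) (k : ℕ) (v : Values n) : Finset (Fin n) :=
  Finset.univ.filter fun i => 1 / (1 - ε) * (kthLargest k v : ℝ) < (v i : ℝ)

open Classical in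
/-- The nodes whose value lies in the `ε`-neighbourhood `[(1 - ε) v_k, v_k / (1 - ε)]` of the
`k`-th largest value. -/
def neighborhood {n : ℕ} (ε : ℝ) (k : ℕ) (v : Values n) : Finset (Fin n) :=
  Finset.univ.filter fun i =>
    (1 - ε) * (kthLargest k v : ℝ) ≤ (v i : ℝ) ∧
      (v i : ℝ) ≤ 1 / (1 - ε) * (kthLargest k v : ℝ)

/-- `F` is a correct output for the values `v`: it has `k` elements and consists of all nodes that
are clearly larger, together with nodes from the `ε`-neighbourhood. -/
def IsOutput {n : ℕ} (ε : ℝ) (k : ℕ) (v : Values n) (F : Finset (Fin n)) : Prop :=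
  F.card = k ∧ ∃ G ⊆ neighborhood ε k v, F = clearlyLarger ε k v ∪ G

/-! ### Filters -/

/-- A filter, i.e. an interval `[lo, hi]` of natural numbers, possibly with `hi = ∞`. -/
structure Interval where
  lo : ℕ
  hi : ℕ∞

/-- The value `x` lies in the filter `I`, i.e. does not violate it. -/
def Interval.Contains (I : Interval) (x : ℕ) : Prop := I.lo ≤ x ∧ (x : ℕ∞) ≤ I.hi

/-- The intervals `I` are a (valid) set of filters for the values `v` and the output `F`: each node's
value lies in its filter, and `ℓ_i ≥ (1 - ε) u_j` for `i ∈ F` and `j ∉ F`. -/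
def IsFilterSet {n : ℕ} (ε : ℝ) (v : Values n) (F : Finset (Fin n)) (I : Fin n → Interval) : Prop :=
  (∀ i, (I i).Contains (v i)) ∧
    ∀ i ∈ F, ∀ j ∉ F, ENNReal.ofReal (1 - ε) * ((I j).hi : ℝ≥0∞) ≤ ((I i).lo : ℝ≥0∞)

/-! ### The offline adversary -/

/-- What a filter-based offline algorithm does on the input `v` with `T` time steps: it chooses a
correct output and a set of filters for each time step, knowing all of `v`. -/
structure Offline {n T : ℕ} (ε : ℝ) (k : ℕ) (v : Fin T → Values n) where
  output : Fin T → Finset (Fin n)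
  filter : Fin T → Fin n → Interval
  output_correct : ∀ t, IsOutput ε k (v t) (output t)
  filter_valid : ∀ t, IsFilterSet ε (v t) (output t) (filter t)

open Classical in
/-- The number of time steps at which an offline algorithm updates its filters. The first assignment
of filters, at the first time step, counts as an update. -/
def Offline.updates {n T : ℕ} {ε : ℝ} {k : ℕ} {v : Fin T → Values n} (S : Offline ε k v) : ℕ :=
  (Finset.univ.filter fun t : Fin T =>
    ∀ s : Fin T, (s : ℕ) + 1 = (t : ℕ) → S.filter s ≠ S.filter t).card

/-- The cost of an optimal filter-based offline algorithm on the input `v`: the least possible number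
of filter updates. -/
def opt {n T : ℕ} (ε : ℝ) (k : ℕ) (v : Fin T → Values n) : ℕ :=
  sInf {m : ℕ | ∃ S : Offline ε k v, S.updates = m}

/-! ### Online algorithms: a server and `n` nodes exchanging messages -/

/-- Messages are bit strings. -/
abbrev Msg : Type := List Bool

/-- A randomized online algorithm for a server and `n` nodes.

Every time step starts with each node observing its new value (`observe`), which is followed by
communication rounds. In a round, each node may send a message to the server (`send`); then the server
may send a message to each single node and one broadcast message to all nodes (`act`); then the nodes
process what they received (`receive`). The communication of the time step ends after the first round
after which the server is in a state satisfying `done`. All coin tosses are private and independent.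

A node's filter is part of its state. It is assigned by the server, that is, it changes only when the
node receives a message. The output is determined by the state of the server. -/
structure Online (n : ℕ) where
  Server : Type
  Node : Type
  serverInit : Server
  nodeInit : Fin n → Node
  observe : Node → ℕ → Node
  send : Node → PMF (Node × Option Msg)
  act : Server → (Fin n → Option Msg) → PMF (Server × (Fin n → Option Msg) × Option Msg)
  receive : Node → (unicast : Option Msg) → (broadcast : Option Msg) → Node
  done : Server → Prop
  output : Server → Finset (Fin n)
  filter : Node → Interval
  filter_observe : ∀ q x, filter (observe q x) = filter q
  filter_send : ∀ q, ∀ r ∈ (send q).support, filter r.1 = filter q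
  filter_receive : ∀ q, filter (receive q none none) = filter q

/-- The joint law of independent random variables with laws `p 0, …, p (n - 1)`. -/
def independent {α : Type} : {n : ℕ} → (Fin n → PMF α) → PMF (Fin n → α)
  | 0, _ => PMF.pure Fin.elim0
  | _ + 1, p =>
    (p 0).bind fun a => (independent fun i => p i.succ).bind fun f => PMF.pure (Fin.cons a f)

namespace Online

variable {n : ℕ} (A : Online n)

/-- The states of the server and of all nodes. -/
structure Config where
  server : A.Server
  node : Fin n → A.Node

/-- Everything that happens in one round, including the results of all random experiments. -/
structure Round where
  /-- each node's state after its coin tosses, and the message it sends to the server, if any -/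
  sent : Fin n → A.Node × Option Msg
  server : A.Server
  unicast : Fin n → Option Msg
  broadcast : Option Msg

variable {A}

/-- The states at the end of a round. -/
def Round.final (r : A.Round) : A.Config where
  server := r.server
  node := fun i => A.receive (r.sent i).1 (r.unicast i) r.broadcast

/-- The number of messages of a round; a broadcast counts once. -/
def Round.messages (r : A.Round) : ℕ :=
  (Finset.univ.filter fun i => (r.sent i).2.isSome).card +
    (Finset.univ.filter fun i => (r.unicast i).isSome).card +
      (if r.broadcast.isSome then 1 else 0)

/-- All messages of a round have at most `b` bits. -/
def Round.SizeAtMost (r : A.Round) (b : ℕ) : Prop :=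
  (∀ i, ∀ m ∈ (r.sent i).2, m.length ≤ b) ∧ (∀ i, ∀ m ∈ r.unicast i, m.length ≤ b) ∧
    ∀ m ∈ r.broadcast, m.length ≤ b

/-- One round of communication started in the states `c`. -/
def runRound (c : A.Config) : PMF A.Round :=
  (independent fun i => A.send (c.node i)).bind fun s =>
    (A.act c.server fun i => (s i).2).bind fun a =>
      PMF.pure { sent := s, server := a.1, unicast := a.2.1, broadcast := a.2.2 }

open Classical in
/-- Rounds of communication started in the states `c`, until the server is done, but at most
`limit` many. -/
def runRounds : (limit : ℕ) → A.Config → PMF (List A.Round)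
  | 0, _ => PMF.pure []
  | limit + 1, c =>
    (runRound c).bind fun r =>
      if A.done r.server then PMF.pure [r]
      else (runRounds limit r.final).bind fun rs => PMF.pure (r :: rs)

variable (A)

/-- Everything that happens in one time step. -/
structure Step where
  values : Values n
  /-- the states after the observation and before the communication -/
  start : A.Config
  /-- the rounds of communication in chronological order -/
  rounds : List A.Round

variable {A}

/-- The states at the end of a time step. -/
def Step.final (s : A.Step) : A.Config :=
  match s.rounds.getLast? with
  | none => s.start
  | some r => r.final

/-- The number of messages of a time step. -/
def Step.messages (s : A.Step) : ℕ := (s.rounds.map Round.messages).sum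

variable (A)

/-- The history of an execution: the past time steps, the most recent one first. -/
abbrev History : Type := List A.Step

/-- An adaptive adversary chooses the values of the next time step, knowing the algorithm and
everything that has happened so far, including the results of the random experiments. -/
abbrev Adversary : Type := A.History → Values n

variable {A}

/-- The current states after a history. -/
def current : A.History → A.Config
  | [] => { server := A.serverInit, node := A.nodeInit }
  | s :: _ => s.final

/-- The law of the first `T` time steps when the adversary `adv` chooses the values, and where a time
step in which the largest value is `M` may take at most `limit M` rounds. -/
def run (limit : ℕ → ℕ) (adv : A.Adversary) : (T : ℕ) → PMF A.History
  | 0 => PMF.pure []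
  | T + 1 =>
    (run limit adv T).bind fun h =>
      let start : A.Config :=
        { server := (current h).server
          node := fun i => A.observe ((current h).node i) (adv h i) }
      (runRounds (limit (maxValue (adv h))) start).bind fun rs =>
        PMF.pure ({ values := adv h, start := start, rounds := rs } :: h)

/-- The values observed in a history, in chronological order. -/
def values (h : A.History) : Fin h.length → Values n := fun t => (h.get t.rev).values

/-- The number of messages of a history. -/
def messages (h : A.History) : ℕ := (h.map Step.messages).sum

/-- What is required of a filter-based online algorithm for the approximate Top-k problem in a time
step `s`: the communication has ended because the server is done; no message has more than `size`
bits; there is no communication if no node observes a filter violation; and at the end of the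
communication the output is correct and the filters of the nodes are a valid set of filters. -/
structure Step.IsCorrect (ε : ℝ) (k : ℕ) (size : ℕ) (s : A.Step) : Prop where
  ended : ∃ r, s.rounds.getLast? = some r ∧ A.done r.server
  size_le : ∀ r ∈ s.rounds, r.SizeAtMost size
  silent : (∀ i, (A.filter (s.start.node i)).Contains (s.values i)) → s.messages = 0
  output_correct : IsOutput ε k s.values (A.output s.final.server)
  filter_valid :
    IsFilterSet ε s.values (A.output s.final.server) fun i => A.filter (s.final.node i)

end Online

/-- A limit for the number of rounds that is polylogarithmic in `n` and the largest value `M`. -/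
def roundLimit (c d n M : ℕ) : ℕ := c * (Nat.log 2 n + Nat.log 2 M + 1) ^ d

/-- A limit for the size of messages that is logarithmic in `n` and the largest value `M`. -/
def sizeLimit (c n M : ℕ) : ℕ := c * (Nat.log 2 n + Nat.log 2 M + 1)

/-- `A` is a filter-based online algorithm for `ε`-Top-`k`-Position Monitoring: against every adversary,
it is correct at each time step, for every outcome of positive probability. -/
def Online.Solves {n : ℕ} (A : Online n) (ε : ℝ) (k c d : ℕ) : Prop :=
  ∀ (adv : A.Adversary) (T : ℕ), ∀ h ∈ (Online.run (roundLimit c d n) adv T).support,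
    ∀ s ∈ h, s.IsCorrect ε k (sizeLimit c n (maxValue s.values))

/-- The expectation of a nonnegative random variable. -/
def expect {α : Type} (p : PMF α) (f : α → ℝ≥0∞) : ℝ≥0∞ := ∑' a, p a * f a

/-- `A` is competitive with the ratio `ratio`, a function of the input, against an optimal filter-based
offline algorithm with error `ε`, for every adaptive adversary and every number of time steps. -/
def Online.Competitive {n : ℕ} (A : Online n) (ε : ℝ) (k c d : ℕ)
    (ratio : (T : ℕ) → (Fin T → Values n) → ℝ) : Prop :=
  ∀ (adv : A.Adversary) (T : ℕ),
    expect (Online.run (roundLimit c d n) adv T) (fun h => (Online.messages h : ℝ≥0∞)) ≤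
      expect (Online.run (roundLimit c d n) adv T) fun h =>
        ENNReal.ofReal (ratio h.length (Online.values h) * (opt ε k (Online.values h) : ℝ))

/-! ### The parameters of an input -/

/-- `σ`: the largest number of nodes that are in the `ε`-neighbourhood at the same time. -/
def sigma {n T : ℕ} (ε : ℝ) (k : ℕ) (v : Fin T → Values n) : ℕ :=
  Finset.univ.sup fun t => (neighborhood ε k (v t)).card

/-- `v_k`: the largest value that is the `k`-th largest value at some time. -/
def maxKth {n T : ℕ} (k : ℕ) (v : Fin T → Values n) : ℕ :=
  Finset.univ.sup fun t => kthLargest k (v t)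

/-- `Δ`: the largest value observed by some node at some time. -/
def delta {n T : ℕ} (v : Fin T → Values n) : ℕ :=
  Finset.univ.sup fun t => maxValue (v t)

/-- The logarithm in `O`-bounds: `max 1 (log₂ x)`. -/
def lg (x : ℝ) : ℝ := max 1 (Real.logb 2 x)

end TopK

end

/-!
# Approximate monitoring of the top `k` positions

The algorithm works in phases. During a phase, `m i` and `M i` denote the least and the largest value
observed by node `i`. An output `F` and a threshold `l` are *feasible* (`Feas`) if `l ≤ m i` inside `F`
and `(1 - ε) M i ≤ l` outside. A feasible output is correct (`Feas.isOutput`), and an offline algorithm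
that keeps its filters during the whole phase yields a feasible pair (`feas_of_isFilterSet`). A new
phase starts only if nothing has been feasible in the last one, so the number of phases is at most the
optimal cost (`Tracks`, `Tracks.le_opt`), and it suffices to bound the messages of a phase. (What
precedes the first phase is charged to the first assignment of filters.)

A phase starts with a randomized search for the `k`-th largest value `z`: nodes speak with a probability
that doubles from round to round, and those below the `k`-th largest report drop out. This takes
`O(k log n)` expected messages (`avg_preceded`). The nodes clearly above `z` belong to every feasible
output, those clearly below to none, and the `s ≤ σ` nodes of the neighbourhood are undecided. If there
is more than one possible output, every feasible threshold lies between `(1 - ε)² z` and `z`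
(`mem_firstGap`), an interval of `O(ε z + 1)` numbers; otherwise only `l ≤ z` is known.

The candidates for `l` form a list of intervals: node `i` excludes those strictly between `m i` and
`(1 - ε) M i`, because it is either inside or outside the output. The server picks the midpoint of the
interval that contains the median of all candidates and assigns filters for it. When the values refute
the threshold, it asks the undecided nodes for `m i` and `M i` and picks a new one; when no candidate is
left, it starts a new phase.

* A refuted threshold lowers `potential` by one: the picked interval is halved. Every undecided node
  splits an interval at most once, which bounds the number of intervals, so the potential is at most
  `s + 1` times the potential of the first interval (`Server.update_spec`). Each failure costs `O(s)`
  messages, and a phase costs `O(s² log (ε z) + k log n + log z)` (`phaseCost`). As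
  `log z = log (ε z) + log (1 / ε)`, both bounds follow.
* A filter violation of a decided node is detected by speaking with doubling probabilities. This is
  silent without violations, certain in the last round, and takes a constant number of expected messages
  (`silence_bound`). The violations of undecided nodes are reported immediately, at most two per node
  and threshold.
* The pick of the median removes a quarter of all candidates at every failure (`weight_pick_below`,
  `weight_pick_above`). After the first failure in a time step the candidates are at most the largest
  value, so the number of rounds is polylogarithmic (`Inv.rank_step`).

The message count is organized by `debt`, an upper bound for the expected messages that the present
phase still causes. A round does not increase the expectation of the messages so far plus the debt,
except for the budget of a new phase (`Inv.avg_step`), and this holds for every history, hence against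
adaptive adversaries (`expect_messages_le`).
-/

noncomputable section

namespace TopK.Monitor

/-! ### Lists of intervals of candidate thresholds -/

/-- The candidate `l` lies in one of the intervals `[p, q]` of the list. -/
def Mem (l : ℕ) (G : List (ℕ × ℕ)) : Prop := ∃ g ∈ G, g.1 ≤ l ∧ l ≤ g.2

/-- The intervals of the list are nonempty, disjoint and increasing. -/
def Sorted (G : List (ℕ × ℕ)) : Prop :=
  (∀ g ∈ G, g.1 ≤ g.2) ∧ G.Pairwise fun g g' => g.2 < g'.1

/-- The candidates in `G` that are less than `b`. -/
def below (b : ℕ) (G : List (ℕ × ℕ)) : List (ℕ × ℕ) :=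
  G.filterMap fun g => if g.1 < b then some (g.1, min g.2 (b - 1)) else none

/-- The candidates in `G` that are at least `a`. -/
def above (a : ℕ) (G : List (ℕ × ℕ)) : List (ℕ × ℕ) :=
  G.filterMap fun g => if a ≤ g.2 then some (max g.1 a, g.2) else none

/-- The number of candidates in a list of disjoint intervals. -/
def weight (G : List (ℕ × ℕ)) : ℕ := (G.map fun g => g.2 + 1 - g.1).sum

/-- The number of halvings after which an interval is exhausted. -/
def intervalPot (g : ℕ × ℕ) : ℕ := 1 + Nat.log 2 (g.2 + 1 - g.1)

/-- The sum of the potentials of the intervals. -/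
def listPot (G : List (ℕ × ℕ)) : ℕ := (G.map intervalPot).sum

@[simp] lemma below_nil (b : ℕ) : below b [] = [] := rfl
@[simp] lemma above_nil (b : ℕ) : above b [] = [] := rfl
@[simp] lemma weight_nil : weight [] = 0 := rfl
@[simp] lemma listPot_nil : listPot [] = 0 := rfl
@[simp] lemma weight_cons (g) (G) : weight (g :: G) = (g.2 + 1 - g.1) + weight G := by
  simp [weight]
@[simp] lemma listPot_cons (g) (G) : listPot (g :: G) = intervalPot g + listPot G := by
  simp [listPot]
@[simp] lemma weight_append (G H) : weight (G ++ H) = weight G + weight H := by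
  simp [weight]
@[simp] lemma listPot_append (G H) : listPot (G ++ H) = listPot G + listPot H := by
  simp [listPot]
lemma below_cons (b g G) :
    below b (g :: G) = (if g.1 < b then [(g.1, min g.2 (b - 1))] else []) ++ below b G := by
  unfold below; rw [List.filterMap_cons]; split_ifs <;> simp
lemma above_cons (a g G) :
    above a (g :: G) = (if a ≤ g.2 then [(max g.1 a, g.2)] else []) ++ above a G := by
  unfold above; rw [List.filterMap_cons]; split_ifs <;> simp
@[simp] lemma below_append (b G H) : below b (G ++ H) = below b G ++ below b H := by
  simp [below]
@[simp] lemma above_append (b G H) : above b (G ++ H) = above b G ++ above b H := by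
  simp [above]

lemma mem_below_iff {b : ℕ} {G : List (ℕ × ℕ)} {g : ℕ × ℕ} :
    g ∈ below b G ↔ ∃ h ∈ G, h.1 < b ∧ g = (h.1, min h.2 (b - 1)) := by
  simp only [below, List.mem_filterMap]
  constructor
  · rintro ⟨h, hh, e⟩
    split_ifs at e with c
    exact ⟨h, hh, c, by simpa using e.symm⟩
  · rintro ⟨h, hh, c, rfl⟩
    exact ⟨h, hh, by simp [c]⟩

lemma mem_above_iff {a : ℕ} {G : List (ℕ × ℕ)} {g : ℕ × ℕ} :
    g ∈ above a G ↔ ∃ h ∈ G, a ≤ h.2 ∧ g = (max h.1 a, h.2) := by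
  simp only [above, List.mem_filterMap]
  constructor
  · rintro ⟨h, hh, e⟩
    split_ifs at e with c
    exact ⟨h, hh, c, by simpa using e.symm⟩
  · rintro ⟨h, hh, c, rfl⟩
    exact ⟨h, hh, by simp [c]⟩

lemma mem_below {b l : ℕ} {G : List (ℕ × ℕ)} : Mem l (below b G) ↔ Mem l G ∧ l < b := by
  constructor
  · rintro ⟨g, hg, h1, h2⟩
    obtain ⟨h, hh, c, rfl⟩ := mem_below_iff.1 hg
    simp only [le_min_iff] at h1 h2
    exact ⟨⟨h, hh, h1, h2.1⟩, by omega⟩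
  · rintro ⟨⟨h, hh, h1, h2⟩, hb⟩
    exact ⟨_, mem_below_iff.2 ⟨h, hh, by omega, rfl⟩, h1, le_min h2 (by omega)⟩

lemma mem_above {a l : ℕ} {G : List (ℕ × ℕ)} : Mem l (above a G) ↔ Mem l G ∧ a ≤ l := by
  constructor
  · rintro ⟨g, hg, h1, h2⟩
    obtain ⟨h, hh, c, rfl⟩ := mem_above_iff.1 hg
    simp only [max_le_iff] at h1 h2
    exact ⟨⟨h, hh, h1.1, h2⟩, h1.2⟩
  · rintro ⟨⟨h, hh, h1, h2⟩, hb⟩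
    exact ⟨_, mem_above_iff.2 ⟨h, hh, by omega, rfl⟩, max_le h1 hb, h2⟩

lemma mem_append {l : ℕ} {G H : List (ℕ × ℕ)} : Mem l (G ++ H) ↔ Mem l G ∨ Mem l H := by
  simp only [Mem, List.mem_append]
  constructor
  · rintro ⟨g, h | h, e⟩
    exacts [.inl ⟨g, h, e⟩, .inr ⟨g, h, e⟩]
  · rintro (⟨g, h, e⟩ | ⟨g, h, e⟩)
    exacts [⟨g, .inl h, e⟩, ⟨g, .inr h, e⟩]

lemma Sorted.tail {g G} (h : Sorted (g :: G)) : Sorted G :=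
  ⟨fun x hx => h.1 x (List.mem_cons_of_mem _ hx), (List.pairwise_cons.1 h.2).2⟩

lemma Sorted.below {G} (h : Sorted G) (b : ℕ) : Sorted (below b G) := by
  refine ⟨?_, ?_⟩
  · intro g hg
    obtain ⟨x, hx, c, rfl⟩ := mem_below_iff.1 hg
    have := h.1 x hx
    simp only [le_min_iff]; omega
  · refine List.Pairwise.filterMap _ ?_ h.2
    intro x y hxy x' hx' y' hy'
    split_ifs at hx' hy'
    simp only [Option.some.injEq] at hx' hy'
    subst hx' hy'
    simp only [min_lt_iff]; omega

lemma Sorted.above {G} (h : Sorted G) (b : ℕ) : Sorted (above b G) := by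
  refine ⟨?_, ?_⟩
  · intro g hg
    obtain ⟨x, hx, c, rfl⟩ := mem_above_iff.1 hg
    have := h.1 x hx
    simp only [max_le_iff]; omega
  · refine List.Pairwise.filterMap _ ?_ h.2
    intro x y hxy x' hx' y' hy'
    split_ifs at hx' hy'
    simp only [Option.some.injEq] at hx' hy'
    subst hx' hy'
    simp only [lt_max_iff]; omega

lemma intervalPot_mono {g h : ℕ × ℕ} (h1 : h.1 ≤ g.1) (h2 : g.2 ≤ h.2) :
    intervalPot g ≤ intervalPot h := by
  unfold intervalPot
  have : Nat.log 2 (g.2 + 1 - g.1) ≤ Nat.log 2 (h.2 + 1 - h.1) := Nat.log_mono_right (by omega)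
  omega

lemma listPot_below_le (b G) : listPot (below b G) ≤ listPot G := by
  induction G with
  | nil => simp
  | cons g G ih =>
    rw [below_cons]
    split_ifs
    · have := intervalPot_mono (g := (g.1, min g.2 (b - 1))) (h := g) le_rfl (min_le_left _ _)
      simp; omega
    · simp; omega

lemma listPot_above_le (a G) : listPot (above a G) ≤ listPot G := by
  induction G with
  | nil => simp
  | cons g G ih =>
    rw [above_cons]
    split_ifs
    · have := intervalPot_mono (g := (max g.1 a, g.2)) (h := g) (le_max_left _ _) le_rfl
      simp; omega
    · simp; omega

lemma weight_below_le (b G) : weight (below b G) ≤ weight G := by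
  induction G with
  | nil => simp
  | cons g G ih =>
    rw [below_cons]
    split_ifs
    · have := min_le_left g.2 (b - 1)
      simp; omega
    · simp; omega

lemma weight_above_le (b G) : weight (above b G) ≤ weight G := by
  induction G with
  | nil => simp
  | cons g G ih =>
    rw [above_cons]
    split_ifs
    · have := le_max_left g.1 b
      simp; omega
    · simp; omega

lemma below_eq_nil {b : ℕ} {G} (h : ∀ g ∈ G, b ≤ g.1) : below b G = [] := by
  rw [List.eq_nil_iff_forall_not_mem]
  intro g hg
  obtain ⟨x, hx, c, -⟩ := mem_below_iff.1 hg
  have := h x hx; omega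

lemma above_eq_nil {a : ℕ} {G : List (ℕ × ℕ)} (h : ∀ g ∈ G, g.2 < a) : above a G = [] := by
  rw [List.eq_nil_iff_forall_not_mem]
  intro g hg
  obtain ⟨x, hx, c, -⟩ := mem_above_iff.1 hg
  have := h x hx; omega

/-- Removing the candidates strictly between `x` and `y`. -/
def cut (x y : ℕ) (G : List (ℕ × ℕ)) : List (ℕ × ℕ) := below (x + 1) G ++ above y G

lemma mem_cut {x y l : ℕ} {G} : Mem l (cut x y G) ↔ Mem l G ∧ (l ≤ x ∨ y ≤ l) := by
  rw [cut, mem_append, mem_below, mem_above, Nat.lt_succ_iff]; tauto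

lemma Sorted.cut {G} (h : Sorted G) {x y : ℕ} (hxy : x < y) : Sorted (cut x y G) := by
  refine ⟨?_, List.pairwise_append.2 ⟨(h.below _).2, (h.above _).2, ?_⟩⟩
  · intro g hg
    rcases List.mem_append.1 hg with hg | hg
    exacts [(h.below _).1 g hg, (h.above _).1 g hg]
  · intro g hg g' hg'
    obtain ⟨a, ha, c, rfl⟩ := mem_below_iff.1 hg
    obtain ⟨a', ha', c', rfl⟩ := mem_above_iff.1 hg'
    simp only [min_lt_iff, lt_max_iff]; omega

lemma weight_cut_le {x y : ℕ} (hxy : x < y) (G) : weight (cut x y G) ≤ weight G := by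
  rw [cut, weight_append]
  induction G with
  | nil => simp
  | cons g G ih =>
    rw [below_cons, above_cons]
    have h1 := le_max_left g.1 y
    have h2 := le_max_right g.1 y
    have h3 := min_le_left g.2 x
    have h4 := min_le_right g.2 x
    split_ifs <;> simp <;> omega

/-- Cutting a hole splits at most one interval. -/
lemma listPot_cut_le {x y W : ℕ} (hxy : x < y) {G} (hG : Sorted G)
    (hW : ∀ g ∈ G, intervalPot g ≤ W) : listPot (cut x y G) ≤ listPot G + W := by
  rw [cut, listPot_append]
  induction G with
  | nil => simp
  | cons g G ih =>
    have ih := ih hG.tail fun g' h' => hW g' (List.mem_cons_of_mem _ h')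
    have hp := (List.pairwise_cons.1 hG.2).1
    have hg := hW g List.mem_cons_self
    rw [below_cons, above_cons]
    by_cases hgx : g.2 ≤ x
    · have e : ¬ y ≤ g.2 := by omega
      have := intervalPot_mono (g := (g.1, min g.2 (x + 1 - 1))) (h := g) le_rfl (min_le_left _ _)
      rw [if_neg e]
      split_ifs <;> simp at * <;> omega
    · have e : below (x + 1) G = [] := below_eq_nil fun g' h' => by have := hp g' h'; omega
      have h3 := listPot_above_le y G
      have h4 := intervalPot_mono (g := (g.1, min g.2 (x + 1 - 1))) (h := g) le_rfl (min_le_left _ _)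
      have h5 := intervalPot_mono (g := (max g.1 y, g.2)) (h := g) (le_max_left _ _) le_rfl
      rw [e]
      split_ifs <;> simp at * <;> omega

/-- Enlarging a hole that already separates the intervals splits none of them. -/
lemma listPot_cut_le_of_sep {x y c : ℕ} (hx : x ≤ c) (hy : c < y) {G : List (ℕ × ℕ)}
    (hG : ∀ g ∈ G, g.2 ≤ c ∨ c < g.1) : listPot (cut x y G) ≤ listPot G := by
  rw [cut, listPot_append]
  induction G with
  | nil => simp
  | cons g G ih =>
    have ih := ih fun g' h' => hG g' (List.mem_cons_of_mem _ h')
    have h4 := intervalPot_mono (g := (g.1, min g.2 (x + 1 - 1))) (h := g) le_rfl (min_le_left _ _)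
    have h5 := intervalPot_mono (g := (max g.1 y, g.2)) (h := g) (le_max_left _ _) le_rfl
    rw [below_cons, above_cons]
    rcases hG g List.mem_cons_self with h | h
    · rw [if_neg (show ¬ y ≤ g.2 by omega)]
      split_ifs <;> simp at * <;> omega
    · rw [if_neg (show ¬ g.1 < x + 1 by omega)]
      split_ifs <;> simp at * <;> omega

lemma sep_cut {x y : ℕ} (hxy : x < y) (G : List (ℕ × ℕ)) : ∀ g ∈ cut x y G, g.2 ≤ x ∨ x < g.1 := by
  intro g hg
  rcases List.mem_append.1 hg with hg | hg
  · obtain ⟨a, ha, c, rfl⟩ := mem_below_iff.1 hg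
    left; exact (min_le_right _ _).trans (by omega)
  · obtain ⟨a, ha, c, rfl⟩ := mem_above_iff.1 hg
    right; exact lt_of_lt_of_le hxy (le_max_right _ _)

/-- Every interval of `G'` is contained in an interval of `G`. -/
def Refines (G' G : List (ℕ × ℕ)) : Prop := ∀ g ∈ G', ∃ h ∈ G, h.1 ≤ g.1 ∧ g.2 ≤ h.2

lemma Refines.refl (G) : Refines G G := fun g hg => ⟨g, hg, le_rfl, le_rfl⟩
lemma Refines.trans {G₁ G₂ G₃} (h : Refines G₁ G₂) (h' : Refines G₂ G₃) : Refines G₁ G₃ := by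
  intro g hg
  obtain ⟨a, ha, h1, h2⟩ := h g hg
  obtain ⟨b, hb, h3, h4⟩ := h' a ha
  exact ⟨b, hb, h3.trans h1, h2.trans h4⟩
lemma refines_below (b G) : Refines (below b G) G := by
  intro g hg
  obtain ⟨a, ha, c, rfl⟩ := mem_below_iff.1 hg
  exact ⟨a, ha, le_rfl, min_le_left _ _⟩
lemma refines_above (b G) : Refines (above b G) G := by
  intro g hg
  obtain ⟨a, ha, c, rfl⟩ := mem_above_iff.1 hg
  exact ⟨a, ha, le_max_left _ _, le_rfl⟩
lemma refines_cut (x y G) : Refines (cut x y G) G := by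
  intro g hg
  rcases List.mem_append.1 hg with hg | hg
  exacts [refines_below _ _ g hg, refines_above _ _ g hg]
lemma Refines.pot_le {G' G W} (h : Refines G' G) (hW : ∀ g ∈ G, intervalPot g ≤ W) :
    ∀ g ∈ G', intervalPot g ≤ W := by
  intro g hg
  obtain ⟨a, ha, h1, h2⟩ := h g hg
  exact (intervalPot_mono h1 h2).trans (hW a ha)
lemma Refines.sep {G' G c} (h : Refines G' G) (hc : ∀ g ∈ G, g.2 ≤ c ∨ c < g.1) :
    ∀ g ∈ G', g.2 ≤ c ∨ c < g.1 := by
  intro g hg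
  obtain ⟨a, ha, h1, h2⟩ := h g hg
  rcases hc a ha with e | e
  · left; omega
  · right; omega

/-- `l` is the midpoint of an interval of `G` containing a median of all candidates. -/
def IsPick (G : List (ℕ × ℕ)) (l : ℕ) : Prop :=
  ∃ L₁ g L₂, G = L₁ ++ g :: L₂ ∧ l = (g.1 + g.2) / 2 ∧
    2 * weight L₁ ≤ weight G ∧ 2 * weight L₂ ≤ weight G

lemma exists_isPick {G} (hG : G ≠ []) : ∃ l, IsPick G l := by
  have key : ∀ (L₂ L₁ : List (ℕ × ℕ)), G = L₁ ++ L₂ → L₂ ≠ [] → 2 * weight L₁ ≤ weight G →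
      ∃ l, IsPick G l := by
    intro L₂
    induction L₂ with
    | nil => intro L₁ _ h; exact absurd rfl h
    | cons g L ih =>
      intro L₁ e _ hw
      by_cases h : 2 * weight L ≤ weight G
      · exact ⟨_, L₁, g, L, e, rfl, hw, h⟩
      · refine ih (L₁ ++ [g]) (by simp [e]) ?_ ?_
        · rintro rfl; simp at h
        · have : weight G = weight L₁ + ((g.2 + 1 - g.1) + weight L) := by rw [e]; simp
          simp; omega
  exact key G [] rfl hG (by simp)

lemma IsPick.mem {G l} (h : IsPick G l) (hG : Sorted G) : Mem l G := by
  obtain ⟨L₁, g, L₂, rfl, rfl, -, -⟩ := h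
  have := hG.1 g (by simp)
  exact ⟨g, by simp, by omega, by omega⟩

lemma IsPick.ne_nil {G l} (h : IsPick G l) : G ≠ [] := by
  obtain ⟨L₁, g, L₂, rfl, -⟩ := h; simp

lemma intervalPot_half {g h : ℕ × ℕ} (hh : h.1 ≤ h.2) (hl : 2 * (h.2 + 1 - h.1) ≤ g.2 + 1 - g.1) :
    intervalPot h + 1 ≤ intervalPot g := by
  unfold intervalPot
  have h1 : Nat.log 2 (2 * (h.2 + 1 - h.1)) ≤ Nat.log 2 (g.2 + 1 - g.1) := Nat.log_mono_right hl
  have h2 : Nat.log 2 ((h.2 + 1 - h.1) * 2) = Nat.log 2 (h.2 + 1 - h.1) + 1 :=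
    Nat.log_mul_base (by norm_num) (by omega)
  rw [mul_comm] at h2; omega

lemma intervalPot_pos (g) : 1 ≤ intervalPot g := by unfold intervalPot; omega

/-- The part of an interval below its midpoint has a smaller potential. -/
lemma listPot_below_mid {g : ℕ × ℕ} {b : ℕ} (hb : b ≤ (g.1 + g.2) / 2) :
    listPot (below b [g]) + 1 ≤ intervalPot g := by
  have := intervalPot_pos g
  rw [below_cons]
  split_ifs with h
  · simp only [below_nil, List.append_nil, listPot_cons, listPot_nil, Nat.add_zero]
    have h1 := min_le_left g.2 (b - 1)
    have h2 := min_le_right g.2 (b - 1)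
    have h3 : g.1 ≤ min g.2 (b - 1) := le_min (by omega) (by omega)
    exact intervalPot_half h3 (by simp only; omega)
  · simpa using this

lemma listPot_above_mid {g : ℕ × ℕ} {a : ℕ} (ha : (g.1 + g.2) / 2 < a) :
    listPot (above a [g]) + 1 ≤ intervalPot g := by
  have := intervalPot_pos g
  rw [above_cons]
  split_ifs with h
  · simp only [above_nil, List.append_nil, listPot_cons, listPot_nil, Nat.add_zero]
    have h1 := le_max_left g.1 a
    have h2 := le_max_right g.1 a
    have h3 : max g.1 a ≤ g.2 := max_le (by omega) (by omega)
    exact intervalPot_half h3 (by simp only; omega)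
  · simpa using this

lemma listPot_pick_below {G l b} (h : IsPick G l) (hb : b ≤ l) :
    listPot (below b G) + 1 ≤ listPot G := by
  obtain ⟨L₁, g, L₂, rfl, rfl, -, -⟩ := h
  have h1 := listPot_below_mid hb
  have h2 := listPot_below_le b L₁
  have h3 := listPot_below_le b L₂
  rw [below_append, ← List.singleton_append, below_append]
  simp only [listPot_append, listPot_cons, listPot_nil] at *; omega

lemma listPot_pick_above {G l a} (h : IsPick G l) (ha : l < a) :
    listPot (above a G) + 1 ≤ listPot G := by
  obtain ⟨L₁, g, L₂, rfl, rfl, -, -⟩ := h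
  have h1 := listPot_above_mid ha
  have h2 := listPot_above_le a L₁
  have h3 := listPot_above_le a L₂
  rw [above_append, ← List.singleton_append, above_append]
  simp only [listPot_append, listPot_cons, listPot_nil] at *; omega

lemma Sorted.pick {L₁ g L₂} (h : Sorted (L₁ ++ g :: L₂)) :
    (∀ x ∈ L₁, x.2 < g.1) ∧ (∀ x ∈ L₂, g.2 < x.1) ∧ g.1 ≤ g.2 := by
  have h2 := List.pairwise_append.1 h.2
  exact ⟨fun x hx => h2.2.2 x hx g (by simp), (List.pairwise_cons.1 h2.2.1).1, h.1 g (by simp)⟩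

/-- A new hole around the pick halves both parts of the interval that it splits. -/
lemma listPot_pick_cut {G l x y W} (h : IsPick G l) (hG : Sorted G) (hx : x < l) (hy : l < y)
    (hW : ∀ g ∈ G, intervalPot g ≤ W) : listPot (cut x y G) + 1 ≤ listPot G + W := by
  obtain ⟨L₁, g, L₂, rfl, rfl, -, -⟩ := h
  obtain ⟨p1, p2, p3⟩ := hG.pick
  have h1 := listPot_below_mid (g := g) (b := x + 1) hx
  have h2 := listPot_above_mid hy
  have h3 := listPot_below_le (x + 1) L₁
  have h4 := listPot_above_le y L₂
  have h5 : below (x + 1) L₂ = [] := below_eq_nil fun g' h' => by have := p2 g' h'; omega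
  have h6 : above y L₁ = [] := above_eq_nil fun g' h' => by have := p1 g' h'; omega
  have h7 := hW g (by simp)
  rw [cut, below_append, ← List.singleton_append, below_append, above_append, above_append, h5, h6]
  simp only [listPot_append, listPot_cons, listPot_nil] at *; omega

/-- If the intervals were separated inside the hole before, then each of them keeps at most one of its
parts, so that the potential decreases without an extra charge. -/
lemma listPot_pick_cut_of_sep {G l x y c} (h : IsPick G l) (hx : x < l) (hy : l < y)
    (hc : x ≤ c) (hc' : c < y) (hs : ∀ g ∈ G, g.2 ≤ c ∨ c < g.1) :
    listPot (cut x y G) + 1 ≤ listPot G := by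
  obtain ⟨L₁, g, L₂, rfl, rfl, -, -⟩ := h
  have h1 := listPot_below_mid (g := g) (b := x + 1) hx
  have h2 := listPot_above_mid hy
  have h3 := listPot_cut_le_of_sep hc hc' (G := L₁) fun g' h' => hs g' (by simp [h'])
  have h4 := listPot_cut_le_of_sep hc hc' (G := L₂) fun g' h' => hs g' (by simp [h'])
  have h5 : listPot (cut x y [g]) + 1 ≤ intervalPot g := by
    have h7 := intervalPot_pos g
    rw [cut, listPot_append]
    rcases hs g (by simp) with h | h
    · have : above y [g] = [] := above_eq_nil fun g' h' => by
        rw [List.mem_singleton.1 h']; omega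
      rw [this]; simpa using h1
    · have : below (x + 1) [g] = [] := below_eq_nil fun g' h' => by
        rw [List.mem_singleton.1 h']; omega
      rw [this]; simpa using h2
  simp only [cut] at *
  rw [below_append, ← List.singleton_append, below_append, above_append, above_append]
  simp only [listPot_append, listPot_cons, listPot_nil] at *; omega

/-- The pick is a weighted median: a failure leaves at most three quarters of the candidates. -/
lemma weight_pick_below {G l} (h : IsPick G l) (hG : Sorted G) :
    4 * weight (below l G) ≤ 3 * weight G := by
  obtain ⟨L₁, g, L₂, rfl, rfl, w1, w2⟩ := h
  obtain ⟨p1, p2, p3⟩ := hG.pick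
  -- the intervals after `g` vanish, and so does half of `g`; the median property bounds the rest
  have h1 := weight_below_le ((g.1 + g.2) / 2) L₁
  have h5 : below ((g.1 + g.2) / 2) L₂ = [] := below_eq_nil fun g' h' => by have := p2 g' h'; omega
  have h6 : 2 * weight (below ((g.1 + g.2) / 2) [g]) ≤ g.2 + 1 - g.1 := by
    rw [below_cons]
    have h1 := min_le_right g.2 ((g.1 + g.2) / 2 - 1)
    split_ifs
    · simp; omega
    · simp
  rw [below_append, ← List.singleton_append, below_append, h5]
  simp only [weight_append, weight_cons, weight_nil] at *; omega

lemma weight_pick_above {G l} (h : IsPick G l) (hG : Sorted G) :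
    4 * weight (above (l + 1) G) ≤ 3 * weight G := by
  obtain ⟨L₁, g, L₂, rfl, rfl, w1, w2⟩ := h
  obtain ⟨p1, p2, p3⟩ := hG.pick
  -- the intervals before `g` vanish, and so does half of `g`; the median property bounds the rest
  have h1 := weight_above_le ((g.1 + g.2) / 2 + 1) L₂
  have h5 : above ((g.1 + g.2) / 2 + 1) L₁ = [] :=
    above_eq_nil fun g' h' => by have := p1 g' h'; omega
  have h6 : 2 * weight (above ((g.1 + g.2) / 2 + 1) [g]) ≤ g.2 + 1 - g.1 := by
    rw [above_cons]
    have h1 := le_max_right g.1 ((g.1 + g.2) / 2 + 1)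
    split_ifs
    · simp; omega
    · simp
  rw [above_append, ← List.singleton_append, above_append, h5]
  simp only [weight_append, weight_cons, weight_nil] at *; omega

lemma weight_le_of_sorted {G} (hG : Sorted G) : ∀ {a b : ℕ}, (∀ g ∈ G, a ≤ g.1 ∧ g.2 ≤ b) →
    a ≤ b + 1 → weight G ≤ b + 1 - a := by
  induction G with
  | nil => intros; simp
  | cons g G ih =>
    intro a b h _
    obtain ⟨h1, h2⟩ := h g List.mem_cons_self
    have hp := (List.pairwise_cons.1 hG.2).1
    have h3 := hG.1 g List.mem_cons_self
    have := ih hG.tail (a := g.2 + 1) (b := b)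
      (fun g' h' => ⟨hp g' h', (h g' (List.mem_cons_of_mem _ h')).2⟩) (by omega)
    simp; omega

/-- The number of times a quantity can shrink to three quarters, from `w`, before it vanishes. -/
def shrinks (w : ℕ) : ℕ := sInf {r | w * 3 ^ r < 4 ^ r}

lemma shrinks_le {w s : ℕ} (h : w < 2 ^ s) : shrinks w ≤ 3 * s := by
  apply Nat.sInf_le
  show w * 3 ^ (3 * s) < 4 ^ (3 * s)
  rw [pow_mul, pow_mul]
  calc w * (3 ^ 3) ^ s < 2 ^ s * (3 ^ 3) ^ s := by gcongr
    _ = 54 ^ s := by rw [← mul_pow]; norm_num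
    _ ≤ (4 ^ 3) ^ s := Nat.pow_le_pow_left (by norm_num) _

lemma shrinks_spec (w : ℕ) : w * 3 ^ shrinks w < 4 ^ shrinks w := by
  apply Nat.sInf_mem (s := {r | w * 3 ^ r < 4 ^ r})
  refine ⟨3 * w, ?_⟩
  show w * 3 ^ (3 * w) < 4 ^ (3 * w)
  rw [pow_mul, pow_mul]
  calc w * (3 ^ 3) ^ w < 2 ^ w * (3 ^ 3) ^ w := by gcongr; exact Nat.lt_two_pow_self
    _ = 54 ^ w := by rw [← mul_pow]; norm_num
    _ ≤ (4 ^ 3) ^ w := Nat.pow_le_pow_left (by norm_num) _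

lemma shrinks_mono {w w' : ℕ} (h : w ≤ w') : shrinks w ≤ shrinks w' :=
  Nat.sInf_le (lt_of_le_of_lt (Nat.mul_le_mul_right _ h) (shrinks_spec w'))

lemma shrinks_lt {w w' : ℕ} (h : 4 * w' ≤ 3 * w) (hw : 1 ≤ w) : shrinks w' + 1 ≤ shrinks w := by
  have h0 := shrinks_spec w
  rcases e : shrinks w with _ | r
  · rw [e] at h0; simp at h0; omega
  · rw [e, pow_succ, pow_succ] at h0
    have : shrinks w' ≤ r := Nat.sInf_le (show w' * 3 ^ r < 4 ^ r by nlinarith [pow_pos (show 0 < 3 by norm_num) r])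
    omega

variable {n : ℕ}

/-! ### Feasible outputs and thresholds -/

/-- The least threshold that permits a node outside the output to have observed `x`. -/
def scaleDown (ε : ℝ) (x : ℕ) : ℕ := ⌈(1 - ε) * x⌉₊

/-- The largest value permitted outside the output by the threshold `l`. -/
def scaleUp (ε : ℝ) (l : ℕ) : ℕ := ⌊(l : ℝ) / (1 - ε)⌋₊

lemma scaleDown_le_iff {ε : ℝ} {x l : ℕ} : scaleDown ε x ≤ l ↔ (1 - ε) * x ≤ l := Nat.ceil_le

lemma le_scaleUp_iff {ε : ℝ} (hε : ε < 1) {x l : ℕ} : x ≤ scaleUp ε l ↔ scaleDown ε x ≤ l := by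
  have h : 0 < 1 - ε := by linarith
  rw [scaleDown_le_iff, scaleUp, Nat.le_floor_iff (by positivity), le_div_iff₀ h, mul_comm]

lemma scaleUp_lt_iff {ε : ℝ} (hε : ε < 1) {x l : ℕ} : scaleUp ε l < x ↔ l < scaleDown ε x := by
  rw [← not_le, le_scaleUp_iff hε, not_le]

lemma scaleDown_mono {ε : ℝ} (hε : ε < 1) {x y : ℕ} (h : x ≤ y) :
    scaleDown ε x ≤ scaleDown ε y := by
  have h0 : 0 ≤ 1 - ε := by linarith
  exact Nat.ceil_mono (by gcongr)

lemma scaleDown_le_self {ε : ℝ} (hε : 0 < ε) (x : ℕ) : scaleDown ε x ≤ x := by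
  rw [scaleDown_le_iff]
  have : (0 : ℝ) ≤ x := by positivity
  nlinarith

/-- The `k`-th largest of the numbers `f i`, `i ∈ S`. -/
def kth (k : ℕ) (S : Finset (Fin n)) (f : Fin n → ℕ) : ℕ :=
  sSup {t | k ≤ (S.filter fun i => t ≤ f i).card}

lemma kth_bddAbove {k : ℕ} (hk : 1 ≤ k) (S : Finset (Fin n)) (f : Fin n → ℕ) :
    BddAbove {t | k ≤ (S.filter fun i => t ≤ f i).card} := by
  refine ⟨S.sup f, fun t ht => ?_⟩
  obtain ⟨i, hi⟩ := Finset.card_pos.1 (lt_of_lt_of_le hk ht)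
  rw [Finset.mem_filter] at hi
  exact hi.2.trans (Finset.le_sup hi.1)

lemma le_kth {k : ℕ} (hk : 1 ≤ k) {S : Finset (Fin n)} {f : Fin n → ℕ} {t : ℕ}
    (h : k ≤ (S.filter fun i => t ≤ f i).card) : t ≤ kth k S f :=
  le_csSup (kth_bddAbove hk S f) h

lemma card_of_le_kth {k : ℕ} (hk : 1 ≤ k) {S : Finset (Fin n)} (hS : k ≤ S.card) {f : Fin n → ℕ}
    {t : ℕ} (h : t ≤ kth k S f) : k ≤ (S.filter fun i => t ≤ f i).card := by
  have h1 : kth k S f ∈ {t | k ≤ (S.filter fun i => t ≤ f i).card} :=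
    Nat.sSup_mem ⟨0, by simpa using hS⟩ (kth_bddAbove hk S f)
  refine le_trans h1 (Finset.card_le_card fun i hi => ?_)
  rw [Finset.mem_filter] at hi ⊢
  exact ⟨hi.1, h.trans hi.2⟩

lemma kth_le_of_forall {k : ℕ} (hk : 1 ≤ k) {S : Finset (Fin n)} (hS : k ≤ S.card)
    {f : Fin n → ℕ} {b : ℕ} (h : ∀ i ∈ S, f i ≤ b) : kth k S f ≤ b := by
  obtain ⟨i, hi⟩ := Finset.card_pos.1 (lt_of_lt_of_le hk (card_of_le_kth hk hS le_rfl))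
  rw [Finset.mem_filter] at hi
  exact hi.2.trans (h i hi.1)

lemma kthLargest_eq (k : ℕ) (v : Values n) : kthLargest k v = kth k Finset.univ v := rfl

lemma le_kthLargest_iff {k : ℕ} (hk : 1 ≤ k) (hn : k ≤ n) {v : Values n} {t : ℕ} :
    t ≤ kthLargest k v ↔ k ≤ (Finset.univ.filter fun i => t ≤ v i).card := by
  rw [kthLargest_eq]
  exact ⟨card_of_le_kth hk (by simpa using hn), le_kth hk⟩

lemma kthLargest_le_maxValue {k : ℕ} (hk : 1 ≤ k) (hn : k ≤ n) (v : Values n) :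
    kthLargest k v ≤ maxValue v :=
  kth_le_of_forall hk (by simpa using hn) fun i _ => Finset.le_sup (Finset.mem_univ i)

lemma le_maxValue (v : Values n) (i : Fin n) : v i ≤ maxValue v := Finset.le_sup (Finset.mem_univ i)

/-- The output `F` and the threshold `l` are compatible with nodes that have observed values
between `m i` and `M i`: filters `[l, ∞)` inside `F` and `[0, l / (1 - ε)]` outside are respected. -/
def Feas (ε : ℝ) (k : ℕ) (m M : Fin n → ℕ) (F : Finset (Fin n)) (l : ℕ) : Prop :=
  F.card = k ∧ (∀ i ∈ F, l ≤ m i) ∧ ∀ j ∉ F, scaleDown ε (M j) ≤ l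

lemma Feas.anti {ε : ℝ} (hε : ε < 1) {k : ℕ} {m M m' M' : Fin n → ℕ} {F l}
    (h : Feas ε k m M F l) (hm : ∀ i, m i ≤ m' i) (hM : ∀ i, M' i ≤ M i) : Feas ε k m' M' F l :=
  ⟨h.1, fun i hi => (h.2.1 i hi).trans (hm i),
    fun j hj => (scaleDown_mono hε (hM j)).trans (h.2.2 j hj)⟩

/-- Filters with a common threshold certify a correct output. -/
lemma Feas.isOutput {ε : ℝ} (h0 : 0 < ε) (hε : ε < 1) {k : ℕ} (hk : 1 ≤ k) (hn : k ≤ n)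
    {v : Values n} {F l} (h : Feas ε k v v F l) : IsOutput ε k v F := by
  have hp : 0 < 1 - ε := by linarith
  set z := kthLargest k v with hz
  have hT : k ≤ (Finset.univ.filter fun i => z ≤ v i).card := (le_kthLargest_iff hk hn).1 le_rfl
  have hlow : ∀ i ∈ F, (1 - ε) * (z : ℝ) ≤ v i := by
    intro i hi
    by_cases hiz : z ≤ v i
    · have : (z : ℝ) ≤ v i := by exact_mod_cast hiz
      have : (0 : ℝ) ≤ z := by positivity
      nlinarith
    · obtain ⟨j, hjT, hjF⟩ : ∃ j ∈ Finset.univ.filter (fun i => z ≤ v i), j ∉ F := by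
        by_contra! hc
        -- otherwise `F` would contain all `k` nodes above `z` and also `i`
        have hss : insert i (Finset.univ.filter fun i => z ≤ v i) ⊆ F :=
          Finset.insert_subset hi hc
        have := Finset.card_le_card hss
        rw [Finset.card_insert_of_notMem (by simpa using hiz), h.1] at this
        omega
      have hj : z ≤ v j := (Finset.mem_filter.1 hjT).2
      have h1 := scaleDown_le_iff.1 ((scaleDown_mono hε hj).trans (h.2.2 j hjF))
      have h2 : (l : ℝ) ≤ v i := by exact_mod_cast h.2.1 i hi
      linarith
  have hcl : clearlyLarger ε k v ⊆ F := by
    intro j hj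
    by_contra hjF
    have hj' : 1 / (1 - ε) * (z : ℝ) < v j := (Finset.mem_filter.1 hj).2
    have hl : (z : ℝ) < l := by
      have h1 := scaleDown_le_iff.1 (h.2.2 j hjF)
      rw [one_div, inv_mul_lt_iff₀ hp] at hj'
      linarith
    have hl' : z + 1 ≤ l := by exact_mod_cast hl
    have h3 : z + 1 ≤ z := (le_kthLargest_iff hk hn).2 <| by
      rw [← h.1]
      refine Finset.card_le_card fun i hi => ?_
      simpa using hl'.trans (h.2.1 i hi)
    omega
  refine ⟨h.1, F \ clearlyLarger ε k v, ?_, (Finset.union_sdiff_of_subset hcl).symm⟩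
  intro i hi
  rw [Finset.mem_sdiff] at hi
  refine Finset.mem_filter.2 ⟨Finset.mem_univ _, hlow i hi.1, ?_⟩
  by_contra hc
  exact hi.2 (Finset.mem_filter.2 ⟨Finset.mem_univ _, not_le.1 hc⟩)

/-- The `k`-th largest value is always a feasible threshold. -/
lemma exists_feas {ε : ℝ} (h0 : 0 < ε) {k : ℕ} (hk : 1 ≤ k) (hn : k ≤ n)
    (v : Values n) : ∃ F, Feas ε k v v F (kthLargest k v) := by
  set z := kthLargest k v with hz
  have hT : k ≤ (Finset.univ.filter fun i => z ≤ v i).card := (le_kthLargest_iff hk hn).1 le_rfl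
  have hT' : (Finset.univ.filter fun i => z + 1 ≤ v i).card ≤ k := by
    by_contra! hc
    have : z + 1 ≤ z := (le_kthLargest_iff hk hn).2 hc.le
    omega
  obtain ⟨F, h1, h2, h3⟩ := Finset.exists_subsuperset_card_eq
    (show (Finset.univ.filter fun i => z + 1 ≤ v i) ⊆ Finset.univ.filter fun i => z ≤ v i from
      fun i hi => by simp at hi ⊢; omega) hT' hT
  refine ⟨F, h3, fun i hi => by simpa using h2 hi, fun j hj => ?_⟩
  refine (scaleDown_le_self h0 _).trans ?_
  by_contra hc
  exact hj (h1 (by simp; omega))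

/-! ### Lower bounds for the offline cost -/

/-- A valid set of filters containing `m i` and `M i` yields a feasible output. -/
lemma feas_of_isFilterSet {ε : ℝ} (hε : ε < 1) {k : ℕ} (hk : 1 ≤ k) {v m M : Fin n → ℕ}
    {F : Finset (Fin n)} {I : Fin n → Interval} (hF : F.card = k) (h : IsFilterSet ε v F I)
    (hI : ∀ i, (I i).Contains (m i) ∧ (I i).Contains (M i)) : ∃ l, Feas ε k m M F l := by
  have hne : F.Nonempty := Finset.card_pos.1 (by omega)
  obtain ⟨i₀, hi₀, hmin⟩ := Finset.exists_min_image F (fun i => (I i).lo) hne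
  refine ⟨(I i₀).lo, hF, fun i hi => (hmin i hi).trans (hI i).1.1, fun j hj => ?_⟩
  rw [scaleDown_le_iff]
  have h1 := h.2 i₀ hi₀ j hj
  have h2 : ((M j : ℕ) : ℝ≥0∞) ≤ ((I j).hi : ℝ≥0∞) := by
    have := (hI j).2.2
    calc ((M j : ℕ) : ℝ≥0∞) = (((M j : ℕ) : ℕ∞) : ℝ≥0∞) := by simp
      _ ≤ _ := by exact_mod_cast this
  have h3 : ENNReal.ofReal (1 - ε) * ((M j : ℕ) : ℝ≥0∞) ≤ ((I i₀).lo : ℝ≥0∞) :=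
    (mul_le_mul_right h2 _).trans h1
  have hp : 0 ≤ 1 - ε := by linarith
  rw [← ENNReal.ofReal_natCast, ← ENNReal.ofReal_natCast, ← ENNReal.ofReal_mul hp] at h3
  exact (ENNReal.ofReal_le_ofReal_iff (by positivity)).1 h3

lemma exists_offline {T : ℕ} {ε : ℝ} (h0 : 0 < ε) (hε : ε < 1) {k : ℕ} (hk : 1 ≤ k) (hn : k ≤ n)
    (v : Fin T → Values n) : Nonempty (Offline ε k v) := by
  choose F hF using fun t => exists_feas (ε := ε) h0 hk hn (v t)
  -- filters that consist of the present values only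
  refine ⟨⟨F, fun t i => ⟨v t i, v t i⟩, fun t => (hF t).isOutput h0 hε hk hn, fun t =>
    ⟨fun i => ⟨le_rfl, le_rfl⟩, fun i hi j hj => ?_⟩⟩⟩
  have h1 := scaleDown_le_iff.1 (((hF t).2.2 j hj).trans ((hF t).2.1 i hi))
  have hp : 0 ≤ 1 - ε := by linarith
  show ENNReal.ofReal (1 - ε) * (((v t j : ℕ) : ℕ∞) : ℝ≥0∞) ≤ ((v t i : ℕ) : ℝ≥0∞)
  rw [ENat.toENNReal_coe, ← ENNReal.ofReal_natCast, ← ENNReal.ofReal_natCast,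
    ← ENNReal.ofReal_mul hp]
  exact ENNReal.ofReal_le_ofReal h1

lemma exists_updates_eq_opt {T : ℕ} {ε : ℝ} (h0 : 0 < ε) (hε : ε < 1) {k : ℕ} (hk : 1 ≤ k)
    (hn : k ≤ n) (v : Fin T → Values n) : ∃ S : Offline ε k v, S.updates = opt ε k v := by
  obtain ⟨S⟩ := exists_offline h0 hε hk hn v
  exact Nat.sInf_mem (s := {m : ℕ | ∃ S : Offline ε k v, S.updates = m}) ⟨_, S, rfl⟩

/-- The offline algorithm on the input without the last time step. -/
def restrict {T : ℕ} {ε : ℝ} {k : ℕ} {v : Fin (T + 1) → Values n} (S : Offline ε k v) :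
    Offline ε k fun t : Fin T => v t.castSucc where
  output := fun t => S.output t.castSucc
  filter := fun t => S.filter t.castSucc
  output_correct _ := S.output_correct _
  filter_valid _ := S.filter_valid _

open Classical in
lemma updates_restrict {T : ℕ} {ε : ℝ} {k : ℕ} {v : Fin (T + 1) → Values n} (S : Offline ε k v) :
    S.updates = (restrict S).updates +
      if ∀ s : Fin T, (s : ℕ) + 1 = T → S.filter s.castSucc ≠ S.filter (Fin.last T)
        then 1 else 0 := by
  unfold Offline.updates
  rw [Finset.card_filter, Finset.card_filter, Fin.sum_univ_castSucc]
  have key : ∀ t : Fin (T + 1), (∀ s : Fin (T + 1), (s : ℕ) + 1 = (t : ℕ) →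
      S.filter s ≠ S.filter t) ↔
      ∀ s : Fin T, (s : ℕ) + 1 = (t : ℕ) → S.filter s.castSucc ≠ S.filter t := by
    intro t
    constructor
    · intro h s hs
      exact h s.castSucc (by simpa using hs)
    · intro h s hs
      have hsT : (s : ℕ) < T := by have := t.2; omega
      simpa using h ⟨s, hsT⟩ (by simpa using hs)
  congr 1
  · refine Finset.sum_congr rfl fun t _ => ?_
    exact if_congr (key t.castSucc) rfl rfl
  · exact if_congr (key (Fin.last T)) rfl rfl

lemma one_le_updates {T : ℕ} {ε : ℝ} {k : ℕ} {v : Fin (T + 1) → Values n} (S : Offline ε k v) :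
    1 ≤ S.updates := by
  classical
  refine Finset.card_pos.2 ⟨0, ?_⟩
  simp

/-- Every offline algorithm on the input `v` has made more than `p` updates, or at least `p` updates
and its present filters contain `m i` and `M i`. -/
def Tracks {T : ℕ} (ε : ℝ) (k : ℕ) (v : Fin T → Values n) (p : ℕ) (m M : Fin n → ℕ) : Prop :=
  ∀ S : Offline ε k v, p + 1 ≤ S.updates ∨ (p ≤ S.updates ∧
    ∀ t : Fin T, (t : ℕ) + 1 = T → ∀ i,
      (S.filter t i).Contains (m i) ∧ (S.filter t i).Contains (M i))

lemma Tracks.le_opt {T : ℕ} {ε : ℝ} (h0 : 0 < ε) (hε : ε < 1) {k : ℕ} (hk : 1 ≤ k) (hn : k ≤ n)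
    {v : Fin T → Values n} {p m M} (h : Tracks ε k v p m M) : p ≤ opt ε k v := by
  obtain ⟨S, hS⟩ := exists_updates_eq_opt h0 hε hk hn v
  rcases h S with h | h <;> omega

lemma one_le_opt {T : ℕ} {ε : ℝ} (h0 : 0 < ε) (hε : ε < 1) {k : ℕ} (hk : 1 ≤ k) (hn : k ≤ n)
    (v : Fin (T + 1) → Values n) : 1 ≤ opt ε k v := by
  obtain ⟨S, hS⟩ := exists_updates_eq_opt h0 hε hk hn v
  exact hS ▸ one_le_updates S

lemma contains_min {I : Interval} {a b : ℕ} (ha : I.Contains a) (hb : I.Contains b) :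
    I.Contains (min a b) := by
  rcases min_choice a b with h | h <;> rw [h] <;> assumption

lemma contains_max {I : Interval} {a b : ℕ} (ha : I.Contains a) (hb : I.Contains b) :
    I.Contains (max a b) := by
  rcases max_choice a b with h | h <;> rw [h] <;> assumption

/-- As long as the filters of the offline algorithm do not change, they contain all values observed. -/
lemma Tracks.extend {T : ℕ} {ε : ℝ} {k : ℕ} {v : Fin (T + 1) → Values n} {p m M}
    (h : Tracks ε k (fun t : Fin T => v t.castSucc) p m M) :
    Tracks ε k v p (fun i => min (m i) (v (Fin.last T) i))
      fun i => max (M i) (v (Fin.last T) i) := by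
  classical
  intro S
  have hu := updates_restrict S
  have h := h (restrict S)
  split_ifs at hu with hc
  · left; rcases h with h | h <;> omega
  · rcases h with h | ⟨h, h'⟩
    · left; omega
    · right
      refine ⟨by omega, fun t ht i => ?_⟩
      push Not at hc
      obtain ⟨s, hs, hf⟩ := hc
      obtain rfl : t = Fin.last T := Fin.ext (by simpa using ht)
      have h2 := h' s hs i
      have h3 : (restrict S).filter s = S.filter (Fin.last T) := hf
      rw [h3] at h2
      have h4 := (S.filter_valid (Fin.last T)).1 i
      exact ⟨contains_min h2.1 h4, contains_max h2.2 h4⟩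

/-- If no output is feasible for the values of a phase, then the offline algorithm has updated its
filters during the phase. The first phase charges the first assignment of filters. -/
lemma Tracks.restart {T : ℕ} {ε : ℝ} (hε : ε < 1) {k : ℕ} (hk : 1 ≤ k)
    {v : Fin (T + 1) → Values n} {p m M} (h : Tracks ε k (fun t : Fin T => v t.castSucc) p m M)
    (hp : p = 0 ∨ ∀ F l, ¬ Feas ε k (fun i => min (m i) (v (Fin.last T) i))
      (fun i => max (M i) (v (Fin.last T) i)) F l) :
    Tracks ε k v (p + 1) (v (Fin.last T)) (v (Fin.last T)) := by
  classical
  intro S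
  right
  refine ⟨?_, fun t ht i => ?_⟩
  · rcases hp with rfl | hp
    · exact one_le_updates S
    · have h1 := h.extend S
      rcases h1 with h1 | ⟨-, h1⟩
      · exact h1
      · obtain ⟨l, hl⟩ := feas_of_isFilterSet hε hk (S.output_correct (Fin.last T)).1
          (S.filter_valid (Fin.last T)) (h1 (Fin.last T) (by simp))
        exact absurd hl (hp _ _)
  · obtain rfl : t = Fin.last T := Fin.ext (by simpa using ht)
    have h4 := (S.filter_valid (Fin.last T)).1 i
    exact ⟨h4, h4⟩

/-! ### Expectations and independent coins -/

section Expect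
variable {α β : Type}

lemma expect_pure (a : α) (f : α → ℝ≥0∞) : expect (PMF.pure a) f = f a := by
  classical
  unfold expect
  rw [tsum_eq_single a]
  · simp
  · intro b hb; simp [hb]

lemma expect_bind (p : PMF α) (g : α → PMF β) (f : β → ℝ≥0∞) :
    expect (p.bind g) f = expect p fun a => expect (g a) f := by
  unfold expect
  simp_rw [PMF.bind_apply, ← ENNReal.tsum_mul_right, ← ENNReal.tsum_mul_left, mul_assoc]
  exact ENNReal.tsum_comm

lemma expect_map (p : PMF α) (g : α → β) (f : β → ℝ≥0∞) :
    expect (p.map g) f = expect p fun a => f (g a) := by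
  rw [← PMF.bind_pure_comp, expect_bind]
  simp [Function.comp, expect_pure]

lemma expect_mono {p : PMF α} {f g : α → ℝ≥0∞} (h : ∀ a ∈ p.support, f a ≤ g a) :
    expect p f ≤ expect p g := by
  refine ENNReal.tsum_le_tsum fun a => ?_
  by_cases ha : p a = 0
  · simp [ha]
  · exact mul_le_mul_right (h a ((PMF.mem_support_iff _ _).2 ha)) _

lemma expect_add (p : PMF α) (f g : α → ℝ≥0∞) :
    expect p (fun a => f a + g a) = expect p f + expect p g := by
  unfold expect
  simp_rw [mul_add]
  exact ENNReal.tsum_add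

lemma expect_const (p : PMF α) (c : ℝ≥0∞) : expect p (fun _ => c) = c := by
  unfold expect
  rw [ENNReal.tsum_mul_right, PMF.tsum_coe, one_mul]

end Expect

lemma independent_apply {α : Type} : ∀ {n : ℕ} (p : Fin n → PMF α) (f : Fin n → α),
    independent p f = ∏ i, p i (f i)
  | 0, p, f => by
    classical
    simp only [independent, Finset.univ_eq_empty, Finset.prod_empty]
    rw [Subsingleton.elim f Fin.elim0]
    simp
  | n + 1, p, f => by
    classical
    rw [independent, PMF.bind_apply, Fin.prod_univ_succ, tsum_eq_single (f 0)]
    · congr 1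
      rw [PMF.bind_apply, tsum_eq_single (Fin.tail f)]
      · rw [independent_apply, PMF.pure_apply, if_pos (Fin.cons_self_tail f).symm, mul_one]
        rfl
      · intro g hg
        rw [PMF.pure_apply, if_neg, mul_zero]
        intro hf
        exact hg (by rw [hf, Fin.tail_cons])
    · intro a ha
      rw [PMF.bind_apply, ENNReal.tsum_eq_zero.2, mul_zero]
      intro g
      rw [PMF.pure_apply, if_neg, mul_zero]
      intro hf
      exact ha (by rw [hf, Fin.cons_zero])

lemma independent_map {α β : Type} : ∀ {n : ℕ} (p : Fin n → PMF α) (f : Fin n → α → β),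
    independent (fun i => (p i).map (f i)) = (independent p).map fun S i => f i (S i)
  | 0, p, f => by
    simp only [independent, PMF.pure_map]
    congr 1
    exact Subsingleton.elim _ _
  | n + 1, p, f => by
    simp only [independent]
    rw [PMF.bind_map, PMF.map_bind]
    congr 1
    funext a
    simp only [Function.comp]
    rw [independent_map (fun i => p i.succ) (fun i => f i.succ), PMF.bind_map, PMF.map_bind]
    congr 1
    funext g
    simp only [Function.comp, PMF.pure_map]
    congr 1
    funext i
    refine Fin.cases ?_ (fun j => ?_) i <;> simp

/-- The probability of a result of a coin that shows `true` with probability `q`. -/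
def coinWeight (q : unitInterval) (b : Bool) : ℝ := if b then q else 1 - q

lemma coinWeight_nonneg (q b) : 0 ≤ coinWeight q b := by
  unfold coinWeight
  split_ifs
  · exact q.2.1
  · linarith [q.2.2]

@[simp] lemma coinWeight_true (q : unitInterval) : coinWeight q true = q := rfl
@[simp] lemma coinWeight_false (q : unitInterval) : coinWeight q false = 1 - q := rfl

/-- A coin that shows `true` with probability `q`. -/
def coin (q : unitInterval) : PMF Bool :=
  PMF.ofFintype (fun b => ENNReal.ofReal (coinWeight q b)) <| by
    rw [Fintype.sum_bool, ← ENNReal.ofReal_add (coinWeight_nonneg _ _) (coinWeight_nonneg _ _)]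
    simp

/-- The outcome `S` of the coins has positive probability. -/
def Possible (q : Fin n → unitInterval) (S : Fin n → Bool) : Prop :=
  ∀ i, coinWeight (q i) (S i) ≠ 0

lemma Possible.of_eq_zero {q : Fin n → unitInterval} {S} (h : Possible q S) {i} (hi : q i = 0) :
    S i = false := by
  by_contra hc
  have := h i
  rw [Bool.eq_true_of_not_eq_false hc] at this
  simp [hi] at this

lemma Possible.of_eq_one {q : Fin n → unitInterval} {S} (h : Possible q S) {i} (hi : q i = 1) :
    S i = true := by
  by_contra hc
  have := h i
  rw [Bool.eq_false_of_not_eq_true hc] at this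
  simp [hi] at this

lemma possible_of_mem_support {q : Fin n → unitInterval} {S : Fin n → Bool}
    (h : S ∈ (independent fun i => coin (q i)).support) : Possible q S := by
  rw [PMF.mem_support_iff, independent_apply] at h
  intro i hi
  refine h (Finset.prod_eq_zero (Finset.mem_univ i) ?_)
  simp [coin, hi]

/-- The expectation of a function of independent coins. -/
def avg (q : Fin n → unitInterval) (f : (Fin n → Bool) → ℝ) : ℝ :=
  ∑ S, (∏ i, coinWeight (q i) (S i)) * f S

lemma prod_coinWeight_nonneg (q : Fin n → unitInterval) (S : Fin n → Bool) :
    0 ≤ ∏ i, coinWeight (q i) (S i) := Finset.prod_nonneg fun _ _ => coinWeight_nonneg _ _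

lemma expect_coins (q : Fin n → unitInterval) {f : (Fin n → Bool) → ℝ} (hf : ∀ S, 0 ≤ f S) :
    expect (independent fun i => coin (q i)) (fun S => ENNReal.ofReal (f S)) =
      ENNReal.ofReal (avg q f) := by
  unfold expect avg
  rw [tsum_fintype, ENNReal.ofReal_sum_of_nonneg fun S _ =>
    mul_nonneg (prod_coinWeight_nonneg q S) (hf S)]
  refine Finset.sum_congr rfl fun S _ => ?_
  rw [independent_apply, ENNReal.ofReal_mul (prod_coinWeight_nonneg q S),
    ENNReal.ofReal_prod_of_nonneg fun _ _ => coinWeight_nonneg _ _]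
  rfl

lemma avg_prod (q : Fin n → unitInterval) (f : Fin n → Bool → ℝ) :
    avg q (fun S => ∏ i, f i (S i)) = ∏ i, (q i * f i true + (1 - q i) * f i false) := by
  unfold avg
  simp_rw [← Finset.prod_mul_distrib]
  rw [← Fintype.prod_sum (fun i b => coinWeight (q i) b * f i b)]
  simp

lemma avg_const (q : Fin n → unitInterval) (c : ℝ) : avg q (fun _ => c) = c := by
  have h := avg_prod q fun _ _ => 1
  simp only [Finset.prod_const_one, mul_one, add_sub_cancel] at h
  unfold avg at *
  rw [← Finset.sum_mul]
  simp only [mul_one] at h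
  rw [h, one_mul]

lemma avg_add (q : Fin n → unitInterval) (f g : (Fin n → Bool) → ℝ) :
    avg q (fun S => f S + g S) = avg q f + avg q g := by
  unfold avg; simp_rw [mul_add]; exact Finset.sum_add_distrib

lemma avg_const_mul (q : Fin n → unitInterval) (c : ℝ) (f : (Fin n → Bool) → ℝ) :
    avg q (fun S => c * f S) = c * avg q f := by
  unfold avg; rw [Finset.mul_sum]; exact Finset.sum_congr rfl fun _ _ => by ring

lemma avg_sum {ι : Type*} (q : Fin n → unitInterval) (s : Finset ι)
    (f : ι → (Fin n → Bool) → ℝ) :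
    avg q (fun S => ∑ j ∈ s, f j S) = ∑ j ∈ s, avg q (f j) := by
  unfold avg; simp_rw [Finset.mul_sum]; exact Finset.sum_comm

lemma avg_mono {q : Fin n → unitInterval} {f g : (Fin n → Bool) → ℝ}
    (h : ∀ S, Possible q S → f S ≤ g S) : avg q f ≤ avg q g := by
  refine Finset.sum_le_sum fun S _ => ?_
  by_cases hS : Possible q S
  · exact mul_le_mul_of_nonneg_left (h S hS) (prod_coinWeight_nonneg q S)
  · unfold Possible at hS
    push Not at hS
    obtain ⟨i, hi⟩ := hS
    rw [Finset.prod_eq_zero (Finset.mem_univ i) hi, zero_mul, zero_mul]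

/-- One coin is independent of a function of the other coins. -/
lemma avg_coin_mul (q : Fin n → unitInterval) (i : Fin n) (f : (Fin n → Bool) → ℝ)
    (hf : ∀ S b, f (Function.update S i b) = f S) :
    avg q (fun S => if S i then f S else 0) = q i * avg q f := by
  rw [← avg_const_mul, ← sub_eq_zero]
  unfold avg
  rw [← Finset.sum_sub_distrib]
  -- flipping the coin `i` pairs off the outcomes
  refine Finset.sum_involution (fun S _ => Function.update S i (!S i)) ?_ ?_ ?_ ?_
  · intro S _
    have e : ∀ T : Fin n → Bool, ∏ j, coinWeight (q j) (T j) =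
        coinWeight (q i) (T i) * ∏ j ∈ Finset.univ.erase i, coinWeight (q j) (T j) := fun T =>
      (Finset.mul_prod_erase _ _ (Finset.mem_univ i)).symm
    rw [e S, e (Function.update S i (!S i))]
    simp only [hf]
    have e' : ∏ j ∈ Finset.univ.erase i, coinWeight (q j) (Function.update S i (!S i) j) =
        ∏ j ∈ Finset.univ.erase i, coinWeight (q j) (S j) :=
      Finset.prod_congr rfl fun j hj => by
        rw [Function.update_of_ne (Finset.ne_of_mem_erase hj)]
    rw [e']
    cases h : S i <;> simp <;> ring
  · intro S _ _ hc
    have := congrFun hc i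
    simp at this
  · intro S _; exact Finset.mem_univ _
  · intro S _; simp

lemma avg_coin (q : Fin n → unitInterval) (i : Fin n) :
    avg q (fun S => if S i then 1 else 0) = q i := by
  rw [avg_coin_mul q i (fun _ => 1) fun _ _ => rfl, avg_const, mul_one]

/-- The expected number of coins in `P` that show `true`. -/
lemma avg_card (q : Fin n → unitInterval) (P : Finset (Fin n)) :
    avg q (fun S => ((P.filter fun i => S i).card : ℝ)) = ∑ i ∈ P, (q i : ℝ) := by
  simp_rw [Finset.card_filter, Nat.cast_sum]
  rw [avg_sum]
  refine Finset.sum_congr rfl fun i _ => ?_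
  simpa using avg_coin q i

/-- The probability that no coin in `P` shows `true`. -/
lemma avg_none (q : Fin n → unitInterval) (P : Finset (Fin n)) :
    avg q (fun S => if ∀ i ∈ P, S i = false then 1 else 0) = ∏ i ∈ P, (1 - (q i : ℝ)) := by
  classical
  have h := avg_prod q fun i b => if i ∈ P ∧ b = true then 0 else 1
  have e : ∀ S : Fin n → Bool, (∏ i, if i ∈ P ∧ S i = true then (0 : ℝ) else 1) =
      if ∀ i ∈ P, S i = false then 1 else 0 := by
    intro S
    split_ifs with hS
    · refine Finset.prod_eq_one fun i _ => ?_
      rw [if_neg]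
      rintro ⟨h1, h2⟩
      simp [hS i h1] at h2
    · push Not at hS
      obtain ⟨i, hi, h2⟩ := hS
      refine Finset.prod_eq_zero (Finset.mem_univ i) ?_
      rw [if_pos]
      exact ⟨hi, by simpa using h2⟩
  simp_rw [e] at h
  rw [h, ← Finset.prod_subset (Finset.subset_univ P)]
  · refine Finset.prod_congr rfl fun i hi => ?_
    simp [hi]
  · intro i _ hi
    simp [hi]

/-- If nobody speaks, then the expected effort that is still to come, which grows with the next
sending probability, is at most the present one. -/
lemma silence_bound {q : ℝ} (h0 : 0 ≤ q) (h1 : q ≤ 1) (m : ℕ) :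
    (1 - q) ^ m * (2 * (m * q) + 2) ≤ 2 := by
  have hb : 1 + m * q ≤ (1 + q) ^ m := one_add_mul_le_pow (by linarith) m
  have h2 : (1 - q) ^ m * (1 + m * q) ≤ 1 := by
    calc (1 - q) ^ m * (1 + m * q) ≤ (1 - q) ^ m * (1 + q) ^ m :=
          mul_le_mul_of_nonneg_left hb (pow_nonneg (by linarith) _)
      _ = (1 - q ^ 2) ^ m := by rw [← mul_pow]; ring
      _ ≤ 1 := pow_le_one₀ (by nlinarith) (by nlinarith)
  nlinarith

/-- The nodes of `P` that are preceded, in the order of decreasing keys, by fewer than `k` senders. -/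
def preceded (k : ℕ) (P : Finset (Fin n)) (key : Fin n → ℕ) (S : Fin n → Bool) : Finset (Fin n) :=
  P.filter fun i => (P.filter fun j => S j ∧ key i < key j).card < k

lemma card_preceded_senders (k : ℕ) (P : Finset (Fin n)) {key : Fin n → ℕ}
    (hkey : Function.Injective key) (S : Fin n → Bool) :
    ((preceded k P key S).filter fun i => S i).card ≤ k := by
  set Q := (preceded k P key S).filter fun i => S i with hQ
  rcases Q.eq_empty_or_nonempty with h | h
  · simp [h]
  -- all other senders in `Q` precede the one with the least key
  · obtain ⟨i, hi, hmin⟩ := Finset.exists_min_image Q key h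
    have h1 : (P.filter fun j => S j ∧ key i < key j).card < k := by
      simp only [hQ, preceded, Finset.mem_filter] at hi; exact hi.1.2
    have h2 : Q.erase i ⊆ P.filter fun j => S j ∧ key i < key j := by
      intro j hj
      rw [Finset.mem_erase] at hj
      have hj2 := hj.2
      simp only [hQ, preceded, Finset.mem_filter] at hj2
      have h3 : key i ≠ key j := fun e => hj.1 (hkey e).symm
      exact Finset.mem_filter.2 ⟨hj2.1.1, hj2.2, lt_of_le_of_ne (hmin j hj.2) h3⟩
    have h3 := Finset.card_le_card h2
    rw [Finset.card_erase_of_mem hi] at h3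
    omega

/-- A node's own coin is independent of the number of larger senders, so that among the nodes with
fewer than `k` larger senders a fraction `q` sends on average. -/
lemma avg_preceded (q : Fin n → unitInterval) (k : ℕ) (P : Finset (Fin n)) {key : Fin n → ℕ}
    (hkey : Function.Injective key) {r : ℝ} (hq : ∀ i ∈ P, (q i : ℝ) = r) :
    r * avg q (fun S => ((preceded k P key S).card : ℝ)) ≤ k := by
  have h1 : avg q (fun S => (((preceded k P key S).filter fun i => S i).card : ℝ)) ≤ k := by
    rw [← avg_const q (k : ℝ)]
    exact avg_mono fun S _ => by exact_mod_cast card_preceded_senders k P hkey S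
  refine le_trans (le_of_eq ?_) h1
  have e1 : ∀ S : Fin n → Bool, ((preceded k P key S).card : ℝ) = ∑ i ∈ P,
      if (P.filter fun j => S j ∧ key i < key j).card < k then (1 : ℝ) else 0 := by
    intro S; rw [preceded, Finset.card_filter]; push_cast; rfl
  have e2 : ∀ S : Fin n → Bool, (((preceded k P key S).filter fun i => S i).card : ℝ) =
      ∑ i ∈ P, if S i then
        (if (P.filter fun j => S j ∧ key i < key j).card < k then (1 : ℝ) else 0) else 0 := by
    intro S
    rw [preceded, Finset.filter_filter, Finset.card_filter, Nat.cast_sum]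
    refine Finset.sum_congr rfl fun i _ => ?_
    split_ifs <;> simp_all
  simp_rw [e1, e2]
  rw [avg_sum, avg_sum, Finset.mul_sum]
  refine Finset.sum_congr rfl fun i hi => ?_
  rw [avg_coin_mul, hq i hi]
  intro S b
  have : (P.filter fun j => Function.update S i b j ∧ key i < key j) =
      P.filter fun j => S j ∧ key i < key j := by
    refine Finset.filter_congr fun j _ => ?_
    by_cases hj : j = i
    · simp [hj]
    · rw [Function.update_of_ne hj]
  rw [this]

/-! ### The algorithm -/

/-- What the server can ask for in a broadcast. Every node remembers the last one.
* `watch l`: use filters for the threshold `l` and report violations;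
* `askLow`: every undecided node reports its least value of the phase;
* `askHigh b`: every undecided node reports the least threshold above its largest value of the
  phase, truncated to `b + 1`;
* `sample r t`: a new phase starts, and each node whose key is at least `t` reports its value with a
  probability that grows with the round `r` of the search for the `k`-th largest value;
* `classify z w`: the `k`-th largest value is `z`; with `w = 0` the nodes in its neighbourhood are
  undecided, with `w = i + 1` only node `i` is. -/
inductive Cmd
  | watch (l : ℕ)
  | askLow
  | askHigh (b : ℕ)
  | sample (r t : ℕ)
  | classify (z w : ℕ)

/-- What a node knows about its membership in all outputs that are feasible in the present phase:
it belongs to all of them, is undecided, or belongs to none. -/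
inductive Role
  | top
  | mid
  | bottom

/-- The filter for the threshold `l`. An undecided node whose values of the phase between `m` and `M`
leave only one side possible gets the filter of this side. -/
def Role.filt (ε : ℝ) (l m M : ℕ) : Role → Interval
  | .top => ⟨l, ⊤⟩
  | .mid => ⟨if m < l then 0 else l, if scaleUp ε l < M then ⊤ else (scaleUp ε l : ℕ∞)⟩
  | .bottom => ⟨0, (scaleUp ε l : ℕ∞)⟩

/-- The state of a node: its name, its value, its least and largest value of the phase, its role, the
last request of the server, the number of rounds since then, and its filter. -/
structure Node (n : ℕ) where
  id : Fin n
  val : ℕ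
  low : ℕ
  high : ℕ
  role : Role
  cmd : Cmd
  rnd : ℕ
  filt : Interval

/-- The index of the last round of a randomized search, in which everybody speaks. -/
def lastRound (n : ℕ) : ℕ := Nat.clog 2 n

/-- The probability of speaking in round `r` of a randomized search. -/
def sendProb (n r : ℕ) : unitInterval :=
  ⟨(1 / 2) ^ (lastRound n - r), by positivity, pow_le_one₀ (by norm_num) (by norm_num)⟩

/-- Distinct numbers that order the nodes by their values. -/
def keyOf (i : Fin n) (x : ℕ) : ℕ := x * n + i

/-- The probability with which a node speaks. -/
def Node.prob (nd : Node n) : unitInterval :=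
  open Classical in
  match nd.cmd with
  | .watch _ => if nd.filt.Contains nd.val then 0 else
      match nd.role with
      | .mid => 1
      | _ => sendProb n nd.rnd
  | .sample r t => if t ≤ keyOf nd.id nd.val then sendProb n r else 0
  | _ =>
      match nd.role with
      | .mid => 1
      | _ => 0

/-- What a node says when it speaks. -/
def Node.ans (ε : ℝ) (nd : Node n) : ℕ :=
  match nd.cmd with
  | .watch _ => if nd.val < nd.filt.lo then 1 else 0
  | .sample _ _ => nd.val
  | .askHigh b => min (scaleDown ε nd.high) (b + 1)
  | _ => nd.low

open Classical in
/-- The role of node `i` with value `x` in a phase that starts with the `k`-th largest value `z`. -/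
def roleFor (ε : ℝ) (z w : ℕ) (i : Fin n) (x : ℕ) : Role :=
  if w = 0 then
    if 1 / (1 - ε) * (z : ℝ) < x then .top else if (1 - ε) * (z : ℝ) ≤ x then .mid else .bottom
  else
    if (1 - ε) * (z : ℝ) ≤ x then (if (i : ℕ) + 1 = w then .mid else .top) else .bottom

/-- How a node processes a broadcast. -/
def Node.react (ε : ℝ) (nd : Node n) : Option Cmd → Node n
  | none => { nd with rnd := nd.rnd + 1 }
  | some c =>
    { id := nd.id
      val := nd.val
      low := match c with
        | .sample _ _ => nd.val
        | _ => nd.low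
      high := match c with
        | .sample _ _ => nd.val
        | _ => nd.high
      role := match c with
        | .classify z w => roleFor ε z w nd.id nd.val
        | _ => nd.role
      cmd := c
      rnd := 0
      filt := match c with
        | .watch l => nd.role.filt ε l nd.low nd.high
        | _ => nd.filt }

/-- How a node processes a new value. -/
def Node.see (nd : Node n) (x : ℕ) : Node n :=
  { nd with val := x, low := min nd.low x, high := max nd.high x, rnd := 0 }

/-- The state of the server. Besides the last request and the rounds since then it knows the nodes in
every feasible output (`top`), the undecided nodes (`mid`), among them those known to have been below
(`fell`) or above (`rose`) the filter for the present threshold, the candidates for a feasible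
threshold (`gaps`), the undecided nodes whose values have excluded candidates in between (`holed`), a
node about to do so (`pend`), and the reports `lows`. The numbers `width`, `phases` and `paid` serve
the analysis only. -/
structure Server (n : ℕ) where
  cmd : Cmd
  rnd : ℕ
  idle : Bool
  top : Finset (Fin n)
  mid : Finset (Fin n)
  fell : Finset (Fin n)
  rose : Finset (Fin n)
  holed : Finset (Fin n)
  gaps : List (ℕ × ℕ)
  pend : List (Fin n)
  lows : Fin n → ℕ
  width : ℕ
  phases : ℕ
  paid : ℕ

/-- The number of undecided nodes in an output. -/
def Server.need (k : ℕ) (s : Server n) : ℕ := k - s.top.card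

/-- The server makes a request. -/
def Server.ask (s : Server n) (c : Cmd) : Server n := { s with cmd := c, rnd := 0, idle := false }

/-- The undecided nodes known to have been below the filter, after the reports `a` of violations by
the nodes in `S`. -/
def Server.newFell (s : Server n) (S : Finset (Fin n)) (a : Fin n → ℕ) : Finset (Fin n) :=
  s.fell ∪ (S ∩ s.mid).filter fun i => a i = 1

/-- The undecided nodes known to have been above the filter, after the reports `a` of violations by
the nodes in `S`. -/
def Server.newRose (s : Server n) (S : Finset (Fin n)) (a : Fin n → ℕ) : Finset (Fin n) :=
  s.rose ∪ (S ∩ s.mid).filter fun i => a i ≠ 1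

/-- The reports show that every feasible threshold is smaller than the present one. -/
def Server.TooHigh (k : ℕ) (s : Server n) (S : Finset (Fin n)) (a : Fin n → ℕ) : Prop :=
  (S ∩ s.top).Nonempty ∨ s.mid.card < (s.newFell S a).card + s.need k

/-- The reports show that every feasible threshold is larger than the present one. -/
def Server.TooLow (k : ℕ) (s : Server n) (S : Finset (Fin n)) (a : Fin n → ℕ) : Prop :=
  (S \ (s.top ∪ s.mid)).Nonempty ∨ s.need k < (s.newRose S a).card

/-- The reports are compatible with the present threshold. -/
def Server.StillOk (k : ℕ) (s : Server n) (S : Finset (Fin n)) (a : Fin n → ℕ) : Prop :=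
  ¬ s.TooHigh k S a ∧ ¬ s.TooLow k S a ∧ Disjoint (s.newFell S a) (s.newRose S a)

open Classical in
/-- The candidates that are left when the threshold `l` fails. -/
def Server.trimmed (k : ℕ) (s : Server n) (l : ℕ) (S : Finset (Fin n)) (a : Fin n → ℕ) :
    List (ℕ × ℕ) :=
  if s.TooLow k S a then above (l + 1) (if s.TooHigh k S a then below l s.gaps else s.gaps)
  else if s.TooHigh k S a then below l s.gaps else s.gaps

open Classical in
/-- A node whose values exclude the threshold, if it fails for no other reason. -/
def Server.culprit (k : ℕ) (s : Server n) (S : Finset (Fin n)) (a : Fin n → ℕ) : List (Fin n) :=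
  if s.TooHigh k S a ∨ s.TooLow k S a then []
  else (s.newFell S a ∩ s.newRose S a).toList.take 1

open Classical in
/-- The server's reaction to the reports `a` of filter violations by the nodes in `S`. -/
def Server.watchStep (k : ℕ) (s : Server n) (l : ℕ) (S : Finset (Fin n)) (a : Fin n → ℕ) :
    Server n × Option Cmd :=
  if S = ∅ then
    ({ s with
        rnd := if lastRound n ≤ s.rnd then 0 else s.rnd + 1
        idle := decide (lastRound n ≤ s.rnd) }, none)
  else if s.StillOk k S a then
    ({ s.ask (.watch l) with fell := s.newFell S a, rose := s.newRose S a }, some (.watch l))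
  else
    ({ s.ask .askLow with gaps := s.trimmed k l S a, pend := s.culprit k S a }, some .askLow)

/-- The server's reaction to the reports of the least values. -/
def Server.lowStep (k : ℕ) (s : Server n) (a : Fin n → ℕ) : Server n × Option Cmd :=
  ({ s.ask (.askHigh (kth (s.need k) s.mid a)) with lows := a },
    some (.askHigh (kth (s.need k) s.mid a)))

/-- The values of node `i` exclude the candidates strictly between `m i` and `y i`. -/
def cutStep (m y : Fin n → ℕ) (st : List (ℕ × ℕ) × Finset (Fin n)) (i : Fin n) :
    List (ℕ × ℕ) × Finset (Fin n) :=
  if m i < y i then (cut (m i) (y i) st.1, insert i st.2) else st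

/-- The candidates that are left, and the nodes that have excluded some, after the reports `y` on the
largest values. -/
def Server.update (k : ℕ) (s : Server n) (b : ℕ) (y : Fin n → ℕ) :
    List (ℕ × ℕ) × Finset (Fin n) :=
  (s.pend ++ s.mid.toList).foldl (cutStep s.lows y)
    (above (kth (s.need k + 1) s.mid y) (below (b + 1) s.gaps), s.holed)

open Classical in
/-- The server's reaction to the reports on the largest values. -/
def Server.highStep (k : ℕ) (s : Server n) (b : ℕ) (y : Fin n → ℕ) : Server n × Option Cmd :=
  if (s.update k b y).1 = [] then
    ({ s.ask (.sample 0 0) with phases := s.phases + 1 }, some (.sample 0 0))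
  else
    let l := Classical.epsilon (IsPick (s.update k b y).1)
    ({ s.ask (.watch l) with
        gaps := (s.update k b y).1
        holed := (s.update k b y).2
        fell := s.mid.filter fun i => s.lows i < l
        rose := s.mid.filter fun i => l < y i }, some (.watch l))

open Classical in
/-- The server's reaction to the values `a` of the nodes in `S` that have spoken in round `r`. -/
def Server.sampleStep (ε : ℝ) (k : ℕ) (s : Server n) (r t : ℕ) (S : Finset (Fin n))
    (a : Fin n → ℕ) : Server n × Option Cmd :=
  let t' := if k ≤ S.card then kth k S (fun i => keyOf i (a i)) else t
  if r < lastRound n then (s.ask (.sample (r + 1) t'), some (.sample (r + 1) t'))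
  else
    ({ s.ask (.classify (t' / n) 0) with
        top := S.filter fun i => 1 / (1 - ε) * ((t' / n : ℕ) : ℝ) < a i },
      some (.classify (t' / n) 0))

/-- Bound for the expected number of messages in a search for the `k`-th largest value. -/
def searchCost (n k : ℕ) : ℕ := (2 * k + 1) * (lastRound n + 1) + 2

/-- The candidates at the start of a phase in which not all outputs agree. -/
def firstGap (ε : ℝ) (z : ℕ) : ℕ × ℕ := (⌈(1 - ε) ^ 2 * (z : ℝ)⌉₊, z)

/-- The budget of a phase with `k`-th largest value `z` and neighbourhood of size `s` at its start. -/
def phaseCost (n k : ℕ) (ε : ℝ) (z s : ℕ) : ℕ :=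
  searchCost n k + (8 * s + 8) * ((s + 1) * intervalPot (firstGap ε z)) + 8 * s + 6 +
    32 * intervalPot (0, z) + 14

open Classical in
/-- The server's reaction to the reports of the nodes `S` in the neighbourhood of the `k`-th largest
value `z`. If only `k` nodes are in it or above it, they are the only feasible output; then all but
one of them count as decided, to keep the number of undecided nodes small. -/
def Server.classifyStep (ε : ℝ) (k : ℕ) (s : Server n) (z : ℕ) (S : Finset (Fin n))
    (a : Fin n → ℕ) : Server n × Option Cmd :=
  let w := S.sup fun i => (i : ℕ) + 1
  if s.top.card + S.card = k then
    ({ s.ask (.classify z w) with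
        top := s.top ∪ S.filter fun i => (i : ℕ) + 1 ≠ w
        mid := S.filter fun i => (i : ℕ) + 1 = w
        holed := ∅
        pend := []
        gaps := [(0, z)]
        width := intervalPot (0, z)
        paid := s.paid + phaseCost n k ε z S.card }, some (.classify z w))
  else
    { s with
        mid := S
        holed := ∅
        pend := []
        gaps := [firstGap ε z]
        width := intervalPot (firstGap ε z)
        paid := s.paid + phaseCost n k ε z S.card : Server n }.lowStep k a

/-- The server's reaction to the messages of a round. -/
def Server.step (ε : ℝ) (k : ℕ) (s : Server n) (S : Finset (Fin n)) (a : Fin n → ℕ) :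
    Server n × Option Cmd :=
  match s.cmd with
  | .watch l => s.watchStep k l S a
  | .askLow => s.lowStep k a
  | .askHigh b => s.highStep k b a
  | .sample r t => s.sampleStep ε k r t S a
  | .classify z 0 => s.classifyStep ε k z S a
  | .classify _ (_ + 1) => s.lowStep k a

/-- An injective numbering of the requests. -/
def Cmd.code : Cmd → ℕ
  | .watch l => Nat.pair 0 (Nat.pair l 0)
  | .askLow => Nat.pair 1 (Nat.pair 0 0)
  | .askHigh b => Nat.pair 2 (Nat.pair b 0)
  | .sample r t => Nat.pair 3 (Nat.pair r t)
  | .classify z w => Nat.pair 4 (Nat.pair z w)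

instance : Inhabited Cmd := ⟨.askLow⟩

lemma Cmd.code_injective : Function.Injective Cmd.code := by
  intro a b h
  cases a <;> cases b <;> simp [Cmd.code, Nat.pair_eq_pair] at h <;> simp_all

lemma bits_injective : Function.Injective Nat.bits := by
  intro a b h
  have e : ∀ m : ℕ, Nat.ofDigits 2 (m.bits.map fun b => cond b 1 0) = m := fun m => by
    rw [← Nat.digits_two_eq_bits, Nat.ofDigits_digits]
  rw [← e a, h, e b]

/-- The inverse of the binary representation. -/
def decodeNat : Msg → ℕ := Function.invFun Nat.bits

@[simp] lemma decodeNat_bits (m : ℕ) : decodeNat m.bits = m :=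
  Function.leftInverse_invFun bits_injective m

/-- The request that is encoded by a message. -/
def decodeCmd : Msg → Cmd := Function.invFun fun c => (Cmd.code c).bits

@[simp] lemma decodeCmd_bits (c : Cmd) : decodeCmd c.code.bits = c :=
  Function.leftInverse_invFun (bits_injective.comp Cmd.code_injective) c

/-- The role of a node before any value is observed. -/
def initRole (k : ℕ) (i : Fin n) : Role :=
  if (i : ℕ) + 1 < k then .top else if (i : ℕ) + 1 = k then .mid else .bottom

/-- The initial state of the server, which fits a past in which all values were zero. -/
def serverInit (n k : ℕ) : Server n where
  cmd := .watch 0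
  rnd := 0
  idle := true
  top := Finset.univ.filter fun i => (i : ℕ) + 1 < k
  mid := Finset.univ.filter fun i => (i : ℕ) + 1 = k
  fell := ∅
  rose := ∅
  holed := ∅
  gaps := [(0, 0)]
  pend := []
  lows := fun _ => 0
  width := 1
  phases := 0
  paid := searchCost n k + 41

/-- The initial state of node `i`. -/
def nodeInit (ε : ℝ) (k : ℕ) (i : Fin n) : Node n where
  id := i
  val := 0
  low := 0
  high := 0
  role := initRole k i
  cmd := .watch 0
  rnd := 0
  filt := (initRole k i).filt ε 0 0 0

/-- The nodes from which a message has arrived. -/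
def sendersOf {α : Type} (m : Fin n → Option α) : Finset (Fin n) :=
  Finset.univ.filter fun i => (m i).isSome

/-- The online algorithm. -/
def monitor (n k : ℕ) (ε : ℝ) : Online n where
  Server := Server n
  Node := Node n
  serverInit := serverInit n k
  nodeInit := nodeInit ε k
  observe := Node.see
  send nd := (coin nd.prob).map fun b => (nd, if b then some (nd.ans ε).bits else none)
  act s m :=
    let r := s.step ε k (sendersOf m) fun i => ((m i).map decodeNat).getD 0
    PMF.pure (r.1, fun _ => none, r.2.map fun c => c.code.bits)
  receive nd _ b := nd.react ε (b.map decodeCmd)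
  done s := s.idle = true
  output s := Classical.epsilon fun F : Finset (Fin n) =>
    s.top ∪ s.rose ⊆ F ∧ F ⊆ (s.top ∪ s.mid) \ s.fell ∧ F.card = k
  filter nd := nd.filt
  filter_observe _ _ := rfl
  filter_send q r hr := by
    rw [PMF.mem_support_map_iff] at hr
    obtain ⟨b, -, rfl⟩ := hr
    rfl
  filter_receive _ := rfl

section Rounds
variable {k : ℕ} {ε : ℝ}

/-- The nodes that speak when the coins show `S`. -/
def speakers (S : Fin n → Bool) : Finset (Fin n) := Finset.univ.filter fun i => S i

/-- The reaction of the server when the coins of the nodes show `S`. -/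
def reaction (c : (monitor n k ε).Config) (S : Fin n → Bool) : Server n × Option Cmd :=
  Server.step ε k c.server (speakers S) fun i => if S i then (c.node i).ans ε else 0

/-- The round in which the coins of the nodes show `S`. -/
def roundOf (c : (monitor n k ε).Config) (S : Fin n → Bool) : (monitor n k ε).Round where
  sent := fun i => (c.node i, if S i then some ((c.node i).ans ε).bits else none)
  server := (reaction c S).1
  unicast := fun _ => none
  broadcast := (reaction c S).2.map fun c => c.code.bits

/-- The states after the round in which the coins of the nodes show `S`. -/
def next (c : (monitor n k ε).Config) (S : Fin n → Bool) : (monitor n k ε).Config where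
  server := (reaction c S).1
  node := fun i => (c.node i).react ε (reaction c S).2

/-- The coins of the nodes. -/
def coins (c : (monitor n k ε).Config) (i : Fin n) : unitInterval := (c.node i).prob

lemma runRound_eq (c : (monitor n k ε).Config) :
    Online.runRound c = (independent fun i => coin (coins c i)).map (roundOf c) := by
  have h : (fun i => (monitor n k ε).send (c.node i)) = fun i => (coin (coins c i)).map
      ((fun i b => (c.node i, if b then some ((c.node i).ans ε).bits else none)) i) := rfl
  rw [Online.runRound, h, independent_map, PMF.bind_map, ← PMF.bind_pure_comp]
  congr 1
  funext S
  simp only [Function.comp, monitor]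
  rw [PMF.pure_bind]
  congr 1
  have h1 : (sendersOf fun i => if S i = true then some (Node.ans ε (c.node i)).bits else none) =
      speakers S := by
    unfold sendersOf speakers
    refine Finset.filter_congr fun i _ => ?_
    cases h : S i <;> simp [h]
  have h2 : (fun i => ((if S i = true then some (Node.ans ε (c.node i)).bits else none).map
      decodeNat).getD 0) = fun i => if S i then (c.node i).ans ε else 0 := by
    funext i
    cases S i <;> simp
  rw [h1, h2]
  rfl

lemma final_roundOf (c : (monitor n k ε).Config) (S : Fin n → Bool) :
    (roundOf c S).final = next c S := by
  unfold Online.Round.final next roundOf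
  congr 1
  funext i
  show Node.react ε (c.node i) (((reaction c S).2.map _).map decodeCmd) = _
  rw [Option.map_map]
  have : (decodeCmd ∘ fun c : Cmd => c.code.bits) = id := by
    funext c; exact decodeCmd_bits c
  rw [this, Option.map_id, id]

lemma messages_roundOf (c : (monitor n k ε).Config) (S : Fin n → Bool) :
    (roundOf c S).messages = (speakers S).card + if (reaction c S).2.isSome then 1 else 0 := by
  unfold Online.Round.messages roundOf speakers
  have h1 : (Finset.univ.filter fun i =>
      (if S i = true then some ((c.node i).ans ε).bits else none).isSome = true) =
      Finset.univ.filter fun i => S i = true := by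
    refine Finset.filter_congr fun i _ => ?_
    cases S i <;> simp
  simp only [Option.isSome_none, Option.isSome_map]
  rw [h1]
  simp

lemma exists_coins_of_mem_runRound {c : (monitor n k ε).Config} {r}
    (h : r ∈ (Online.runRound c).support) : ∃ S, Possible (coins c) S ∧ r = roundOf c S := by
  rw [runRound_eq, PMF.mem_support_map_iff] at h
  obtain ⟨S, hS, rfl⟩ := h
  exact ⟨S, possible_of_mem_support hS, rfl⟩

end Rounds

/-! ### Updating the candidates -/

lemma listPot_cut_below_le (x y b : ℕ) (G : List (ℕ × ℕ)) :
    listPot (cut x y (below b G)) ≤ listPot (cut x y G) := by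
  induction G with
  | nil => simp
  | cons g G ih =>
    simp only [cut, listPot_append] at *
    rw [below_cons, below_append, above_append, below_cons, above_cons]
    have e1 := min_le_left g.2 (b - 1)
    have e2 : min (min g.2 (b - 1)) (x + 1 - 1) ≤ min g.2 (x + 1 - 1) :=
      min_le_min_right _ e1
    have h4 := intervalPot_mono (g := (g.1, min (min g.2 (b - 1)) (x + 1 - 1)))
      (h := (g.1, min g.2 (x + 1 - 1))) le_rfl e2
    have h5 := intervalPot_mono (g := (max g.1 y, min g.2 (b - 1))) (h := (max g.1 y, g.2)) le_rfl e1
    simp only [listPot_append]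
    split_ifs <;> simp [below_cons, above_cons] at * <;> (try split_ifs) <;> (try simp at *) <;> omega

lemma listPot_cut_above_le (x y a : ℕ) (G : List (ℕ × ℕ)) :
    listPot (cut x y (above a G)) ≤ listPot (cut x y G) := by
  induction G with
  | nil => simp
  | cons g G ih =>
    simp only [cut, listPot_append] at *
    rw [above_cons, below_append, above_append, below_cons, above_cons]
    have e1 := le_max_left g.1 a
    have e2 : max g.1 y ≤ max (max g.1 a) y := max_le_max_right _ e1
    have h4 := intervalPot_mono (g := (max g.1 a, min g.2 (x + 1 - 1)))
      (h := (g.1, min g.2 (x + 1 - 1))) e1 le_rfl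
    have h5 := intervalPot_mono (g := (max (max g.1 a) y, g.2)) (h := (max g.1 y, g.2)) e2 le_rfl
    simp only [listPot_append]
    split_ifs <;> simp [below_cons, above_cons] at * <;> (try split_ifs) <;> (try simp at *) <;> omega

/-- The node's values of the phase exclude some candidates, and its hole separates the intervals. -/
def Separates (G : List (ℕ × ℕ)) (m y : ℕ) : Prop :=
  ∃ x, m ≤ x ∧ x < y ∧ ∀ g ∈ G, g.2 ≤ x ∨ x < g.1

lemma Separates.mono {G G' : List (ℕ × ℕ)} {m y m' y' : ℕ} (h : Separates G m y)
    (hr : Refines G' G) (hm : m' ≤ m) (hy : y ≤ y') : Separates G' m' y' := by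
  obtain ⟨x, h1, h2, h3⟩ := h
  exact ⟨x, hm.trans h1, h2.trans_le hy, hr.sep h3⟩

/-- The bookkeeping of the candidates: `m` and `y` bound the holes of the undecided nodes `U`, those
in `H` have been used for cutting, and no interval has a potential above `W`. -/
structure GapsOk (W : ℕ) (U : Finset (Fin n)) (m y : Fin n → ℕ) (G : List (ℕ × ℕ))
    (H : Finset (Fin n)) : Prop where
  sorted : Sorted G
  width : ∀ g ∈ G, intervalPot g ≤ W
  sub : H ⊆ U
  sep : ∀ i ∈ H, Separates G (m i) (y i)

/-- An upper bound for the number of thresholds that can still fail. -/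
def potential (W : ℕ) (U : Finset (Fin n)) (G : List (ℕ × ℕ)) (H : Finset (Fin n)) : ℕ :=
  listPot G + (U.card - H.card) * W

lemma GapsOk.refine {W : ℕ} {U m y m' y' G G' H} (h : GapsOk (n := n) W U m y G H)
    (hs : Sorted G') (hr : Refines G' G) (hm : ∀ i, m' i ≤ m i) (hy : ∀ i, y i ≤ y' i) :
    GapsOk W U m' y' G' H :=
  ⟨hs, hr.pot_le h.width, h.sub, fun i hi => (h.sep i hi).mono hr (hm i) (hy i)⟩

section Cut
variable {W b : ℕ} {U : Finset (Fin n)} {m y : Fin n → ℕ} {G : List (ℕ × ℕ)} {H : Finset (Fin n)}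

lemma sub_insert_mul (hU : H ⊆ U) {i : Fin n} (hi : i ∈ U) (hH : i ∉ H) (W : ℕ) :
    (U.card - (insert i H).card) * W + W = (U.card - H.card) * W := by
  have h1 : (insert i H).card ≤ U.card := Finset.card_le_card (Finset.insert_subset hi hU)
  rw [Finset.card_insert_of_notMem hH] at h1 ⊢
  obtain ⟨d, hd⟩ := Nat.exists_eq_add_of_le h1
  rw [hd, show H.card + 1 + d - (H.card + 1) = d by omega,
    show H.card + 1 + d - H.card = d + 1 by omega]
  ring

lemma refines_cutStep (m' y' : Fin n → ℕ) (st : List (ℕ × ℕ) × Finset (Fin n)) (i : Fin n) :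
    Refines (cutStep m' y' st i).1 st.1 := by
  unfold cutStep
  split_ifs
  exacts [refines_cut _ _ _, Refines.refl _]

lemma GapsOk.cutStep (h : GapsOk W U m y G H) {i : Fin n} (hi : i ∈ U) :
    GapsOk W U m y (cutStep m (fun i => min (y i) (b + 1)) (G, H) i).1
      (cutStep m (fun i => min (y i) (b + 1)) (G, H) i).2 := by
  have hr := refines_cutStep m (fun i => min (y i) (b + 1)) (G, H) i
  unfold Monitor.cutStep at *
  split_ifs with hc
  · rw [if_pos hc] at hr
    refine ⟨h.sorted.cut hc, hr.pot_le h.width, Finset.insert_subset hi h.sub, fun j hj => ?_⟩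
    rcases Finset.mem_insert.1 hj with rfl | hj
    · exact ⟨m j, le_rfl, hc.trans_le (min_le_left _ _), sep_cut hc G⟩
    · exact (h.sep j hj).mono hr le_rfl le_rfl
  · exact h

/-- Cutting the hole of an undecided node never increases the potential: a new split is paid for by
the node. -/
lemma GapsOk.potential_cutStep (h : GapsOk W U m y G H) (hb : ∀ g ∈ G, g.2 ≤ b) {i : Fin n}
    (hi : i ∈ U) :
    potential W U (Monitor.cutStep m (fun i => min (y i) (b + 1)) (G, H) i).1
      (Monitor.cutStep m (fun i => min (y i) (b + 1)) (G, H) i).2 ≤ potential W U G H := by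
  unfold Monitor.cutStep potential
  split_ifs with hc
  · by_cases hH : i ∈ H
    · rw [Finset.insert_eq_of_mem hH]
      obtain ⟨x, h1, h2, h3⟩ := h.sep i hH
      have := listPot_cut_le_of_sep (x := m i) (y := min (y i) (b + 1)) (c := min x b) (G := G)
        (by simp only [lt_min_iff] at hc; exact le_min h1 (by omega))
        (lt_min ((min_le_left _ _).trans_lt h2) (Nat.lt_succ_of_le (min_le_right _ _)))
        (fun g hg => by
          rcases h3 g hg with h | h
          · exact .inl (le_min h (hb g hg))
          · exact .inr ((min_le_left _ _).trans_lt h))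
      simp only; omega
    · have h1 := sub_insert_mul h.sub hi hH W
      have h2 := listPot_cut_le hc h.sorted h.width
      dsimp only at h2 ⊢; omega
  · exact le_rfl

lemma le_of_refines {G' : List (ℕ × ℕ)} (hr : Refines G' G) (hb : ∀ g ∈ G, g.2 ≤ b) :
    ∀ g ∈ G', g.2 ≤ b := by
  intro g hg
  obtain ⟨h, hh, -, h2⟩ := hr g hg
  exact h2.trans (hb h hh)

lemma GapsOk.foldl_cutStep (L : List (Fin n)) (hL : ∀ i ∈ L, i ∈ U) :
    ∀ {G H}, GapsOk W U m y G H → (∀ g ∈ G, g.2 ≤ b) →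
    let st := L.foldl (Monitor.cutStep m fun i => min (y i) (b + 1)) (G, H)
    GapsOk W U m y st.1 st.2 ∧ Refines st.1 G ∧ weight st.1 ≤ weight G ∧
      potential W U st.1 st.2 ≤ potential W U G H ∧
      ∀ l, Mem l st.1 ↔ Mem l G ∧ ∀ i ∈ L, l ≤ m i ∨ min (y i) (b + 1) ≤ l := by
  induction L with
  | nil => intro G H h _; exact ⟨h, Refines.refl _, le_rfl, le_rfl, by simp⟩
  | cons i L ih =>
    intro G H h hb
    have hi := hL i List.mem_cons_self
    have hr := refines_cutStep m (fun i => min (y i) (b + 1)) (G, H) i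
    obtain ⟨h1, h2, h3, h4, h5⟩ := ih (fun j hj => hL j (List.mem_cons_of_mem _ hj))
      (h.cutStep (b := b) hi) (le_of_refines hr hb)
    refine ⟨h1, h2.trans hr, h3.trans ?_, h4.trans (h.potential_cutStep hb hi), fun l => ?_⟩
    · unfold Monitor.cutStep
      split_ifs with hc
      exacts [weight_cut_le hc _, le_rfl]
    · simp only [List.foldl_cons]
      rw [show List.foldl (Monitor.cutStep m fun i => min (y i) (b + 1))
        (Monitor.cutStep m (fun i => min (y i) (b + 1)) (G, H) i) L = List.foldl (Monitor.cutStep m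
        fun i => min (y i) (b + 1)) ((Monitor.cutStep m (fun i => min (y i) (b + 1)) (G, H) i).1,
        (Monitor.cutStep m (fun i => min (y i) (b + 1)) (G, H) i).2) L from rfl, h5]
      have e : Mem l (Monitor.cutStep m (fun i => min (y i) (b + 1)) (G, H) i).1 ↔
          Mem l G ∧ (l ≤ m i ∨ min (y i) (b + 1) ≤ l) := by
        unfold Monitor.cutStep
        split_ifs with hc
        · exact mem_cut
        · simp only [iff_self_and]; intro _; dsimp only at hc; omega
      rw [e, List.forall_mem_cons, and_assoc]

/-- A node whose hole contains the threshold that has been tried halves an interval. -/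
lemma GapsOk.potential_pend (h : GapsOk W U m y G H) {a l : ℕ} (hl : IsPick G l) {i : Fin n}
    (hi : i ∈ U) (h1 : m i < l) (h2 : l < y i) :
    potential W U
      (Monitor.cutStep m (fun i => min (y i) (b + 1)) (above a (below (b + 1) G), H) i).1
      (Monitor.cutStep m (fun i => min (y i) (b + 1)) (above a (below (b + 1) G), H) i).2 + 1 ≤
      potential W U G H := by
  have hr : Refines (above a (below (b + 1) G)) G := (refines_above _ _).trans (refines_below _ _)
  have hok : GapsOk W U m y (above a (below (b + 1) G)) H :=
    h.refine ((h.sorted.below _).above _) hr (fun _ => le_rfl) fun _ => le_rfl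
  have hb' : ∀ g ∈ above a (below (b + 1) G), g.2 ≤ b := by
    refine le_of_refines (refines_above _ _) fun g hg => ?_
    obtain ⟨g', -, -, rfl⟩ := mem_below_iff.1 hg
    exact (min_le_right _ _).trans (by omega)
  -- if the truncation at `b` excludes `l`, then it has halved the interval already
  by_cases hbl : b < l
  · refine (Nat.add_le_add_right (hok.potential_cutStep hb' hi) 1).trans ?_
    have e1 := listPot_pick_below hl (b := b + 1) hbl
    have e2 := listPot_above_le a (below (b + 1) G)
    unfold potential; omega
  · have hc : m i < min (y i) (b + 1) := lt_min (h1.trans h2) (by omega)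
    have e0 : listPot (cut (m i) (min (y i) (b + 1)) (above a (below (b + 1) G))) ≤
        listPot (cut (m i) (min (y i) (b + 1)) G) :=
      (listPot_cut_above_le _ _ _ _).trans (listPot_cut_below_le _ _ _ _)
    unfold Monitor.cutStep potential
    rw [if_pos hc]
    simp only
    by_cases hH : i ∈ H
    · rw [Finset.insert_eq_of_mem hH]
      -- no interval contains both ends of the hole of a node that has split before, so one side of `l` is lost
      obtain ⟨x, hx1, hx2, hx3⟩ := h.sep i hH
      by_cases hxb : x ≤ b
      · have := listPot_pick_cut_of_sep (y := min (y i) (b + 1)) hl h1 (lt_min h2 (by omega)) hx1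
          (lt_min hx2 (by omega)) hx3
        omega
      · have e3 : min (y i) (b + 1) = b + 1 := by omega
        have e4 : above (b + 1) (above a (below (b + 1) G)) = [] :=
          above_eq_nil fun g hg => Nat.lt_succ_of_le (hb' g hg)
        have e5 := listPot_pick_below hl (b := m i + 1) h1
        have e6 := listPot_cut_above_le (m i) (b + 1) a (below (b + 1) G)
        have e7 := listPot_cut_below_le (m i) (b + 1) (b + 1) G
        have e8 : listPot (below (m i + 1) (above a (below (b + 1) G))) ≤
            listPot (below (m i + 1) G) := by
          have f1 : ∀ G' : List (ℕ × ℕ), ∀ c, (∀ g ∈ G', g.2 < c) →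
              listPot (cut (m i) c G') = listPot (below (m i + 1) G') := by
            intro G' c hc
            rw [cut, above_eq_nil hc, List.append_nil]
          obtain ⟨c, hcG⟩ : ∃ c, ∀ g ∈ G, g.2 < c := by
            refine ⟨(G.map fun g => g.2).sum + 1, fun g hg => Nat.lt_succ_of_le ?_⟩
            exact List.le_sum_of_mem (List.mem_map_of_mem hg)
          rw [← f1 G c hcG, ← f1 (above a (below (b + 1) G)) c]
          · exact (listPot_cut_above_le _ _ _ _).trans (listPot_cut_below_le _ _ _ _)
          · intro g hg
            obtain ⟨h, hh, -, h2⟩ := hr g hg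
            exact h2.trans_lt (hcG h hh)
        rw [e3, cut, e4, List.append_nil]
        omega
    -- a node that has not split before pays for the additional interval
    · have e1 := sub_insert_mul h.sub hi hH W
      have e2 := listPot_pick_cut hl h.sorted h1 (lt_min h2 (by omega)) h.width
        (y := min (y i) (b + 1))
      omega

end Cut

/-- The state of the search after the reports on the largest values: the remaining candidates are
exactly those that the reports permit, and a node whose hole contained the last threshold has lowered
the potential. -/
lemma Server.update_spec {k W b l : ℕ} {m y : Fin n → ℕ} {s : Server n}
    (h : GapsOk W s.mid m y s.gaps s.holed) (hlow : ∀ i ∈ s.mid, s.lows i = m i)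
    {y' : Fin n → ℕ} (hy : ∀ i ∈ s.mid, y' i = min (y i) (b + 1))
    (hlen : s.pend.length ≤ 1) (hpick : s.pend ≠ [] → IsPick s.gaps l)
    (hpend : ∀ i ∈ s.pend, i ∈ s.mid ∧ m i < l ∧ l < y i) :
    GapsOk W s.mid m y (s.update k b y').1 (s.update k b y').2 ∧
    weight (s.update k b y').1 ≤ weight s.gaps ∧
    potential W s.mid (s.update k b y').1 (s.update k b y').2 + s.pend.length ≤
      potential W s.mid s.gaps s.holed ∧
    ∀ l', Mem l' (s.update k b y').1 ↔ Mem l' s.gaps ∧ l' ≤ b ∧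
      kth (s.need k + 1) s.mid y' ≤ l' ∧ ∀ i ∈ s.mid, l' ≤ m i ∨ min (y i) (b + 1) ≤ l' := by
  set a := kth (s.need k + 1) s.mid y' with ha
  have hr : Refines (above a (below (b + 1) s.gaps)) s.gaps :=
    (refines_above _ _).trans (refines_below _ _)
  have hok : GapsOk W s.mid m y (above a (below (b + 1) s.gaps)) s.holed :=
    h.refine ((h.sorted.below _).above _) hr (fun _ => le_rfl) fun _ => le_rfl
  have hb' : ∀ g ∈ above a (below (b + 1) s.gaps), g.2 ≤ b := by
    refine le_of_refines (refines_above _ _) fun g hg => ?_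
    obtain ⟨g', -, -, rfl⟩ := mem_below_iff.1 hg
    exact (min_le_right _ _).trans (by omega)
  have hL : ∀ i ∈ s.pend ++ s.mid.toList, i ∈ s.mid := by
    intro i hi
    rcases List.mem_append.1 hi with hi | hi
    exacts [(hpend i hi).1, Finset.mem_toList.1 hi]
  -- the reports determine the holes of the undecided nodes, up to the truncation at `b + 1`
  have hfold : ∀ (L : List (Fin n)), (∀ i ∈ L, i ∈ s.mid) → ∀ st,
      L.foldl (cutStep s.lows y') st = L.foldl (cutStep m fun i => min (y i) (b + 1)) st := by
    intro L
    induction L with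
    | nil => intros; rfl
    | cons i L ih =>
      intro hL st
      have hi := hL i List.mem_cons_self
      have e : cutStep s.lows y' st i = cutStep m (fun i => min (y i) (b + 1)) st i := by
        unfold cutStep; rw [hlow i hi, hy i hi]
      rw [List.foldl_cons, List.foldl_cons, e, ih fun j hj => hL j (List.mem_cons_of_mem _ hj)]
  have hup : s.update k b y' = (s.pend ++ s.mid.toList).foldl
      (cutStep m fun i => min (y i) (b + 1)) (above a (below (b + 1) s.gaps), s.holed) :=
    hfold _ hL _
  obtain ⟨h1, h2, h3, h4, h5⟩ := hok.foldl_cutStep (s.pend ++ s.mid.toList) hL hb'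
  rw [hup]
  have hw : weight (above a (below (b + 1) s.gaps)) ≤ weight s.gaps :=
    (weight_above_le _ _).trans (weight_below_le _ _)
  refine ⟨h1, h3.trans hw, ?_, fun l' => ?_⟩
  · have hp : potential W s.mid (above a (below (b + 1) s.gaps)) s.holed ≤
        potential W s.mid s.gaps s.holed := by
      have e1 := listPot_above_le a (below (b + 1) s.gaps)
      have e2 := listPot_below_le (b + 1) s.gaps
      unfold potential; omega
    rcases e : s.pend with _ | ⟨i, L⟩
    · rw [e] at h4; simpa using h4.trans hp
    · obtain rfl : L = [] := by
        rw [e] at hlen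
        exact List.eq_nil_of_length_eq_zero (by simpa using hlen)
      have hi := hpend i (by simp [e])
      have e1 := h.potential_pend (b := b) (a := a) (hpick (by simp [e])) hi.1 hi.2.1 hi.2.2
      have hL' : ∀ j ∈ s.mid.toList, j ∈ s.mid := fun j hj => Finset.mem_toList.1 hj
      obtain ⟨-, -, -, e2, -⟩ := (hok.cutStep (b := b) hi.1).foldl_cutStep s.mid.toList hL'
        (le_of_refines (refines_cutStep _ _ _ _) hb')
      simp only [List.singleton_append, List.foldl_cons, List.length_singleton]
      exact (Nat.add_le_add_right e2 1).trans e1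
  · rw [h5, mem_above, mem_below, Nat.lt_succ_iff, and_assoc, and_assoc]
    refine and_congr_right fun _ => and_congr_right fun _ => and_congr_right fun _ => ?_
    constructor
    · intro h i hi
      exact h i (List.mem_append.2 (.inr (Finset.mem_toList.2 hi)))
    · intro h i hi
      exact h i (hL i hi)

/-! ### Invariants -/

/-- The nodes agree with the server on the last request and the round, and have seen `v`. -/
structure Synced (v : Values n) (s : Server n) (nd : Fin n → Node n) : Prop where
  id : ∀ i, (nd i).id = i
  val : ∀ i, (nd i).val = v i
  cmd : ∀ i, (nd i).cmd = s.cmd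
  rnd : ∀ i, (nd i).rnd = s.rnd
  low : ∀ i, (nd i).low ≤ v i
  high : ∀ i, v i ≤ (nd i).high

/-- The nodes and the server agree on the roles, which permit outputs of size `k`. -/
structure RolesOk (k : ℕ) (s : Server n) (nd : Fin n → Node n) : Prop where
  top : ∀ i, (nd i).role = .top ↔ i ∈ s.top
  mid : ∀ i, (nd i).role = .mid ↔ i ∈ s.mid
  card_top : s.top.card < k
  card : k ≤ s.top.card + s.mid.card

/-- The knowledge of the server about the present phase is correct. Before the first phase nothing
is claimed about feasible outputs. -/
structure PhaseOk (ε : ℝ) (k : ℕ) (s : Server n) (nd : Fin n → Node n) : Prop where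
  roles : RolesOk k s nd
  gaps : GapsOk s.width s.mid (fun i => (nd i).low) (fun i => scaleDown ε (nd i).high) s.gaps s.holed
  sound : s.phases = 0 ∨ ∀ F l, Feas ε k (fun i => (nd i).low) (fun i => (nd i).high) F l →
    s.top ⊆ F ∧ F ⊆ s.top ∪ s.mid ∧ Mem l s.gaps

/-- The filters belong to the threshold `l`, and the server knows which of them have been violated
by undecided nodes, except for violations in the present time step. -/
structure WatchOk (ε : ℝ) (k l : ℕ) (v : Values n) (s : Server n) (nd : Fin n → Node n) : Prop where
  pick : IsPick s.gaps l
  fell_sub : s.fell ⊆ s.mid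
  rose_sub : s.rose ⊆ s.mid
  disj : Disjoint s.fell s.rose
  fell_card : s.fell.card + s.need k ≤ s.mid.card
  rose_card : s.rose.card ≤ s.need k
  fell : ∀ i ∈ s.fell, (nd i).low < l
  rose : ∀ i ∈ s.rose, l < scaleDown ε (nd i).high
  lo : ∀ i, (nd i).filt.lo = if i ∈ s.top ∨ (i ∈ s.mid ∧ i ∉ s.fell) then l else 0
  hi : ∀ i, (nd i).filt.hi = if i ∈ s.top ∨ i ∈ s.rose then ⊤ else (scaleUp ε l : ℕ∞)
  low : ∀ i ∈ s.mid, i ∉ s.fell → (nd i).low < l → v i < l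
  high : ∀ i ∈ s.mid, i ∉ s.rose → l < scaleDown ε (nd i).high → l < scaleDown ε (v i)
  quiet : s.idle = false → ∀ i ∈ s.mid, (nd i).filt.Contains (v i)
  rnd : s.rnd ≤ lastRound n

/-- A node that is pending has a hole around the midpoint of an interval. -/
def PendOk (ε : ℝ) (s : Server n) (nd : Fin n → Node n) : Prop :=
  s.pend.length ≤ 1 ∧ ∃ l, (s.pend ≠ [] → IsPick s.gaps l) ∧
    ∀ i ∈ s.pend, i ∈ s.mid ∧ (nd i).low < l ∧ l < scaleDown ε (nd i).high

/-- The server knows the least values of the undecided nodes. -/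
def HighOk (k b : ℕ) (s : Server n) (nd : Fin n → Node n) : Prop :=
  (∀ i ∈ s.mid, s.lows i = (nd i).low) ∧ b = kth (s.need k) s.mid s.lows

/-- The phase has started with the values `v`. -/
def Flat (v : Values n) (nd : Fin n → Node n) : Prop := ∀ i, (nd i).low = v i ∧ (nd i).high = v i

/-- The nodes with the `k` largest keys take part in the search. -/
def SampleOk (k r t : ℕ) (v : Values n) : Prop :=
  r ≤ lastRound n ∧ k ≤ (Finset.univ.filter fun i => t ≤ keyOf i (v i)).card

/-- The `k`-th largest value has been found. -/
def ClassifyOk (ε : ℝ) (k z : ℕ) (v : Values n) (s : Server n) (nd : Fin n → Node n) : Prop :=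
  z = kthLargest k v ∧ s.top = clearlyLarger ε k v ∧ ∀ i, (nd i).role = roleFor ε z 0 i (v i)

/-- What holds while the server waits for answers to its last request. -/
def StageOk (ε : ℝ) (k : ℕ) (v : Values n) (s : Server n) (nd : Fin n → Node n) : Prop :=
  match s.cmd with
  | .watch l => PhaseOk ε k s nd ∧ WatchOk ε k l v s nd
  | .askLow => PhaseOk ε k s nd ∧ PendOk ε s nd
  | .askHigh b => PhaseOk ε k s nd ∧ PendOk ε s nd ∧ HighOk k b s nd
  | .sample r t => SampleOk k r t v
  | .classify z 0 => ClassifyOk ε k z v s nd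
  | .classify z (w + 1) =>
    (PhaseOk ε k s nd ∧ PendOk ε s nd) ∧ z = kthLargest k v ∧ w < n

/-- A new phase has started, but its budget has not been determined. -/
def Cmd.Early : Cmd → Prop
  | .sample _ _ => True
  | .classify _ 0 => True
  | _ => False

/-- What has happened since the start of the time step, when the states were `s₀` and `nd₀`: no new
phase has started, or one has, because no output was feasible. -/
def Since (ε : ℝ) (k : ℕ) (v : Values n) (s₀ : Server n) (nd₀ : Fin n → Node n) (s : Server n)
    (nd : Fin n → Node n) : Prop :=
  open Classical in
  (s.phases = s₀.phases ∧ s.paid = s₀.paid ∧ ¬ s.cmd.Early ∧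
    ∀ i, (nd i).low = (nd₀ i).low ∧ (nd i).high = (nd₀ i).high) ∨
  (s.phases = s₀.phases + 1 ∧ Flat v nd ∧
    (s₀.phases = 0 ∨ ∀ F l, ¬ Feas ε k (fun i => (nd₀ i).low) (fun i => (nd₀ i).high) F l) ∧
    s.paid = s₀.paid + if s.cmd.Early then 0 else
      phaseCost n k ε (kthLargest k v) (neighborhood ε k v).card)

/-- The invariant of the communication in a time step. -/
structure Inv (ε : ℝ) (k : ℕ) (v : Values n) (s₀ : Server n) (nd₀ : Fin n → Node n) (s : Server n)
    (nd : Fin n → Node n) : Prop where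
  synced : Synced v s nd
  since : Since ε k v s₀ nd₀ s nd
  stage : StageOk ε k v s nd

/-- What holds at the end of a time step. -/
structure EndOk (ε : ℝ) (k : ℕ) (v : Values n) (s : Server n) (nd : Fin n → Node n) : Prop where
  id : ∀ i, (nd i).id = i
  val : ∀ i, (nd i).val = v i
  cmd : ∀ i, (nd i).cmd = s.cmd
  low : ∀ i, (nd i).low ≤ v i
  high : ∀ i, v i ≤ (nd i).high
  rnd : s.rnd = 0
  idle : s.idle = true
  phase : PhaseOk ε k s nd
  watch : ∃ l, s.cmd = .watch l ∧ WatchOk ε k l v s nd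
  contains : ∀ i, (nd i).filt.Contains (v i)

section Watch
variable {ε : ℝ} {k l : ℕ} {v : Values n} {s : Server n} {nd : Fin n → Node n} {S : Fin n → Bool}

/-- The answers of the nodes that speak. -/
def answers (ε : ℝ) (nd : Fin n → Node n) (S : Fin n → Bool) (i : Fin n) : ℕ :=
  if S i then (nd i).ans ε else 0

@[simp] lemma mem_speakers {i : Fin n} : i ∈ speakers S ↔ S i = true := by simp [speakers]

/-- The node violates its filter. -/
def Violates (nd : Fin n → Node n) (i : Fin n) : Prop := ¬ (nd i).filt.Contains (nd i).val

lemma prob_watch (hs : Synced v s nd) (hc : s.cmd = .watch l) (i : Fin n) :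
    (¬ Violates nd i → (nd i).prob = 0) ∧
    (Violates nd i → (nd i).role = .mid → (nd i).prob = 1) ∧
    (Violates nd i → (nd i).role ≠ .mid → (nd i).prob = sendProb n s.rnd) := by
  have h1 := hs.cmd i
  have h2 := hs.rnd i
  unfold Violates Node.prob
  rw [h1, hc]
  refine ⟨fun h => ?_, fun h h' => ?_, fun h h' => ?_⟩
  · simp only; rw [if_pos (not_not.1 h)]
  · simp only; rw [if_neg h, h']
  · simp only; rw [if_neg h, h2]

lemma violates_of_speaks (hs : Synced v s nd) (hc : s.cmd = .watch l)
    (hS : Possible (fun i => (nd i).prob) S) {i : Fin n} (hi : S i = true) : Violates nd i := by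
  by_contra h
  have := hS.of_eq_zero ((prob_watch hs hc i).1 h)
  simp [hi] at this

lemma speaks_of_mid (hr : RolesOk k s nd) (hs : Synced v s nd) (hc : s.cmd = .watch l)
    (hS : Possible (fun i => (nd i).prob) S) {i : Fin n} (hi : Violates nd i) (hm : i ∈ s.mid) :
    S i = true :=
  hS.of_eq_one ((prob_watch hs hc i).2.1 hi ((hr.mid i).2 hm))

lemma sendProb_last {r : ℕ} (h : lastRound n ≤ r) : sendProb n r = 1 := by
  apply Subtype.ext
  simp [sendProb, Nat.sub_eq_zero_of_le h]

lemma speaks_of_last (hs : Synced v s nd) (hc : s.cmd = .watch l)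
    (hS : Possible (fun i => (nd i).prob) S) (hr : lastRound n ≤ s.rnd) {i : Fin n}
    (hi : Violates nd i) : S i = true := by
  by_cases h : (nd i).role = .mid
  · exact hS.of_eq_one ((prob_watch hs hc i).2.1 hi h)
  · exact hS.of_eq_one (((prob_watch hs hc i).2.2 hi h).trans (sendProb_last hr))

lemma answer_eq_one (hs : Synced v s nd) (hc : s.cmd = .watch l) {i : Fin n} (hi : S i = true) :
    answers ε nd S i = 1 ↔ v i < (nd i).filt.lo := by
  unfold answers Node.ans
  rw [if_pos hi, hs.cmd i, hc, hs.val i]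
  simp only
  split_ifs <;> simp_all

/-- A violation that is not from below is from above. -/
lemma hi_lt_of_violates (hs : Synced v s nd) {i : Fin n} (hi : Violates nd i)
    (h : ¬ v i < (nd i).filt.lo) : (nd i).filt.hi < (v i : ℕ∞) := by
  unfold Violates Interval.Contains at hi
  rw [hs.val i] at hi
  push Not at h
  by_contra hc
  exact hi ⟨h, not_lt.1 hc⟩

lemma RolesOk.not_mid (hr : RolesOk k s nd) {i : Fin n} (h : i ∈ s.top) : i ∉ s.mid := by
  intro hm
  have h1 := (hr.top i).2 h
  rw [(hr.mid i).2 hm] at h1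
  exact absurd h1 (by simp)

lemma RolesOk.disjoint (hr : RolesOk k s nd) : Disjoint s.top s.mid :=
  Finset.disjoint_left.2 fun _ => hr.not_mid

section Facts
variable (h0 : 0 < ε) (hε : ε < 1) (hs : Synced v s nd) (hc : s.cmd = .watch l) (hr : RolesOk k s nd)
  (hw : WatchOk ε k l v s nd) (hS : Possible (fun i => (nd i).prob) S)
include hs hc hr hw

lemma fell_report {i : Fin n} (hm : i ∈ s.mid) (hi : S i = true)
    (ha : answers ε nd S i = 1) : i ∉ s.fell ∧ (nd i).low < l := by
  have ht : i ∉ s.top := fun h => hr.not_mid h hm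
  rw [answer_eq_one hs hc hi, hw.lo] at ha
  split_ifs at ha with h
  · exact ⟨(h.resolve_left ht).2, (hs.low i).trans_lt ha⟩
  · omega

include hε hS in
lemma rose_report {i : Fin n} (hm : i ∈ s.mid) (hi : S i = true)
    (ha : answers ε nd S i ≠ 1) : i ∉ s.rose ∧ l < scaleDown ε (nd i).high := by
  have ht : i ∉ s.top := fun h => hr.not_mid h hm
  have h1 := hi_lt_of_violates hs (violates_of_speaks hs hc hS hi)
    (fun h => ha ((answer_eq_one hs hc hi).2 h))
  rw [hw.hi] at h1
  split_ifs at h1 with h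
  · exact absurd h1 not_top_lt
  · have h2 : scaleUp ε l < v i := by exact_mod_cast h1
    exact ⟨fun h' => h (.inr h'), ((scaleUp_lt_iff hε).1 h2).trans_le (scaleDown_mono hε (hs.high i))⟩

lemma newFell_spec : s.newFell (speakers S) (answers ε nd S) ⊆ s.mid ∧
    ∀ i ∈ s.newFell (speakers S) (answers ε nd S), (nd i).low < l := by
  unfold Server.newFell
  refine ⟨Finset.union_subset hw.fell_sub fun i hi => ?_, fun i hi => ?_⟩
  · exact Finset.mem_of_mem_inter_right (Finset.mem_of_mem_filter i hi)
  · rcases Finset.mem_union.1 hi with h | h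
    · exact hw.fell i h
    · simp only [Finset.mem_filter, Finset.mem_inter, mem_speakers] at h
      exact (fell_report hs hc hr hw h.1.2 h.1.1 h.2).2

include hε hS in
lemma newRose_spec : s.newRose (speakers S) (answers ε nd S) ⊆ s.mid ∧
    ∀ i ∈ s.newRose (speakers S) (answers ε nd S), l < scaleDown ε (nd i).high := by
  unfold Server.newRose
  refine ⟨Finset.union_subset hw.rose_sub fun i hi => ?_, fun i hi => ?_⟩
  · exact Finset.mem_of_mem_inter_right (Finset.mem_of_mem_filter i hi)
  · rcases Finset.mem_union.1 hi with h | h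
    · exact hw.rose i h
    · simp only [Finset.mem_filter, Finset.mem_inter, mem_speakers] at h
      exact (rose_report hε hs hc hr hw hS h.1.2 h.1.1 h.2).2

include hε hS in
/-- Every report of an undecided node is new. -/
lemma card_reports : s.fell.card + s.rose.card + (speakers S ∩ s.mid).card ≤
    (s.newFell (speakers S) (answers ε nd S)).card +
      (s.newRose (speakers S) (answers ε nd S)).card := by
  unfold Server.newFell Server.newRose
  rw [Finset.card_union_of_disjoint, Finset.card_union_of_disjoint,
    ← Finset.card_filter_add_card_filter_not (s := speakers S ∩ s.mid)
      (fun i => answers ε nd S i = 1)]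
  · simp only [ne_eq]; omega
  · refine Finset.disjoint_left.2 fun i h1 h => ?_
    simp only [Finset.mem_filter, Finset.mem_inter, mem_speakers] at h
    exact (rose_report hε hs hc hr hw hS h.1.2 h.1.1 h.2).1 h1
  · refine Finset.disjoint_left.2 fun i h1 h => ?_
    simp only [Finset.mem_filter, Finset.mem_inter, mem_speakers] at h
    exact (fell_report hs hc hr hw h.1.2 h.1.1 h.2).1 h1

include hS in
lemma le_low_of_not_newFell {i : Fin n} (hm : i ∈ s.mid)
    (hi : i ∉ s.newFell (speakers S) (answers ε nd S)) : l ≤ (nd i).low := by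
  by_contra hlt
  have ht : i ∉ s.top := fun h => hr.not_mid h hm
  simp only [Server.newFell, Finset.mem_union, Finset.mem_filter, Finset.mem_inter, mem_speakers,
    not_or, not_and] at hi
  have h1 := hw.low i hm hi.1 (not_le.1 hlt)
  have h2 : v i < (nd i).filt.lo := by
    rw [hw.lo, if_pos (.inr ⟨hm, hi.1⟩)]; exact h1
  have h3 : Violates nd i := fun h => by
    have := h.1
    rw [hs.val] at this
    omega
  have h4 := speaks_of_mid hr hs hc hS h3 hm
  exact hi.2 ⟨h4, hm⟩ ((answer_eq_one hs hc h4).2 h2)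

include h0 hε hS in
lemma le_of_not_newRose {i : Fin n} (hm : i ∈ s.mid)
    (hi : i ∉ s.newRose (speakers S) (answers ε nd S)) : scaleDown ε (nd i).high ≤ l := by
  by_contra hlt
  have ht : i ∉ s.top := fun h => hr.not_mid h hm
  simp only [Server.newRose, Finset.mem_union, Finset.mem_filter, Finset.mem_inter, mem_speakers,
    not_or, not_and] at hi
  have h1 := (scaleUp_lt_iff hε).2 (hw.high i hm hi.1 (not_le.1 hlt))
  have h2 : (nd i).filt.hi < (v i : ℕ∞) := by
    rw [hw.hi, if_neg (not_or.2 ⟨ht, hi.1⟩)]; exact_mod_cast h1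
  have h3 : Violates nd i := fun h => by
    have := h.2
    rw [hs.val] at this
    exact absurd h2 (not_lt.2 this)
  have h4 := speaks_of_mid hr hs hc hS h3 hm
  have h5 := hi.2 ⟨h4, hm⟩
  rw [not_not, answer_eq_one hs hc h4, hw.lo] at h5
  have h6 := (le_scaleUp_iff hε).2 (scaleDown_le_self h0 l)
  split_ifs at h5 <;> omega

include hS in
lemma lt_of_tooHigh (h : s.TooHigh k (speakers S) (answers ε nd S)) {F : Finset (Fin n)} {l' : ℕ}
    (hF : Feas ε k (fun i => (nd i).low) (fun i => (nd i).high) F l')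
    (htop : s.top ⊆ F) (hsub : F ⊆ s.top ∪ s.mid) : l' < l := by
  rcases h with ⟨i, hi⟩ | h
  · rw [Finset.mem_inter, mem_speakers] at hi
    have h1 := violates_of_speaks hs hc hS hi.1
    have h2 : v i < l := by
      by_contra hcon
      refine h1 ⟨?_, ?_⟩
      · rw [hw.lo, if_pos (.inl hi.2), hs.val]; omega
      · rw [hw.hi, if_pos (.inl hi.2)]; exact le_top
    exact ((hF.2.1 i (htop hi.2)).trans (hs.low i)).trans_lt h2
  · by_contra hcon
    obtain ⟨h1, h2⟩ := newFell_spec (S := S) hs hc hr hw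
    have h3 : F ⊆ s.top ∪ (s.mid \ s.newFell (speakers S) (answers ε nd S)) := by
      intro i hi
      rcases Finset.mem_union.1 (hsub hi) with h | h
      · exact Finset.mem_union_left _ h
      · refine Finset.mem_union_right _ (Finset.mem_sdiff.2 ⟨h, fun h' => ?_⟩)
        have := h2 i h'
        have := hF.2.1 i hi
        dsimp only at this
        omega
    have h4 := Finset.card_le_card h3
    have h5 := Finset.card_union_le s.top (s.mid \ s.newFell (speakers S) (answers ε nd S))
    rw [Finset.card_sdiff_of_subset h1] at h5
    have h6 := Finset.card_le_card h1
    have h7 := hr.card_top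
    rw [hF.1] at h4
    unfold Server.need at h
    omega

include hε hS in
lemma lt_of_tooLow (h : s.TooLow k (speakers S) (answers ε nd S)) {F : Finset (Fin n)} {l' : ℕ}
    (hF : Feas ε k (fun i => (nd i).low) (fun i => (nd i).high) F l')
    (htop : s.top ⊆ F) (hsub : F ⊆ s.top ∪ s.mid) : l < l' := by
  rcases h with ⟨i, hi⟩ | h
  · simp only [Finset.mem_sdiff, mem_speakers, Finset.mem_union, not_or] at hi
    have h1 := violates_of_speaks hs hc hS hi.1
    have h2 : l < scaleDown ε (v i) := by
      by_contra hcon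
      refine h1 ⟨?_, ?_⟩
      · rw [hw.lo, if_neg (by tauto)]; exact Nat.zero_le _
      · rw [hw.hi, if_neg (not_or.2 ⟨hi.2.1, fun h => hi.2.2 (hw.rose_sub h)⟩), hs.val]
        exact_mod_cast (le_scaleUp_iff hε).2 (not_lt.1 hcon)
    have h3 : i ∉ F := fun h => by
      have := hsub h
      rw [Finset.mem_union] at this; tauto
    exact (h2.trans_le (scaleDown_mono hε (hs.high i))).trans_le (hF.2.2 i h3)
  · by_contra hcon
    obtain ⟨h1, h2⟩ := newRose_spec (S := S) hε hs hc hr hw hS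
    have h3 : s.top ∪ s.newRose (speakers S) (answers ε nd S) ⊆ F := by
      refine Finset.union_subset htop fun i hi => ?_
      by_contra hiF
      have := h2 i hi
      have := hF.2.2 i hiF
      dsimp only at this
      omega
    have h4 := Finset.card_le_card h3
    rw [Finset.card_union_of_disjoint (Finset.disjoint_of_subset_right h1 hr.disjoint), hF.1] at h4
    unfold Server.need at h
    omega

end Facts

end Watch

/-- The filters that the nodes compute agree with the knowledge of the server. -/
lemma filt_react {ε : ℝ} (hε : ε < 1) {k : ℕ} {s : Server n} {nd : Fin n → Node n}
    (hr : RolesOk k s nd) {l : ℕ} {fell rose : Finset (Fin n)}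
    (hro : rose ⊆ s.mid) (h1 : ∀ i ∈ s.mid, i ∈ fell ↔ (nd i).low < l)
    (h2 : ∀ i ∈ s.mid, i ∈ rose ↔ l < scaleDown ε (nd i).high) (i : Fin n) :
    (((nd i).react ε (some (.watch l))).filt.lo =
      if i ∈ s.top ∨ (i ∈ s.mid ∧ i ∉ fell) then l else 0) ∧
    (((nd i).react ε (some (.watch l))).filt.hi =
      if i ∈ s.top ∨ i ∈ rose then ⊤ else (scaleUp ε l : ℕ∞)) := by
  simp only [Node.react]
  cases e : (nd i).role
  · have ht := (hr.top i).1 e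
    simp [Role.filt, ht]
  · have hm := (hr.mid i).1 e
    have ht : i ∉ s.top := fun h => hr.not_mid h hm
    have e1 := h1 i hm
    have e2 := h2 i hm
    rw [← scaleUp_lt_iff hε] at e2
    simp [Role.filt, ht, hm, e1, e2]
    split_ifs <;> omega
  · have ht : i ∉ s.top := fun h => by rw [(hr.top i).2 h] at e; simp at e
    have hm : i ∉ s.mid := fun h => by rw [(hr.mid i).2 h] at e; simp at e
    have hm' : i ∉ rose := fun h => hm (hro h)
    simp [Role.filt, ht, hm, hm']

/-- The filter of an undecided node contains its value if it has been adapted to the values of the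
phase. -/
lemma contains_of_filt {ε : ℝ} (hε : ε < 1) {l m M x : ℕ} {I : Interval} {p q p' q' : Prop}
    [Decidable (p ∨ q)] [Decidable (p' ∨ q')] (hlo : I.lo = if p ∨ q then l else 0)
    (hhi : I.hi = if p' ∨ q' then ⊤ else (scaleUp ε l : ℕ∞)) (h1 : p ∨ q → l ≤ m)
    (h2 : ¬ q' → scaleDown ε M ≤ l) (hm : m ≤ x) (hM : x ≤ M) : I.Contains x := by
  refine ⟨?_, ?_⟩
  · rw [hlo]
    split_ifs with h
    exacts [(h1 h).trans hm, Nat.zero_le _]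
  · rw [hhi]
    split_ifs with h
    · exact le_top
    · have := h2 fun h' => h (.inr h')
      exact_mod_cast hM.trans ((le_scaleUp_iff hε).2 this)

/-- A broadcast brings the nodes up to date with the server. -/
lemma Synced.react_some {ε : ℝ} {v : Values n} {s s' : Server n} {nd : Fin n → Node n}
    (h : Synced v s nd) (c : Cmd) (hc : s'.cmd = c) (hr : s'.rnd = 0) :
    Synced v s' fun i => (nd i).react ε (some c) where
  id := h.id
  val := h.val
  cmd _ := hc.symm
  rnd _ := hr.symm
  low i := by
    simp only [Node.react]
    split
    exacts [(h.val i).le, h.low i]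
  high i := by
    simp only [Node.react]
    split
    exacts [(h.val i).ge, h.high i]

section WatchStep
variable {ε : ℝ} {k l : ℕ} {v : Values n} {s₀ s : Server n} {nd₀ nd : Fin n → Node n}
  {S : Fin n → Bool}

lemma refines_trimmed (k : ℕ) (s : Server n) (l : ℕ) (S : Finset (Fin n)) (a : Fin n → ℕ) :
    Refines (s.trimmed k l S a) s.gaps := by
  unfold Server.trimmed
  split_ifs
  exacts [(refines_above _ _).trans (refines_below _ _), refines_above _ _, refines_below _ _,
    Refines.refl _]

lemma sorted_trimmed {k : ℕ} {s : Server n} (h : Sorted s.gaps) (l : ℕ) (S : Finset (Fin n))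
    (a : Fin n → ℕ) : Sorted (s.trimmed k l S a) := by
  unfold Server.trimmed
  split_ifs
  exacts [(h.below _).above _, h.above _, h.below _, h]

lemma mem_trimmed {k : ℕ} {s : Server n} {l l' : ℕ} {S : Finset (Fin n)} {a : Fin n → ℕ}
    (h1 : s.TooHigh k S a → l' < l) (h2 : s.TooLow k S a → l < l') (h : Mem l' s.gaps) :
    Mem l' (s.trimmed k l S a) := by
  unfold Server.trimmed
  split_ifs with h3 h4 h4
  · have := h1 h4
    have := h2 h3
    omega
  · exact mem_above.2 ⟨h, h2 h3⟩
  · exact mem_below.2 ⟨h, h1 h4⟩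
  · exact h

/-- The transition from a state in which the server waits for reports of violations. -/
lemma Inv.watchStep (h0 : 0 < ε) (hε : ε < 1) (h : Inv ε k v s₀ nd₀ s nd) (hc : s.cmd = .watch l)
    (hS : Possible (fun i => (nd i).prob) S) :
    let r := s.watchStep k l (speakers S) (answers ε nd S)
    let nd' := fun i => (nd i).react ε r.2
    (r.1.idle = false → Inv ε k v s₀ nd₀ r.1 nd') ∧
    (r.1.idle = true → EndOk ε k v r.1 nd' ∧ Since ε k v s₀ nd₀ r.1 nd') := by
  obtain ⟨hp, hw⟩ : PhaseOk ε k s nd ∧ WatchOk ε k l v s nd := by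
    have := h.stage; unfold StageOk at this; rwa [hc] at this
  have hs := h.synced
  have hr := hp.roles
  have hsince := h.since
  unfold Server.watchStep
  by_cases hempty : speakers S = ∅
  · rw [if_pos hempty]
    -- silence: undecided violators would have spoken with certainty
    have hno : ∀ i, S i = false := fun i => by
      by_contra hi
      have : i ∈ speakers S := by simpa using hi
      rw [hempty] at this; simp at this
    have hmid : ∀ i ∈ s.mid, (nd i).filt.Contains (v i) := fun i hi => by
      by_contra hcon
      have := speaks_of_mid hr hs hc hS (by unfold Violates; rwa [hs.val i]) hi
      simp [hno i] at this
    have hwatch : ∀ c r b, r ≤ lastRound n →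
        WatchOk ε k l v { s with cmd := c, rnd := r, idle := b }
        fun i => (nd i).react ε none := fun c r b hr => { hw with quiet := fun _ => hmid, rnd := hr }
    refine ⟨fun hi => ?_, fun hi => ?_⟩
    · have hlt : ¬ lastRound n ≤ s.rnd := by simpa using hi
      refine ⟨⟨hs.id, hs.val, hs.cmd, fun i => ?_, hs.low, hs.high⟩, hsince, ?_⟩
      · simp only [Node.react, hs.rnd i]; rw [if_neg hlt]
      · simp only [StageOk, hc]
        refine ⟨⟨⟨hr.top, hr.mid, hr.card_top, hr.card⟩, hp.gaps, hp.sound⟩, ?_⟩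
        refine hwatch _ _ _ ?_
        rw [if_neg hlt]; omega
    -- in the last round everybody speaks with probability one, so that silence is conclusive
    · have hle : lastRound n ≤ s.rnd := by simpa using hi
      refine ⟨⟨hs.id, hs.val, hs.cmd, hs.low, hs.high, by simp only; rw [if_pos hle], hi,
        ⟨⟨hr.top, hr.mid, hr.card_top, hr.card⟩, hp.gaps, hp.sound⟩, ⟨l, hc, hwatch _ _ _ ?_⟩,
        fun i => ?_⟩, hsince⟩
      · rw [if_pos hle]; exact Nat.zero_le _
      · by_contra hcon
        have := speaks_of_last hs hc hS hle (i := i)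
          (by unfold Violates; rw [hs.val i]; exact hcon)
        simp [hno i] at this
  rw [if_neg hempty]
  by_cases hok : s.StillOk k (speakers S) (answers ε nd S)
  · rw [if_pos hok]
    refine ⟨fun _ => ?_, fun hi => by simp [Server.ask] at hi⟩
    -- the threshold stays; the reporting undecided nodes get one-sided filters
    obtain ⟨hh, hl, hd⟩ := hok
    obtain ⟨f1, f2⟩ := newFell_spec (S := S) hs hc hr hw
    obtain ⟨g1, g2⟩ := newRose_spec (S := S) hε hs hc hr hw hS
    have f3 := fun i hm => le_low_of_not_newFell (i := i) hs hc hr hw hS hm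
    have g3 := fun i hm => le_of_not_newRose (i := i) h0 hε hs hc hr hw hS hm
    have hfilt := filt_react hε hr (l := l) g1
      (fun i hm => ⟨f2 i, fun h => by by_contra hcon; have := f3 i hm hcon; omega⟩)
      (fun i hm => ⟨g2 i, fun h => by by_contra hcon; have := g3 i hm hcon; omega⟩)
    refine ⟨hs.react_some _ rfl rfl, ?_, ?_⟩
    · unfold Since at *
      rw [hc] at hsince
      exact hsince
    · refine ⟨⟨⟨hr.top, hr.mid, hr.card_top, hr.card⟩, hp.gaps, hp.sound⟩, ?_⟩
      refine ⟨hw.pick, f1, g1, hd, ?_, ?_, f2, g2, fun i => (hfilt i).1, fun i => (hfilt i).2,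
        fun i hm hi hlt => ?_, fun i hm hi hlt => ?_, fun _ i hm => ?_, Nat.zero_le _⟩
      · by_contra hcon; exact hh (.inr (not_le.1 hcon))
      · by_contra hcon; exact hl (.inr (not_le.1 hcon))
      · have := f3 i hm hi
        simp only [Node.react] at hlt; omega
      · have := g3 i hm hi
        simp only [Node.react] at hlt; omega
      · exact contains_of_filt hε (hfilt i).1 (hfilt i).2
          (fun h => f3 i hm (h.resolve_left fun h => hr.not_mid h hm).2) (g3 i hm) (hs.low i)
          (hs.high i)
  · rw [if_neg hok]
    refine ⟨fun _ => ?_, fun hi => by simp [Server.ask] at hi⟩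
    refine ⟨hs.react_some _ rfl rfl, ?_, ?_⟩
    · unfold Since at *
      rw [hc] at hsince
      exact hsince
    · refine ⟨⟨⟨hr.top, hr.mid, hr.card_top, hr.card⟩, hp.gaps.refine
        (sorted_trimmed hp.gaps.sorted _ _ _) (refines_trimmed _ _ _ _ _) (fun _ => le_rfl)
        fun _ => le_rfl, ?_⟩, ?_⟩
      -- the threshold fails: a feasible threshold is not lost with the discarded candidates
      · refine hp.sound.imp id fun H F l' hF => ?_
        obtain ⟨e1, e2, e3⟩ := H F l' hF
        exact ⟨e1, e2, mem_trimmed (fun ht => lt_of_tooHigh hs hc hr hw hS ht hF e1 e2)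
          (fun ht => lt_of_tooLow hε hs hc hr hw hS ht hF e1 e2) e3⟩
      · unfold PendOk Server.culprit Server.trimmed
        simp only
        by_cases hT : s.TooHigh k (speakers S) (answers ε nd S) ∨
            s.TooLow k (speakers S) (answers ε nd S)
        · rw [if_pos hT]
          exact ⟨by simp, l, fun h => absurd rfl h, by simp⟩
        · rw [if_neg hT]
          refine ⟨by simp, l, fun _ => ?_, fun i hi => ?_⟩
          · rw [if_neg fun h => hT (.inr h), if_neg fun h => hT (.inl h)]
            exact hw.pick
          · have hi := Finset.mem_toList.1 (List.mem_of_mem_take hi)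
            rw [Finset.mem_inter] at hi
            exact ⟨(newFell_spec hs hc hr hw).1 hi.1, (newFell_spec hs hc hr hw).2 i hi.1,
              (newRose_spec hε hs hc hr hw hS).2 i hi.2⟩

end WatchStep

/-! ### The transitions of the search within a phase -/

section Transitions
variable {ε : ℝ} {k l : ℕ} {v : Values n} {s₀ s s' : Server n} {nd₀ nd nd' : Fin n → Node n}
  {S : Fin n → Bool}

/-- All undecided nodes, and no others, answer to this request. -/
def Cmd.AsksMid : Cmd → Prop
  | .askLow => True
  | .askHigh _ => True
  | .classify _ _ => True
  | _ => False

lemma prob_asksMid {q : Node n} (hc : q.cmd.AsksMid) :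
    (q.role = .mid → q.prob = 1) ∧ (q.role ≠ .mid → q.prob = 0) := by
  unfold Node.prob
  cases e : q.cmd <;> rw [e] at hc <;> simp only [Cmd.AsksMid] at hc <;>
    cases e' : q.role <;> simp

lemma speakers_eq_of_asksMid {M : Finset (Fin n)} (hs : Synced v s nd) (hc : s.cmd.AsksMid)
    (hM : ∀ i, (nd i).role = .mid ↔ i ∈ M) (hS : Possible (fun i => (nd i).prob) S) :
    speakers S = M := by
  ext i
  rw [mem_speakers]
  have h := prob_asksMid (q := nd i) (by rw [hs.cmd i]; exact hc)
  by_cases hm : i ∈ M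
  · have := hS.of_eq_one (h.1 ((hM i).2 hm))
    simp [hm, this]
  · have := hS.of_eq_zero (h.2 fun e => hm ((hM i).1 e))
    simp [hm, this]

lemma Since.of_eq (h : Since ε k v s₀ nd₀ s nd) (h1 : s'.phases = s.phases) (h2 : s'.paid = s.paid)
    (h3 : s'.cmd.Early ↔ s.cmd.Early)
    (h4 : ∀ i, (nd' i).low = (nd i).low ∧ (nd' i).high = (nd i).high) :
    Since ε k v s₀ nd₀ s' nd' := by
  unfold Since Flat at *
  rw [h1, h2, propext h3]
  simp only [fun i => (h4 i).1, fun i => (h4 i).2]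
  exact h

lemma react_low {c : Cmd} (hc : ¬ c.Early) (q : Node n) :
    (q.react ε (some c)).low = q.low ∧ (q.react ε (some c)).high = q.high := by
  unfold Node.react
  cases c <;> simp_all [Cmd.Early]

/-- The server has asked for the least values of the undecided nodes. -/
def Cmd.AsksLow : Cmd → Prop
  | .askLow => True
  | .classify _ (_ + 1) => True
  | _ => False

lemma Cmd.AsksLow.asksMid {c : Cmd} (h : c.AsksLow) : c.AsksMid ∧ ¬ c.Early := by
  cases c with
  | classify z w => cases w <;> simp_all [Cmd.AsksLow, Cmd.AsksMid, Cmd.Early]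
  | _ => simp_all [Cmd.AsksLow, Cmd.AsksMid, Cmd.Early]

lemma Cmd.AsksLow.stageOk (hc : s.cmd.AsksLow) :
    StageOk ε k v s nd → PhaseOk ε k s nd ∧ PendOk ε s nd := by
  unfold StageOk
  cases e : s.cmd with
  | classify z w =>
    cases w with
    | zero => simp_all [Cmd.AsksLow]
    | succ w => exact And.left
  | _ => simp_all [Cmd.AsksLow]

lemma answers_low (hs : Synced v s nd) (hc : s.cmd.AsksMid) (hb : ∀ b, s.cmd ≠ .askHigh b) {i : Fin n}
    (hi : S i = true) : answers ε nd S i = (nd i).low := by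
  unfold answers Node.ans
  rw [if_pos hi, hs.cmd i]
  cases e : s.cmd <;> rw [e] at hc <;> simp_all [Cmd.AsksMid]

/-- The transition from a state in which the server waits for the least values. -/
lemma Inv.lowStep (h : Inv ε k v s₀ nd₀ s nd) (hc : s.cmd.AsksLow)
    (hS : Possible (fun i => (nd i).prob) S) :
    let r := s.lowStep k (answers ε nd S)
    Inv ε k v s₀ nd₀ r.1 fun i => (nd i).react ε r.2 := by
  obtain ⟨hp, hq⟩ := hc.stageOk h.stage
  have hs := h.synced
  have hr := hp.roles
  have hm := speakers_eq_of_asksMid hs hc.asksMid.1 hr.mid hS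
  refine ⟨hs.react_some _ rfl rfl, h.since.of_eq rfl rfl ?_ fun i => react_low id _,
    ⟨⟨hr.top, hr.mid, hr.card_top, hr.card⟩, hp.gaps, hp.sound⟩, hq, fun i hi => ?_, rfl⟩
  · exact iff_of_false id hc.asksMid.2
  · refine answers_low hs hc.asksMid.1 (fun b hb => ?_) ?_
    · rw [hb] at hc; exact hc
    · rw [← mem_speakers, hm]; exact hi

lemma HighOk.answers {b : ℕ} (hp : RolesOk k s nd) (hs : Synced v s nd)
    (hc : s.cmd = .askHigh b) (hS : Possible (fun i => (nd i).prob) S) {i : Fin n} (hi : i ∈ s.mid) :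
    answers ε nd S i = min (scaleDown ε (nd i).high) (b + 1) := by
  have hm := speakers_eq_of_asksMid hs (by rw [hc]; trivial) hp.mid hS
  rw [← hm, mem_speakers] at hi
  unfold Monitor.answers Node.ans
  rw [if_pos hi, hs.cmd i, hc]

/-- Removing the excluded candidates keeps every feasible one. -/
lemma mem_update_of_feas {b : ℕ} {y : Fin n → ℕ} (hr : RolesOk k s nd) (hh : HighOk k b s nd)
    (hy : ∀ i ∈ s.mid, y i = min (scaleDown ε (nd i).high) (b + 1))
    (hspec : Mem l (s.update k b y).1 ↔ Mem l s.gaps ∧ l ≤ b ∧ kth (s.need k + 1) s.mid y ≤ l ∧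
      ∀ i ∈ s.mid, l ≤ (nd i).low ∨ min (scaleDown ε (nd i).high) (b + 1) ≤ l)
    {F : Finset (Fin n)} (hF : Feas ε k (fun i => (nd i).low) (fun i => (nd i).high) F l)
    (htop : s.top ⊆ F) (hsub : F ⊆ s.top ∪ s.mid) (hl : Mem l s.gaps) :
    Mem l (s.update k b y).1 := by
  have hct := hr.card_top
  have hcard := hr.card
  have hneed : s.need k = k - s.top.card := rfl
  rw [hspec]
  refine ⟨hl, ?_, ?_, fun i hi => ?_⟩
  · rw [hh.2]
    refine le_kth (by omega) ?_
    have h1 : F \ s.top ⊆ s.mid.filter fun i => l ≤ s.lows i := by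
      intro i hi
      rw [Finset.mem_sdiff] at hi
      have hm : i ∈ s.mid := (Finset.mem_union.1 (hsub hi.1)).resolve_left hi.2
      rw [Finset.mem_filter, hh.1 i hm]
      exact ⟨hm, hF.2.1 i hi.1⟩
    have h2 := Finset.card_le_card h1
    rw [Finset.card_sdiff_of_subset htop, hF.1] at h2
    exact h2
  · by_contra! hcon
    have hcd : s.need k + 1 ≤ s.mid.card := by
      by_contra! h
      have : kth (s.need k + 1) s.mid y = 0 := by
        unfold kth
        have : {t | s.need k + 1 ≤ (s.mid.filter fun i => t ≤ y i).card} = ∅ := by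
          ext t
          have := Finset.card_filter_le s.mid fun i => t ≤ y i
          simp only [Set.mem_ofPred_eq, Set.mem_empty_iff_false, iff_false]
          omega
        rw [this]; simp
      omega
    have h1 := card_of_le_kth (by omega) hcd (t := l + 1) hcon
    have h2 : s.top ∪ (s.mid.filter fun i => l + 1 ≤ y i) ⊆ F := by
      refine Finset.union_subset htop fun i hi => ?_
      rw [Finset.mem_filter] at hi
      by_contra hiF
      have h3 := hF.2.2 i hiF
      dsimp only at h3
      rw [hy i hi.1] at hi
      have := hi.2.trans (min_le_left _ _)
      omega
    have h3 := Finset.card_le_card h2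
    rw [Finset.card_union_of_disjoint (Finset.disjoint_of_subset_right (Finset.filter_subset _ _)
      hr.disjoint), hF.1] at h3
    omega
  · by_cases hi' : i ∈ F
    · exact .inl (hF.2.1 i hi')
    · exact .inr ((min_le_left _ _).trans (hF.2.2 i hi'))

/-- The transition from a state in which the server waits for the largest values. -/
lemma Inv.highStep (h0 : 0 < ε) (hε : ε < 1) (hk : 1 ≤ k) (hn : k ≤ n)
    (h : Inv ε k v s₀ nd₀ s nd) {b : ℕ} (hc : s.cmd = .askHigh b)
    (hS : Possible (fun i => (nd i).prob) S) :
    let r := s.highStep k b (answers ε nd S)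
    Inv ε k v s₀ nd₀ r.1 fun i => (nd i).react ε r.2 := by
  obtain ⟨hp, ⟨hlen, p, hpick, hpend⟩, hh⟩ : PhaseOk ε k s nd ∧ PendOk ε s nd ∧ HighOk k b s nd := by
    have := h.stage; unfold StageOk at this; rwa [hc] at this
  have hs := h.synced
  have hr := hp.roles
  have hct := hr.card_top
  have hcard := hr.card
  have hneed : s.need k = k - s.top.card := rfl
  have hy : ∀ i ∈ s.mid, answers ε nd S i = min (scaleDown ε (nd i).high) (b + 1) :=
    fun i hi => HighOk.answers hr hs hc hS hi
  obtain ⟨u1, -, -, u4⟩ := Server.update_spec (k := k) hp.gaps hh.1 hy hlen hpick hpend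
  have hsound : s.phases = 0 ∨ ∀ F l, Feas ε k (fun i => (nd i).low) (fun i => (nd i).high) F l →
      s.top ⊆ F ∧ F ⊆ s.top ∪ s.mid ∧ Mem l (s.update k b (answers ε nd S)).1 :=
    hp.sound.imp id fun H F l hF => by
      obtain ⟨e1, e2, e3⟩ := H F l hF
      exact ⟨e1, e2, mem_update_of_feas hr hh hy (u4 l) hF e1 e2 e3⟩
  unfold Server.highStep
  by_cases hnil : (s.update k b (answers ε nd S)).1 = []
  · rw [if_pos hnil]
    -- no candidate is left, so that no output is feasible and a new phase starts
    have hnone : s.phases = 0 ∨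
        ∀ F l, ¬ Feas ε k (fun i => (nd i).low) (fun i => (nd i).high) F l :=
      hsound.imp id fun H F l hF => by
        have := (H F l hF).2.2
        rw [hnil] at this
        obtain ⟨g, hg, -⟩ := this
        simp at hg
    refine ⟨hs.react_some _ rfl rfl, ?_, Nat.zero_le _, by simpa using hn⟩
    have hsince := h.since
    unfold Since at *
    rcases hsince with ⟨e1, e2, -, e3⟩ | ⟨e1, e2, e3, -⟩
    · right
      refine ⟨by simp [e1], fun i => ?_, ?_, ?_⟩
      · simp [Node.react, hs.val i]
      · simp only [fun i => (e3 i).1, fun i => (e3 i).2, e1] at hnone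
        exact hnone
      · simp [Server.ask, Cmd.Early, e2]
    · exfalso
      rcases hnone with hnone | hnone
      · omega
      · obtain ⟨F, hF⟩ := exists_feas h0 hk hn v
        refine hnone F (kthLargest k v) ?_
        simp only [fun i => (e2 i).1, fun i => (e2 i).2]
        exact hF
  · rw [if_neg hnil]
    simp only
    -- the new threshold lies in no hole and respects the bounds on the numbers of low and high nodes
    have hl := Classical.epsilon_spec (exists_isPick hnil)
    generalize Classical.epsilon (IsPick (s.update k b (answers ε nd S)).1) = l at hl ⊢
    obtain ⟨-, hlb, hla, hlm⟩ := (u4 l).1 (hl.mem u1.sorted)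
    have hfell : ∀ i, (i ∈ s.mid.filter fun i => s.lows i < l) ↔ i ∈ s.mid ∧ (nd i).low < l := by
      intro i
      rw [Finset.mem_filter]
      exact and_congr_right fun hi => by rw [hh.1 i hi]
    have hrose : ∀ i, (i ∈ s.mid.filter fun i => l < answers ε nd S i) ↔
        i ∈ s.mid ∧ l < scaleDown ε (nd i).high := by
      intro i
      rw [Finset.mem_filter]
      exact and_congr_right fun hi => by rw [hy i hi, lt_min_iff]; omega
    have hfilt := filt_react hε hr (l := l) (Finset.filter_subset _ _)
      (fun i hi => (hfell i).trans (and_iff_right hi))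
      (fun i hi => (hrose i).trans (and_iff_right hi))
    refine ⟨hs.react_some _ rfl rfl, h.since.of_eq rfl rfl ?_ fun i => react_low id _,
      ⟨⟨hr.top, hr.mid, hr.card_top, hr.card⟩, u1, hsound⟩, hl, Finset.filter_subset _ _,
      Finset.filter_subset _ _, ?_, ?_, ?_, fun i hi => ((hfell i).1 hi).2,
      fun i hi => ((hrose i).1 hi).2, fun i => (hfilt i).1, fun i => (hfilt i).2,
      fun i hm hi hlt => absurd ((hfell i).2 ⟨hm, hlt⟩) hi,
      fun i hm hi hlt => absurd ((hrose i).2 ⟨hm, hlt⟩) hi, fun _ i hm => ?_, Nat.zero_le _⟩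
    · simp [Server.ask, Cmd.Early, hc]
    · refine Finset.disjoint_left.2 fun i hi hi' => ?_
      obtain ⟨hm, hi⟩ := (hfell i).1 hi
      have hi' := ((hrose i).1 hi').2
      rcases hlm i hm with h | h
      · omega
      · rw [min_le_iff] at h; omega
    · rw [hh.2] at hlb
      have h1 := card_of_le_kth (by omega) (by omega) hlb
      have h2 := Finset.card_filter_add_card_filter_not (s := s.mid) (fun i => s.lows i < l)
      simp only [not_lt] at h2
      show (s.mid.filter fun i => s.lows i < l).card + s.need k ≤ s.mid.card
      omega
    · by_contra! hcon
      have := le_kth (k := s.need k + 1) (by omega) (S := s.mid) (f := answers ε nd S) (t := l + 1)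
        hcon
      omega
    · refine contains_of_filt hε (hfilt i).1 (hfilt i).2 (fun h => ?_) (fun h => ?_) (hs.low i)
        (hs.high i)
      · by_contra hcon
        exact (h.resolve_left fun h => hr.not_mid h hm).2 ((hfell i).2 ⟨hm, not_le.1 hcon⟩)
      · by_contra hcon
        exact h ((hrose i).2 ⟨hm, not_le.1 hcon⟩)

end Transitions

/-! ### The transitions at the start of a phase -/

lemma kth_congr {k : ℕ} {S : Finset (Fin n)} {f g : Fin n → ℕ} (h : ∀ i ∈ S, f i = g i) :
    kth k S f = kth k S g := by
  unfold kth
  congr 1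
  ext t
  rw [Set.mem_ofPred_eq, Set.mem_ofPred_eq, Finset.filter_congr fun i hi => by rw [h i hi]]

lemma keyOf_div (i : Fin n) (x : ℕ) : keyOf i x / n = x := by
  have hn : 0 < n := i.pos
  unfold keyOf
  rw [Nat.add_div_of_dvd_right (Dvd.intro_left x rfl), Nat.mul_div_cancel _ hn,
    Nat.div_eq_of_lt i.2, add_zero]

section Select
variable {k t : ℕ} {v : Values n}

lemma mem_of_kthLargest_lt (hk : 1 ≤ k) (hn : k ≤ n)
    (ht : k ≤ (Finset.univ.filter fun i => t ≤ keyOf i (v i)).card) {i : Fin n}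
    (hi : kthLargest k v < v i) : t ≤ keyOf i (v i) := by
  by_contra! hlt
  have h1 : (Finset.univ.filter fun i => t ≤ keyOf i (v i)) ⊆
      Finset.univ.filter fun j => v i ≤ v j := by
    intro j hj
    rw [Finset.mem_filter] at hj ⊢
    refine ⟨hj.1, ?_⟩
    have := Nat.div_le_div_right (c := n) (hlt.le.trans hj.2)
    rwa [keyOf_div, keyOf_div] at this
  have h2 := (le_kthLargest_iff hk hn).2 (ht.trans (Finset.card_le_card h1))
  omega

/-- The search finds the `k`-th largest value. -/
lemma kth_key_div (hk : 1 ≤ k) (hn : k ≤ n)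
    (ht : k ≤ (Finset.univ.filter fun i => t ≤ keyOf i (v i)).card) :
    kth k (Finset.univ.filter fun i => t ≤ keyOf i (v i)) (fun i => keyOf i (v i)) / n =
      kthLargest k v := by
  set P := Finset.univ.filter fun i => t ≤ keyOf i (v i)
  apply le_antisymm
  · rw [le_kthLargest_iff hk hn]
    refine (card_of_le_kth hk ht (f := fun i => keyOf i (v i)) le_rfl).trans
      (Finset.card_le_card fun i hi => ?_)
    rw [Finset.mem_filter] at hi ⊢
    refine ⟨Finset.mem_univ i, ?_⟩
    have := Nat.div_le_div_right (c := n) hi.2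
    rwa [keyOf_div] at this
  · rw [Nat.le_div_iff_mul_le (by omega)]
    have h1 := (le_kthLargest_iff hk hn (v := v)).1 le_rfl
    by_cases hA : ∀ i, kthLargest k v ≤ v i → t ≤ keyOf i (v i)
    · refine le_kth hk (h1.trans (Finset.card_le_card fun i hi => ?_))
      rw [Finset.mem_filter] at hi
      have := Nat.mul_le_mul_right n hi.2
      refine Finset.mem_filter.2 ⟨Finset.mem_filter.2 ⟨hi.1, hA i hi.2⟩, ?_⟩
      unfold keyOf
      omega
    · push Not at hA
      obtain ⟨i, hi, hlt⟩ := hA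
      have h2 : t ≤ kth k P (fun i => keyOf i (v i)) := by
        refine le_kth hk (ht.trans (Finset.card_le_card fun i hi => ?_))
        exact Finset.mem_filter.2 ⟨hi, (Finset.mem_filter.1 hi).2⟩
      have := Nat.mul_le_mul_right n hi
      unfold keyOf at hlt
      omega

end Select

lemma kthLargest_lt_of_clearlyLarger {ε : ℝ} (h0 : 0 < ε) (hε : ε < 1) {z x : ℕ}
    (h : 1 / (1 - ε) * (z : ℝ) < x) : z < x := by
  have hp : 0 < 1 - ε := by linarith
  have h1 : (1 : ℝ) ≤ 1 / (1 - ε) := by rw [le_div_iff₀ hp]; linarith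
  have h2 : (0 : ℝ) ≤ z := by positivity
  have : (z : ℝ) < x := by nlinarith
  exact_mod_cast this

lemma card_clearlyLarger_lt {ε : ℝ} (h0 : 0 < ε) (hε : ε < 1) {k : ℕ} (hk : 1 ≤ k) (hn : k ≤ n)
    (v : Values n) : (clearlyLarger ε k v).card < k := by
  by_contra! h
  have h1 : kthLargest k v + 1 ≤ kthLargest k v := by
    rw [le_kthLargest_iff hk hn]
    refine h.trans (Finset.card_le_card fun i hi => ?_)
    unfold clearlyLarger at hi
    rw [Finset.mem_filter] at hi ⊢
    exact ⟨hi.1, kthLargest_lt_of_clearlyLarger h0 hε hi.2⟩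
  omega

lemma le_card_neighborhood {ε : ℝ} (h0 : 0 < ε) {k : ℕ} (hk : 1 ≤ k) (hn : k ≤ n)
    (v : Values n) : k ≤ (clearlyLarger ε k v).card + (neighborhood ε k v).card := by
  have h1 := (le_kthLargest_iff hk hn (v := v)).1 le_rfl
  refine (h1.trans (Finset.card_le_card fun i hi => ?_)).trans (Finset.card_union_le _ _)
  rw [Finset.mem_filter] at hi
  have h2 : (kthLargest k v : ℝ) ≤ v i := by exact_mod_cast hi.2
  have h3 : (0 : ℝ) ≤ kthLargest k v := by positivity
  simp only [clearlyLarger, neighborhood, Finset.mem_union, Finset.mem_filter, Finset.mem_univ,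
    true_and]
  rcases lt_or_ge (1 / (1 - ε) * (kthLargest k v : ℝ)) (v i) with h | h
  · exact .inl h
  · exact .inr ⟨by nlinarith, h⟩

lemma disjoint_neighborhood (ε : ℝ) (k : ℕ) (v : Values n) :
    Disjoint (clearlyLarger ε k v) (neighborhood ε k v) := by
  refine Finset.disjoint_left.2 fun i hi hi' => ?_
  simp only [clearlyLarger, neighborhood, Finset.mem_filter] at hi hi'
  linarith [hi'.2.2, hi.2]

lemma roleFor_zero (ε : ℝ) (k : ℕ) (v : Values n) (i : Fin n) :
    (roleFor ε (kthLargest k v) 0 i (v i) = .top ↔ i ∈ clearlyLarger ε k v) ∧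
    (roleFor ε (kthLargest k v) 0 i (v i) = .mid ↔ i ∈ neighborhood ε k v) := by
  simp only [roleFor, clearlyLarger, neighborhood, Finset.mem_filter, Finset.mem_univ, true_and,
    if_pos, ← not_lt (a := 1 / (1 - ε) * (kthLargest k v : ℝ))]
  by_cases hp : 1 / (1 - ε) * (kthLargest k v : ℝ) < (v i : ℝ) <;>
    by_cases hq : (1 - ε) * (kthLargest k v : ℝ) ≤ (v i : ℝ) <;>
    simp only [hp, hq] <;> simp

lemma roleFor_succ {ε : ℝ} (h0 : 0 < ε) (hε : ε < 1) (k : ℕ) (v : Values n) {w : ℕ} (hw : w ≠ 0)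
    (i : Fin n) :
    (roleFor ε (kthLargest k v) w i (v i) = .top ↔
      (i ∈ clearlyLarger ε k v ∨ i ∈ neighborhood ε k v) ∧ (i : ℕ) + 1 ≠ w) ∧
    (roleFor ε (kthLargest k v) w i (v i) = .mid ↔
      (i ∈ clearlyLarger ε k v ∨ i ∈ neighborhood ε k v) ∧ (i : ℕ) + 1 = w) := by
  have h : (i ∈ clearlyLarger ε k v ∨ i ∈ neighborhood ε k v) ↔
      (1 - ε) * (kthLargest k v : ℝ) ≤ v i := by
    simp only [clearlyLarger, neighborhood, Finset.mem_filter, Finset.mem_univ, true_and]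
    constructor
    · rintro (h | h)
      · have := kthLargest_lt_of_clearlyLarger h0 hε h
        have h2 : (kthLargest k v : ℝ) < v i := by exact_mod_cast this
        have h3 : (0 : ℝ) ≤ kthLargest k v := by positivity
        nlinarith
      · exact h.1
    · intro h
      rcases lt_or_ge (1 / (1 - ε) * (kthLargest k v : ℝ)) (v i) with h' | h'
      · exact .inl h'
      · exact .inr ⟨h, h'⟩
  rw [h, roleFor, if_neg hw]
  split_ifs with h1 h2
  · simp [h1, h2]
  · simp [h1, h2]
  · simp [h1]

section Transitions
variable {ε : ℝ} {k : ℕ} {v : Values n} {s₀ s : Server n} {nd₀ nd : Fin n → Node n}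
  {S : Fin n → Bool}

lemma prob_sample {r t : ℕ} (hs : Synced v s nd) (hc : s.cmd = .sample r t) (i : Fin n) :
    (nd i).prob = if t ≤ keyOf i (v i) then sendProb n r else 0 := by
  unfold Node.prob
  rw [hs.cmd i, hc, hs.id i, hs.val i]

lemma answers_sample {r t : ℕ} (hs : Synced v s nd) (hc : s.cmd = .sample r t) {i : Fin n}
    (hi : i ∈ speakers S) : answers ε nd S i = v i := by
  rw [mem_speakers] at hi
  unfold answers Node.ans
  rw [if_pos hi, hs.cmd i, hc, hs.val i]

lemma speakers_sample {r t : ℕ} (hs : Synced v s nd) (hc : s.cmd = .sample r t)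
    (hS : Possible (fun i => (nd i).prob) S) :
    speakers S ⊆ Finset.univ.filter fun i => t ≤ keyOf i (v i) := by
  intro i hi
  rw [mem_speakers] at hi
  by_contra hcon
  rw [Finset.mem_filter, and_iff_right (Finset.mem_univ i)] at hcon
  have := hS.of_eq_zero (i := i) (by rw [prob_sample hs hc, if_neg hcon])
  simp [hi] at this

lemma speakers_sample_last {r t : ℕ} (hs : Synced v s nd) (hc : s.cmd = .sample r t)
    (hr : lastRound n ≤ r) (hS : Possible (fun i => (nd i).prob) S) :
    speakers S = Finset.univ.filter fun i => t ≤ keyOf i (v i) := by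
  refine (speakers_sample hs hc hS).antisymm fun i hi => ?_
  rw [mem_speakers]
  exact hS.of_eq_one (by
    rw [prob_sample hs hc, if_pos (Finset.mem_filter.1 hi).2, sendProb_last hr])

lemma Since.of_early (h : Since ε k v s₀ nd₀ s nd) (hc : s.cmd.Early) :
    s.phases = s₀.phases + 1 ∧ Flat v nd ∧
    (s₀.phases = 0 ∨ ∀ F l, ¬ Feas ε k (fun i => (nd₀ i).low) (fun i => (nd₀ i).high) F l) ∧
    s.paid = s₀.paid := by
  unfold Since at h
  rw [if_pos hc] at h
  exact h.resolve_left fun h => h.2.2.1 hc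

/-- The transition from a state in which the server searches the `k`-th largest value. -/
lemma Inv.sampleStep (h0 : 0 < ε) (hε : ε < 1) (hk : 1 ≤ k) (hn : k ≤ n)
    (h : Inv ε k v s₀ nd₀ s nd) {r t : ℕ} (hc : s.cmd = .sample r t)
    (hS : Possible (fun i => (nd i).prob) S) :
    let p := s.sampleStep ε k r t (speakers S) (answers ε nd S)
    Inv ε k v s₀ nd₀ p.1 fun i => (nd i).react ε p.2 := by
  obtain ⟨hr, ht⟩ : SampleOk k r t v := by
    have := h.stage; unfold StageOk at this; rwa [hc] at this
  have hs := h.synced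
  obtain ⟨e1, e2, e3, e4⟩ := h.since.of_early (by rw [hc]; trivial)
  have hkey : kth k (speakers S) (fun i => keyOf i (answers ε nd S i)) =
      kth k (speakers S) fun i => keyOf i (v i) :=
    kth_congr fun i hi => by rw [answers_sample hs hc hi]
  unfold Server.sampleStep
  simp only
  rw [hkey]
  by_cases hlt : r < lastRound n
  · rw [if_pos hlt]
    refine ⟨hs.react_some _ rfl rfl, .inr ⟨e1, fun i => ?_, e3, ?_⟩, hlt, ?_⟩
    · simp [Node.react, hs.val i]
    · simp [Server.ask, Cmd.Early, e4]
    · split_ifs with hcard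
      · refine (card_of_le_kth hk hcard (f := fun i => keyOf i (v i)) le_rfl).trans (Finset.card_le_card ?_)
        exact Finset.filter_subset_filter _ (Finset.subset_univ _)
      · exact ht
  · rw [if_neg hlt]
    have hsp := speakers_sample_last hs hc (not_lt.1 hlt) hS
    have hz := kth_key_div hk hn ht
    rw [hsp, if_pos ht, hz]
    refine ⟨hs.react_some _ rfl rfl, .inr ⟨e1, fun i => ?_, e3, ?_⟩, rfl, ?_, fun i => ?_⟩
    · simp only [Node.react]; exact e2 i
    · simp [Server.ask, Cmd.Early, e4]
    · ext i
      simp only [Finset.mem_filter, Finset.mem_univ, true_and, clearlyLarger]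
      constructor
      · rintro ⟨hi, hi'⟩
        rwa [answers_sample hs hc (by rw [hsp]; simpa using hi)] at hi'
      · intro hi
        have hm := mem_of_kthLargest_lt hk hn ht (kthLargest_lt_of_clearlyLarger h0 hε hi)
        refine ⟨hm, ?_⟩
        rwa [answers_sample hs hc (by rw [hsp]; simpa using hm)]
    · simp only [Node.react, hs.id i, hs.val i]

/-- At the start of a phase with several feasible outputs, every feasible threshold is close to the
`k`-th largest value. -/
lemma mem_firstGap (h0 : 0 < ε) (hε : ε < 1) (hk : 1 ≤ k) (hn : k ≤ n)
    (hne : (clearlyLarger ε k v).card + (neighborhood ε k v).card ≠ k) {F : Finset (Fin n)} {l : ℕ}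
    (hF : Feas ε k v v F l) : (firstGap ε (kthLargest k v)).1 ≤ l := by
  have hp : 0 < 1 - ε := by linarith
  obtain ⟨hc, G, hG, rfl⟩ := hF.isOutput h0 hε hk hn
  have h1 := le_card_neighborhood h0 hk hn (ε := ε) v
  obtain ⟨j, hj, hjG⟩ : ∃ j ∈ neighborhood ε k v, j ∉ G := by
    by_contra! hcon
    have := hG.antisymm hcon
    rw [this, Finset.card_union_of_disjoint (disjoint_neighborhood ε k v)] at hc
    exact hne hc
  have hjF : j ∉ clearlyLarger ε k v ∪ G := by
    rw [Finset.mem_union, not_or]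
    exact ⟨fun h => Finset.disjoint_left.1 (disjoint_neighborhood ε k v) h hj, hjG⟩
  have h2 := scaleDown_le_iff.1 (hF.2.2 j hjF)
  have h3 := (Finset.mem_filter.1 hj).2.1
  unfold firstGap
  rw [Nat.ceil_le]
  nlinarith

lemma le_kthLargest_of_feas (hk : 1 ≤ k) (hn : k ≤ n) {F : Finset (Fin n)} {l : ℕ}
    (hF : Feas ε k v v F l) : l ≤ kthLargest k v := by
  rw [le_kthLargest_iff hk hn, ← hF.1]
  exact Finset.card_le_card fun i hi => Finset.mem_filter.2 ⟨Finset.mem_univ i, hF.2.1 i hi⟩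

lemma gapsOk_singleton {g : ℕ × ℕ} (hg : g.1 ≤ g.2) (U : Finset (Fin n)) (m y : Fin n → ℕ) :
    GapsOk (intervalPot g) U m y [g] ∅ :=
  ⟨⟨by simpa using hg, by simp⟩, by simp, by simp, by simp⟩

lemma firstGap_le (h0 : 0 < ε) (hε : ε < 1) (z : ℕ) : (firstGap ε z).1 ≤ (firstGap ε z).2 := by
  unfold firstGap
  rw [Nat.ceil_le]
  have : (0 : ℝ) ≤ z := by positivity
  have h : (1 - ε) ^ 2 ≤ 1 := pow_le_one₀ (by linarith) (by linarith)
  nlinarith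

/-- The transition from a state in which the server waits for the values in the neighbourhood. -/
lemma Inv.classifyStep (h0 : 0 < ε) (hε : ε < 1) (hk : 1 ≤ k) (hn : k ≤ n)
    (h : Inv ε k v s₀ nd₀ s nd) {z : ℕ} (hc : s.cmd = .classify z 0)
    (hS : Possible (fun i => (nd i).prob) S) :
    let p := s.classifyStep ε k z (speakers S) (answers ε nd S)
    Inv ε k v s₀ nd₀ p.1 fun i => (nd i).react ε p.2 := by
  obtain ⟨rfl, htop, hrole⟩ : ClassifyOk ε k z v s nd := by
    have := h.stage; unfold StageOk at this; rwa [hc] at this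
  have hs := h.synced
  have hmid : ∀ i, (nd i).role = .mid ↔ i ∈ neighborhood ε k v := fun i => by
    rw [hrole i]; exact (roleFor_zero ε k v i).2
  have htop' : ∀ i, (nd i).role = .top ↔ i ∈ clearlyLarger ε k v := fun i => by
    rw [hrole i]; exact (roleFor_zero ε k v i).1
  have hsp := speakers_eq_of_asksMid hs (by rw [hc]; trivial) hmid hS
  obtain ⟨e1, e2, e3, e4⟩ := h.since.of_early (by rw [hc]; trivial)
  have c1 := card_clearlyLarger_lt h0 hε hk hn v
  have c2 := le_card_neighborhood h0 hk hn (ε := ε) v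
  have hdis := disjoint_neighborhood ε k v
  have hfeas : ∀ F l, Feas ε k (fun i => (nd i).low) (fun i => (nd i).high) F l →
      Feas ε k v v F l := fun F l hF => by
    simp only [fun i => (e2 i).1, fun i => (e2 i).2] at hF; exact hF
  unfold Server.classifyStep
  rw [hsp, htop]
  by_cases hsep : (clearlyLarger ε k v).card + (neighborhood ε k v).card = k
  · rw [if_pos hsep]
    -- the output is determined; the node `x` stays undecided in name only
    obtain ⟨x, hx, hxw⟩ := Finset.exists_mem_eq_sup (neighborhood ε k v)
      (Finset.card_pos.1 (by omega)) fun i => (i : ℕ) + 1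
    simp only
    rw [hxw]
    have hne : ∀ i : Fin n, (i : ℕ) + 1 = (x : ℕ) + 1 ↔ i = x := fun i => by
      rw [Fin.ext_iff]; omega
    simp only [ne_eq, hne]
    have hmx : (neighborhood ε k v).filter (fun i => i = x) = {x} := by
      ext i
      simp only [Finset.mem_filter, Finset.mem_singleton]
      exact ⟨fun h => h.2, fun h => ⟨h ▸ hx, h⟩⟩
    have htx : (clearlyLarger ε k v) ∪ (neighborhood ε k v).filter (fun i => ¬ i = x) =
        (clearlyLarger ε k v ∪ neighborhood ε k v).erase x := by
      ext i
      simp only [Finset.mem_union, Finset.mem_filter, Finset.mem_erase]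
      constructor
      · rintro (h | h)
        · exact ⟨fun e => Finset.disjoint_left.1 hdis h (e ▸ hx), .inl h⟩
        · exact ⟨h.2, .inr h.1⟩
      · rintro ⟨h, h' | h'⟩
        · exact .inl h'
        · exact .inr ⟨h', h⟩
    rw [hmx, htx]
    have hcu : (clearlyLarger ε k v ∪ neighborhood ε k v).card = k := by
      rw [Finset.card_union_of_disjoint hdis]; exact hsep
    have hxu : x ∈ clearlyLarger ε k v ∪ neighborhood ε k v := Finset.mem_union_right _ hx
    refine ⟨hs.react_some _ rfl rfl, .inr ⟨e1, fun i => ?_, e3, ?_⟩, ⟨⟨⟨?_, ?_, ?_, ?_⟩,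
      gapsOk_singleton (Nat.zero_le _) _ _ _, .inr fun F l hF => ?_⟩, ?_⟩, rfl, x.2⟩
    · simp only [Node.react]; exact e2 i
    · rw [if_neg (by simp [Server.ask, Cmd.Early])]
      simp only; rw [e4]
    · intro i
      simp only [Node.react, hs.id i, hs.val i, Finset.mem_erase, Finset.mem_union]
      rw [(roleFor_succ h0 hε k v (Nat.succ_ne_zero _) i).1, ne_eq, hne, and_comm]
    · intro i
      simp only [Node.react, hs.id i, hs.val i, Finset.mem_singleton]
      rw [(roleFor_succ h0 hε k v (Nat.succ_ne_zero _) i).2, hne]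
      exact ⟨fun h => h.2, fun h => ⟨h ▸ .inr hx, h⟩⟩
    · simp only [Finset.card_erase_of_mem hxu, hcu]; omega
    · simp only [Finset.card_erase_of_mem hxu, hcu, Finset.card_singleton]; omega
    · simp only [Node.react] at hF
      have hF := hfeas F l hF
      obtain ⟨hcF, G, hG, rfl⟩ := hF.isOutput h0 hε hk hn
      have hGe : G = neighborhood ε k v := by
        refine Finset.eq_of_subset_of_card_le hG ?_
        have := Finset.card_union_le (clearlyLarger ε k v) G
        omega
      subst hGe
      refine ⟨Finset.erase_subset _ _, fun i hi => ?_, (0, kthLargest k v),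
        List.mem_singleton.2 rfl, Nat.zero_le _, le_kthLargest_of_feas hk hn hF⟩
      simp only [Finset.mem_union, Finset.mem_erase, Finset.mem_singleton] at hi ⊢
      tauto
    · exact ⟨by simp, 0, fun h => absurd rfl h, by simp⟩
  · rw [if_neg hsep]
    refine ⟨hs.react_some _ rfl rfl, .inr ⟨e1, fun i => ?_, e3, ?_⟩, ⟨⟨htop', hmid, ?_, ?_⟩,
      gapsOk_singleton (firstGap_le h0 hε _) _ _ _, .inr fun F l hF => ?_⟩, ?_, fun i hi => ?_, rfl⟩
    · simp only [Server.lowStep, Node.react]; exact e2 i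
    · rw [if_neg (by simp [Server.lowStep, Server.ask, Cmd.Early])]
      simp only [Server.lowStep, Server.ask]; rw [e4]
    · simp only [Server.lowStep, Server.ask]; exact c1
    · simp only [Server.lowStep, Server.ask]; exact c2
    · simp only [Node.react, Server.lowStep] at hF
      have hF := hfeas F l hF
      -- some node of the neighbourhood lies outside the output, which bounds the threshold from below
      have hm := mem_firstGap h0 hε hk hn hsep hF
      have hm' := le_kthLargest_of_feas hk hn hF
      obtain ⟨hcF, G, hG, rfl⟩ := hF.isOutput h0 hε hk hn
      simp only [Server.lowStep, Server.ask]
      exact ⟨Finset.subset_union_left, Finset.union_subset_union_right hG,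
        firstGap ε (kthLargest k v), List.mem_singleton.2 rfl, hm, hm'⟩
    · exact ⟨by simp [Server.lowStep, Server.ask], 0, fun h => absurd rfl h,
        by simp [Server.lowStep, Server.ask]⟩
    · have hi' : i ∈ neighborhood ε k v := hi
      rw [← hsp, mem_speakers] at hi'
      exact answers_low hs (by rw [hc]; trivial) (by simp [hc]) hi'

end Transitions

/-! ### Correctness of the time steps -/

section Step
variable {ε : ℝ} {k : ℕ} {v : Values n} {s₀ s : Server n} {nd₀ nd : Fin n → Node n}
  {S : Fin n → Bool}

lemma idle_classifyStep (z : ℕ) (T : Finset (Fin n)) (a : Fin n → ℕ) :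
    (s.classifyStep ε k z T a).1.idle = false := by
  unfold Server.classifyStep
  dsimp only
  split_ifs <;> rfl

lemma idle_sampleStep (r t : ℕ) (T : Finset (Fin n)) (a : Fin n → ℕ) :
    (s.sampleStep ε k r t T a).1.idle = false := by
  unfold Server.sampleStep
  dsimp only
  split_ifs <;> rfl

lemma idle_highStep (b : ℕ) (a : Fin n → ℕ) : (s.highStep k b a).1.idle = false := by
  unfold Server.highStep
  dsimp only
  split_ifs <;> rfl

/-- The invariant is preserved until the server is idle, and then the time step has ended well. -/
lemma Inv.step (h0 : 0 < ε) (hε : ε < 1) (hk : 1 ≤ k) (hn : k ≤ n) (h : Inv ε k v s₀ nd₀ s nd)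
    (hS : Possible (fun i => (nd i).prob) S) :
    let r := s.step ε k (speakers S) (answers ε nd S)
    let nd' := fun i => (nd i).react ε r.2
    (r.1.idle = false → Inv ε k v s₀ nd₀ r.1 nd') ∧
    (r.1.idle = true → EndOk ε k v r.1 nd' ∧ Since ε k v s₀ nd₀ r.1 nd') := by
  have key : ∀ r : Server n × Option Cmd, r.1.idle = false →
      Inv ε k v s₀ nd₀ r.1 (fun i => (nd i).react ε r.2) →
      (r.1.idle = false → Inv ε k v s₀ nd₀ r.1 fun i => (nd i).react ε r.2) ∧
      (r.1.idle = true → EndOk ε k v r.1 (fun i => (nd i).react ε r.2) ∧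
        Since ε k v s₀ nd₀ r.1 fun i => (nd i).react ε r.2) :=
    fun r h1 h2 => ⟨fun _ => h2, fun h3 => by simp [h1] at h3⟩
  unfold Server.step
  rcases hc : s.cmd with l | - | b | ⟨r, t⟩ | ⟨z, w | w⟩
  · exact h.watchStep h0 hε hc hS
  · exact key _ rfl (h.lowStep (by rw [hc]; trivial) hS)
  · exact key _ (idle_highStep _ _) (h.highStep h0 hε hk hn hc hS)
  · exact key _ (idle_sampleStep _ _ _ _) (h.sampleStep h0 hε hk hn hc hS)
  · exact key _ (idle_classifyStep _ _ _) (h.classifyStep h0 hε hk hn hc hS)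
  · exact key _ rfl (h.lowStep (by rw [hc]; trivial) hS)

/-- The invariant holds when a new time step begins. -/
lemma EndOk.start (hε : ε < 1) (h : EndOk ε k v s nd) (v' : Values n) :
    Inv ε k v' s (fun i => (nd i).see (v' i)) s fun i => (nd i).see (v' i) := by
  obtain ⟨l, hc, hw⟩ := h.watch
  have hp := h.phase
  have hr := hp.roles
  have hlow : ∀ i, ((nd i).see (v' i)).low ≤ (nd i).low := fun i => min_le_left _ _
  have hhigh : ∀ i, (nd i).high ≤ ((nd i).see (v' i)).high := fun i => le_max_left _ _
  refine ⟨⟨h.id, fun _ => rfl, h.cmd, fun _ => h.rnd.symm, fun _ => min_le_right _ _,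
    fun _ => le_max_right _ _⟩, .inl ⟨rfl, rfl, by simp [hc, Cmd.Early], fun _ => ⟨rfl, rfl⟩⟩, ?_⟩
  unfold StageOk
  rw [hc]
  refine ⟨⟨⟨hr.top, hr.mid, hr.card_top, hr.card⟩, hp.gaps.refine hp.gaps.sorted (Refines.refl _)
    hlow fun i => scaleDown_mono hε (hhigh i), hp.sound.imp (fun e => e) fun H F l hF =>
    H F l (hF.anti hε hlow hhigh)⟩, ?_⟩
  refine { hw with
    fell := fun i hi => (hlow i).trans_lt (hw.fell i hi)
    rose := fun i hi => (hw.rose i hi).trans_le (scaleDown_mono hε (hhigh i))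
    low := fun i hm hi hlt => ?_
    high := fun i hm hi hlt => ?_
    quiet := fun hq => by simp [h.idle] at hq }
  · by_contra hcon
    have h1 : (nd i).low < l := by
      simp only [Node.see] at hlt
      omega
    have h2 := hw.low i hm hi h1
    have h3 := (h.contains i).1
    rw [hw.lo, if_pos (.inr ⟨hm, hi⟩)] at h3
    omega
  · by_contra hcon
    have h1 : l < scaleDown ε (nd i).high := by
      simp only [Node.see] at hlt
      rcases le_total (nd i).high (v' i) with h' | h'
      · rw [max_eq_right h'] at hlt; exact absurd hlt hcon
      · rwa [max_eq_left h'] at hlt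
    have h2 := (scaleUp_lt_iff hε).2 (hw.high i hm hi h1)
    have h3 := (h.contains i).2
    rw [hw.hi, if_neg (not_or.2 ⟨fun h => hr.not_mid h hm, hi⟩)] at h3
    have h4 : v i ≤ scaleUp ε l := by exact_mod_cast h3
    omega

lemma EndOk.exists_output (h : EndOk ε k v s nd) : ∃ F : Finset (Fin n),
    s.top ∪ s.rose ⊆ F ∧ F ⊆ (s.top ∪ s.mid) \ s.fell ∧ F.card = k := by
  obtain ⟨l, -, hw⟩ := h.watch
  have hr := h.phase.roles
  have h1 := hr.card_top
  have h2 : s.fell ⊆ s.top ∪ s.mid := hw.fell_sub.trans Finset.subset_union_right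
  have h3 := hw.rose_card
  have h4 := hw.fell_card
  have h5 : s.need k = k - s.top.card := rfl
  refine (Finset.exists_subsuperset_card_eq (n := k) (s := s.top ∪ s.rose)
    (t := (s.top ∪ s.mid) \ s.fell) (fun i hi => ?_) ?_ ?_).imp fun F hF => hF
  · rw [Finset.mem_sdiff]
    rcases Finset.mem_union.1 hi with hi | hi
    · exact ⟨Finset.mem_union_left _ hi, fun hf => hr.not_mid hi (hw.fell_sub hf)⟩
    · exact ⟨Finset.mem_union_right _ (hw.rose_sub hi),
        fun hf => Finset.disjoint_left.1 hw.disj hf hi⟩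
  · have := Finset.card_union_le s.top s.rose
    omega
  · rw [Finset.card_sdiff_of_subset h2, Finset.card_union_of_disjoint hr.disjoint]
    omega

/-- At the end of a time step, every set that is compatible with the knowledge of the server is a
correct output, and the filters of the nodes are valid for it. -/
lemma EndOk.correct (h0 : 0 < ε) (hε : ε < 1) (hk : 1 ≤ k) (hn : k ≤ n) (h : EndOk ε k v s nd)
    {F : Finset (Fin n)} (h1 : s.top ∪ s.rose ⊆ F) (h2 : F ⊆ (s.top ∪ s.mid) \ s.fell)
    (h3 : F.card = k) : IsOutput ε k v F ∧ IsFilterSet ε v F fun i => (nd i).filt := by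
  obtain ⟨l, -, hw⟩ := h.watch
  have hlo : ∀ i ∈ F, (nd i).filt.lo = l := fun i hi => by
    have := h2 hi
    rw [Finset.mem_sdiff, Finset.mem_union] at this
    rw [hw.lo, if_pos]
    tauto
  have hhi : ∀ i ∉ F, (nd i).filt.hi = (scaleUp ε l : ℕ∞) := fun i hi => by
    rw [hw.hi, if_neg]
    exact fun h => hi (h1 (Finset.mem_union.2 h))
  refine ⟨Feas.isOutput h0 hε hk hn (l := l) ⟨h3, fun i hi => ?_, fun i hi => ?_⟩, h.contains,
    fun i hi j hj => ?_⟩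
  · rw [← hlo i hi]; exact (h.contains i).1
  · have := (h.contains i).2
    rw [hhi i hi] at this
    exact (le_scaleUp_iff hε).1 (by exact_mod_cast this)
  · dsimp only
    rw [hlo i hi, hhi j hj]
    have hp : 0 < 1 - ε := by linarith
    have hf : (1 - ε) * (scaleUp ε l : ℝ) ≤ l := by
      have := Nat.floor_le (show (0 : ℝ) ≤ (l : ℝ) / (1 - ε) by positivity)
      rw [le_div_iff₀ hp] at this
      unfold scaleUp
      linarith
    have e : ((scaleUp ε l : ℕ∞) : ℝ≥0∞) = ENNReal.ofReal (scaleUp ε l : ℝ) := by simp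
    have e' : (l : ℝ≥0∞) = ENNReal.ofReal (l : ℝ) := by simp
    rw [e, e', ← ENNReal.ofReal_mul hp.le]
    exact ENNReal.ofReal_le_ofReal hf

lemma endOk_init (ε : ℝ) (hk : 1 ≤ k) (hn : k ≤ n) :
    EndOk ε k (fun _ => 0) (serverInit n k) (nodeInit ε k) := by
  have c1 : (Finset.univ.filter fun i : Fin n => (i : ℕ) + 1 < k).card = k - 1 := by
    rw [Finset.filter_congr fun (i : Fin n) _ => (show (i : ℕ) + 1 < k ↔ (i : ℕ) < k - 1 by omega),
      Fin.card_filter_val_lt]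
    omega
  have c2 : (Finset.univ.filter fun i : Fin n => (i : ℕ) + 1 = k).card = 1 := by
    rw [Finset.card_eq_one]
    refine ⟨⟨k - 1, by omega⟩, ?_⟩
    ext i
    simp only [Finset.mem_filter, Finset.mem_univ, true_and, Finset.mem_singleton, Fin.ext_iff]
    omega
  have htop : ∀ i : Fin n, initRole k i = .top ↔ (i : ℕ) + 1 < k := fun i => by
    unfold initRole; split_ifs <;> simp_all
  have hmid : ∀ i : Fin n, initRole k i = .mid ↔ (i : ℕ) + 1 = k := fun i => by
    unfold initRole; split_ifs with h1 h2 <;> simp_all; omega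
  have hz : scaleDown ε 0 = 0 := by simp [scaleDown]
  have hz' : scaleUp ε 0 = 0 := by simp [scaleUp]
  have hg : GapsOk 1 (serverInit n k).mid (fun i => (nodeInit ε k i).low)
      (fun i => scaleDown ε (nodeInit ε k i).high) [(0, 0)] ∅ := by
    have := gapsOk_singleton (g := (0, 0)) le_rfl (serverInit n k).mid
      (fun i => (nodeInit ε k i).low) (fun i => scaleDown ε (nodeInit ε k i).high)
    have e : intervalPot (0, 0) = 1 := by simp [intervalPot]
    rwa [e] at this
  refine ⟨fun _ => rfl, fun _ => rfl, fun _ => rfl, fun _ => le_rfl, fun _ => le_rfl, rfl, rfl,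
    ⟨⟨fun i => ?_, fun i => ?_, ?_, ?_⟩, hg, .inl rfl⟩, ⟨0, rfl, ?_⟩, fun i => ?_⟩
  · simp [nodeInit, serverInit, htop]
  · simp [nodeInit, serverInit, hmid]
  · simp only [serverInit, c1]; omega
  · simp only [serverInit, c1, c2]; omega
  · refine ⟨⟨[], (0, 0), [], ?_⟩, by simp [serverInit], by simp [serverInit], by simp [serverInit], ?_,
      by simp [serverInit], by simp [serverInit], by simp [serverInit], fun i => ?_, fun i => ?_,
      fun i _ _ h => absurd h (Nat.not_lt_zero _), fun i _ _ h => ?_, fun h => by simp [serverInit] at h,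
      Nat.zero_le _⟩
    · simp [serverInit]
    · simp only [Server.need, serverInit, c1, c2, Finset.card_empty]; omega
    · simp only [nodeInit]
      cases initRole k i <;> simp [Role.filt]
    · simp only [nodeInit, serverInit, Finset.mem_filter, Finset.mem_univ, true_and,
        Finset.notMem_empty, or_false]
      by_cases h1 : (i : ℕ) + 1 < k
      · simp [(htop i).2 h1, h1, Role.filt]
      · rw [if_neg h1]
        have h2 := mt (htop i).1 h1
        cases e : initRole k i <;> simp_all [Role.filt]
    · simp [nodeInit, hz] at h
  · simp only [nodeInit]
    cases initRole k i <;> simp [Role.filt, Interval.Contains, hz']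

end Step

/-! ### The size of the messages -/

lemma lastRound_le (n : ℕ) : lastRound n ≤ n := by
  refine Nat.clog_le_of_le_pow ?_
  exact Nat.lt_two_pow_self.le

lemma code_lt {i a b B : ℕ} (hB : 4 ≤ B) (hi : i ≤ 4) (ha : a ≤ B) (hb : b ≤ B) :
    Nat.pair i (Nat.pair a b) < (B + 1) ^ 4 := by
  have h1 : Nat.pair a b + 1 ≤ (B + 1) ^ 2 :=
    (Nat.pair_lt_max_add_one_sq a b).trans_le (Nat.pow_le_pow_left (by omega) 2)
  refine (Nat.pair_lt_max_add_one_sq _ _).trans_le ?_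
  rw [show (B + 1) ^ 4 = ((B + 1) ^ 2) ^ 2 by ring]
  refine Nat.pow_le_pow_left ?_ 2
  have : B + 1 ≤ (B + 1) ^ 2 := by nlinarith
  rcases max_choice i (Nat.pair a b) with h | h <;> rw [h] <;> omega

section Step
variable {ε : ℝ} {k : ℕ} {v : Values n} {s₀ s : Server n} {nd₀ nd : Fin n → Node n}
  {S : Fin n → Bool}

lemma kth_le_maxValue (hk : 1 ≤ k) {T : Finset (Fin n)} (hT : k ≤ T.card) {f : Fin n → ℕ}
    (h : ∀ i ∈ T, f i ≤ v i) : kth k T f ≤ maxValue v :=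
  kth_le_of_forall hk hT fun i hi => (h i hi).trans (le_maxValue v i)

lemma Inv.askHigh_le (h : Inv ε k v s₀ nd₀ s nd) {b : ℕ} (hc : s.cmd = .askHigh b) :
    b ≤ maxValue v := by
  obtain ⟨hp, -, hh⟩ : PhaseOk ε k s nd ∧ PendOk ε s nd ∧ HighOk k b s nd := by
    have := h.stage; unfold StageOk at this; rwa [hc] at this
  have h1 := hp.roles.card_top
  have h2 := hp.roles.card
  rw [hh.2]
  unfold Server.need
  exact kth_le_maxValue (by omega) (by omega)
    fun i hi => (hh.1 i hi).le.trans (h.synced.low i)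

/-- A threshold that fits the present values is not larger than all of them. -/
lemma WatchOk.le_maxValue {l : ℕ} (h : WatchOk ε k l v s nd) (hr : RolesOk k s nd)
    (hi : s.idle = false) : l ≤ maxValue v := by
  have h1 := hr.card_top
  have h2 := h.fell_card
  have h3 : s.need k = k - s.top.card := rfl
  have h4 : s.fell.card < s.mid.card := by omega
  obtain ⟨i, hm, hf⟩ := Finset.exists_mem_notMem_of_card_lt_card h4
  have h5 := (h.quiet hi i hm).1
  rw [h.lo, if_pos (.inr ⟨hm, hf⟩)] at h5
  exact h5.trans (Monitor.le_maxValue v i)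

/-- The requests made by the server have short encodings. -/
lemma Inv.code_lt (hk : 1 ≤ k) (hn : k ≤ n) (h : Inv ε k v s₀ nd₀ s nd) (hi : s.idle = false) :
    s.cmd.code < ((maxValue v + 1) * n + 5) ^ 4 := by
  have hM : maxValue v + 1 ≤ (maxValue v + 1) * n := Nat.le_mul_of_pos_right _ (by omega)
  have hN : n ≤ (maxValue v + 1) * n := Nat.le_mul_of_pos_left _ (by omega)
  have hst := h.stage
  unfold StageOk at hst
  rcases hc : s.cmd with l | - | b | ⟨r, t⟩ | ⟨z, w | w⟩ <;> rw [hc] at hst <;> simp only [Cmd.code] <;>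
    refine Monitor.code_lt (by omega) (by omega) ?_ ?_ <;> try omega
  · have := hst.2.le_maxValue hst.1.roles hi
    omega
  · have := h.askHigh_le hc
    omega
  · have := hst.1
    have := lastRound_le n
    omega
  · obtain ⟨i, hi⟩ := Finset.card_pos.1 (lt_of_lt_of_le hk hst.2)
    have h1 := (Finset.mem_filter.1 hi).2
    have h2 := Nat.mul_le_mul_right n (le_maxValue v i)
    have h3 := i.2
    unfold keyOf at h1
    rw [Nat.add_mul]
    omega
  · rw [hst.1]
    have := kthLargest_le_maxValue hk hn v
    omega
  · rw [hst.2.1]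
    have := kthLargest_le_maxValue hk hn v
    omega

lemma Inv.ans_le (h : Inv ε k v s₀ nd₀ s nd) (i : Fin n) : (nd i).ans ε ≤ maxValue v + 1 := by
  have h1 := (h.synced.low i).trans (le_maxValue v i)
  have h2 := le_maxValue v i
  unfold Node.ans
  rw [h.synced.cmd i, h.synced.val i]
  rcases hc : s.cmd with l | - | b | ⟨r, t⟩ | ⟨z, w⟩ <;> simp only
  · split_ifs <;> omega
  · omega
  · have := h.askHigh_le hc
    exact (min_le_right _ _).trans (by omega)
  · omega
  · omega

lemma cmd_step {c : Cmd} {T : Finset (Fin n)} {a : Fin n → ℕ} (h : (s.step ε k T a).2 = some c) :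
    (s.step ε k T a).1.cmd = c ∧ (s.step ε k T a).1.idle = false := by
  unfold Server.step at *
  split at h
  · unfold Server.watchStep at *
    split_ifs at * <;> simp_all [Server.ask]
  · unfold Server.lowStep at *
    simp_all [Server.ask]
  · unfold Server.highStep at *
    dsimp only at *
    split_ifs at * <;> simp_all [Server.ask]
  · unfold Server.sampleStep at *
    dsimp only at *
    split_ifs at * <;> simp_all [Server.ask]
  · unfold Server.classifyStep Server.lowStep at *
    dsimp only at *
    split_ifs at * <;> simp_all [Server.ask]
  · unfold Server.lowStep at *
    simp_all [Server.ask]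

end Step

lemma add_one_le_two_pow_log (m : ℕ) : m + 1 ≤ 2 ^ (Nat.log 2 m + 1) :=
  Nat.lt_pow_succ_log_self (by norm_num) m

lemma length_bits_le {m e : ℕ} (h : m < 2 ^ e) : m.bits.length ≤ e := by
  rw [Nat.size_eq_bits_len]
  exact Nat.size_le.2 h

lemma size_bound (n M : ℕ) : (M + 1) * n + 5 ≤ 2 ^ (Nat.log 2 n + Nat.log 2 M + 4) := by
  have h1 := add_one_le_two_pow_log n
  have h2 := add_one_le_two_pow_log M
  have h3 : (M + 1) * n ≤ 2 ^ (Nat.log 2 M + 1) * 2 ^ (Nat.log 2 n + 1) :=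
    Nat.mul_le_mul h2 (by omega)
  have h4 : 2 ^ (Nat.log 2 M + 1) * 2 ^ (Nat.log 2 n + 1) = 4 * 2 ^ (Nat.log 2 n + Nat.log 2 M) := by
    ring
  have h5 : 2 ^ (Nat.log 2 n + Nat.log 2 M + 4) = 16 * 2 ^ (Nat.log 2 n + Nat.log 2 M) := by ring
  have h6 : 1 ≤ 2 ^ (Nat.log 2 n + Nat.log 2 M) := Nat.one_le_two_pow
  omega

section Step
variable {ε : ℝ} {k : ℕ} {v : Values n} {s₀ : Server n} {nd₀ : Fin n → Node n}

lemma Inv.sizeAtMost (h0 : 0 < ε) (hε : ε < 1) (hk : 1 ≤ k) (hn : k ≤ n)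
    {c : (monitor n k ε).Config} {S : Fin n → Bool}
    (h : Inv ε k v s₀ nd₀ c.server c.node) (hS : Possible (coins c) S) :
    (roundOf c S).SizeAtMost (sizeLimit 120 n (maxValue v)) := by
  have hB := size_bound n (maxValue v)
  have hlim : 4 * (Nat.log 2 n + Nat.log 2 (maxValue v) + 4) ≤ sizeLimit 120 n (maxValue v) := by
    unfold sizeLimit; omega
  refine ⟨fun i m hm => ?_, fun i m hm => by simp [roundOf] at hm, fun m hm => ?_⟩
  · simp only [roundOf] at hm
    split_ifs at hm with hi
    · obtain rfl : ((c.node i).ans ε).bits = m := by simpa using hm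
      refine (length_bits_le (e := Nat.log 2 n + Nat.log 2 (maxValue v) + 4) ?_).trans (by omega)
      have h1 := h.ans_le i
      have h2 : maxValue v + 1 ≤ (maxValue v + 1) * n := Nat.le_mul_of_pos_right _ (by omega)
      omega
    · simp at hm
  · simp only [roundOf, Option.mem_def, Option.map_eq_some_iff] at hm
    obtain ⟨d, hd, rfl⟩ := hm
    refine (length_bits_le ?_).trans hlim
    obtain ⟨e1, e2⟩ := cmd_step hd
    have h1 := ((h.step h0 hε hk hn hS).1 e2).code_lt hk hn e2
    have h2 : d.code < ((maxValue v + 1) * n + 5) ^ 4 := by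
      rw [← e1]; exact h1
    refine h2.trans_le ((Nat.pow_le_pow_left hB 4).trans_eq ?_)
    rw [← pow_mul, mul_comm]

end Step

/-! ### The number of rounds -/

lemma one_le_weight {G : List (ℕ × ℕ)} (hG : Sorted G) (h : G ≠ []) : 1 ≤ weight G := by
  obtain ⟨g, L, rfl⟩ := List.exists_cons_of_ne_nil h
  have := hG.1 g (by simp)
  simp only [weight, List.map_cons, List.sum_cons]
  omega

/-- The greatest number of rounds between two failures of a threshold. -/
def blockLength (n : ℕ) : ℕ := lastRound n + 4

/-- The greatest number of failures of a threshold after which no candidate up to `M` is left. -/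
def maxFailures (M : ℕ) : ℕ := shrinks (M + 1)

open Classical in
/-- A bound for the number of remaining rounds, unless a new phase will start. After the first failure
of a threshold all candidates are at most `M`, and no undecided node violates its filter, so that
every further failure removes a quarter of the candidates. -/
def Server.stageRank (M : ℕ) (s : Server n) : ℕ :=
  match s.cmd with
  | .watch _ =>
      if s.idle then (maxFailures M + 2) * blockLength n
      else if ∀ g ∈ s.gaps, g.2 ≤ M then
        shrinks (weight s.gaps) * blockLength n + (lastRound n + 1 - s.rnd)
      else (maxFailures M + 1) * blockLength n + (lastRound n + 1 - s.rnd)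
  | .askLow => shrinks (min (weight s.gaps) (M + 1)) * blockLength n + lastRound n + 3
  | .askHigh _ => shrinks (min (weight s.gaps) (M + 1)) * blockLength n + lastRound n + 2
  | .sample r _ => (maxFailures M + 1) * blockLength n + 5 + (lastRound n + 1 - r)
  | .classify _ 0 => (maxFailures M + 1) * blockLength n + 4
  | .classify _ (_ + 1) => (maxFailures M + 1) * blockLength n + 3

/-- A bound for the number of remaining rounds in a time step in which the greatest value is `M` and
which has started with the phase number `p`. -/
def Server.rank (M p : ℕ) (s : Server n) : ℕ :=
  (if s.phases = p then (maxFailures M + 4) * blockLength n + lastRound n + 10 else 0) + s.stageRank M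

section Rank
variable {ε : ℝ} {k : ℕ} {v : Values n} {s₀ s : Server n} {nd₀ nd : Fin n → Node n}
  {S : Fin n → Bool}

lemma shrinks_min_le (w M : ℕ) : shrinks (min w (M + 1)) ≤ maxFailures M :=
  shrinks_mono (min_le_right _ _)

lemma weight_le {G : List (ℕ × ℕ)} {M : ℕ} (hG : Sorted G) (h : ∀ g ∈ G, g.2 ≤ M) :
    weight G ≤ M + 1 := by
  have := weight_le_of_sorted hG (a := 0) (b := M) (fun g hg => ⟨Nat.zero_le _, h g hg⟩) (by omega)
  omega

lemma rank_lt {M p : ℕ} {s s' : Server n} (h : s'.phases = s.phases)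
    (h' : s'.stageRank M < s.stageRank M) : s'.rank M p < s.rank M p := by
  unfold Server.rank
  rw [h]
  omega

/-- If all undecided nodes respect their filters, reports mean that the threshold has failed. -/
lemma tooHigh_or_tooLow (hs : Synced v s nd) {l : ℕ} (hc : s.cmd = .watch l)
    (hS : Possible (fun i => (nd i).prob) S)
    (hq : ∀ i ∈ s.mid, (nd i).filt.Contains (v i)) (h : speakers S ≠ ∅) (a : Fin n → ℕ) :
    s.TooHigh k (speakers S) a ∨ s.TooLow k (speakers S) a := by
  obtain ⟨i, hi⟩ := Finset.nonempty_iff_ne_empty.2 h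
  have h1 := violates_of_speaks hs hc hS (mem_speakers.1 hi)
  have h2 : i ∉ s.mid := fun hm => by
    unfold Violates at h1
    rw [hs.val i] at h1
    exact h1 (hq i hm)
  by_cases ht : i ∈ s.top
  · exact .inl (.inl ⟨i, Finset.mem_inter.2 ⟨hi, ht⟩⟩)
  · exact .inr (.inl ⟨i, Finset.mem_sdiff.2 ⟨hi, fun h => (Finset.mem_union.1 h).elim ht h2⟩⟩)

lemma weight_trimmed {l : ℕ} {T : Finset (Fin n)} {a : Fin n → ℕ} (hp : IsPick s.gaps l)
    (hs : Sorted s.gaps) (h : s.TooHigh k T a ∨ s.TooLow k T a) :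
    4 * weight (s.trimmed k l T a) ≤ 3 * weight s.gaps := by
  unfold Server.trimmed
  have h1 := weight_pick_below hp hs
  have h2 := weight_pick_above hp hs
  have h3 := weight_above_le (l + 1) (below l s.gaps)
  split_ifs with h4 h5 h5
  · omega
  · exact h2
  · exact h1
  · tauto

lemma stageRank_watch {M l : ℕ} (hc : s.cmd = .watch l) :
    (s.idle = true → s.stageRank M = (maxFailures M + 2) * blockLength n) ∧
    (s.idle = false → (∀ g ∈ s.gaps, g.2 ≤ M) → s.stageRank M =
      shrinks (weight s.gaps) * blockLength n + (lastRound n + 1 - s.rnd)) ∧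
    (s.idle = false → ¬ (∀ g ∈ s.gaps, g.2 ≤ M) → s.stageRank M =
      (maxFailures M + 1) * blockLength n + (lastRound n + 1 - s.rnd)) := by
  unfold Server.stageRank
  rw [hc]
  dsimp only
  refine ⟨fun h => if_pos h, fun h h' => ?_, fun h h' => ?_⟩
  · rw [if_neg (by simp [h]), if_pos h']
  · rw [if_neg (by simp [h]), if_neg h']

lemma stageRank_watch_le {M l : ℕ} (hc : s.cmd = .watch l) (hi : s.idle = false)
    (hs : Sorted s.gaps) : s.stageRank M ≤
      (maxFailures M + 1) * blockLength n + (lastRound n + 1 - s.rnd) := by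
  by_cases hg : ∀ g ∈ s.gaps, g.2 ≤ M
  · rw [(stageRank_watch hc).2.1 hi hg]
    have h : shrinks (weight s.gaps) ≤ maxFailures M := shrinks_mono (weight_le hs hg)
    have := Nat.mul_le_mul_right (blockLength n) (h.trans (Nat.le_succ _))
    exact Nat.add_le_add_right this _
  · exact ((stageRank_watch hc).2.2 hi hg).le

/-- Silent rounds advance the search. In the first report of a time step the threshold may survive or
fail with a small effect; later on, all undecided nodes respect their filters, so that every report
comes from a decided node and removes a quarter of the candidates. -/
lemma Inv.rank_watchStep (h : Inv ε k v s₀ nd₀ s nd) {l : ℕ} (hc : s.cmd = .watch l)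
    (hS : Possible (fun i => (nd i).prob) S)
    (hi : (s.watchStep k l (speakers S) (answers ε nd S)).1.idle = false) :
    (s.watchStep k l (speakers S) (answers ε nd S)).1.stageRank (maxValue v) <
      s.stageRank (maxValue v) := by
  obtain ⟨hp, hw⟩ : PhaseOk ε k s nd ∧ WatchOk ε k l v s nd := by
    have := h.stage; unfold StageOk at this; rwa [hc] at this
  have hs := h.synced
  set M := maxValue v
  obtain ⟨r1, r2, r3⟩ := stageRank_watch (M := M) hc
  have hrnd := hw.rnd
  have hb : blockLength n = lastRound n + 4 := rfl
  unfold Server.watchStep at hi ⊢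
  by_cases hempty : speakers S = ∅
  · rw [if_pos hempty] at hi ⊢
    have hlt : ¬ lastRound n ≤ s.rnd := by simpa using hi
    have hidle : decide (lastRound n ≤ s.rnd) = false := decide_eq_false hlt
    generalize hs' : { s with
      rnd := if lastRound n ≤ s.rnd then 0 else s.rnd + 1
      idle := decide (lastRound n ≤ s.rnd) } = s'
    have e1 : s'.cmd = .watch l := by rw [← hs']; exact hc
    have e2 : s'.idle = false := by rw [← hs']; exact hidle
    have e3 : s'.gaps = s.gaps := by rw [← hs']
    have e4 : s'.rnd = s.rnd + 1 := by rw [← hs']; exact if_neg hlt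
    obtain ⟨-, q2, q3⟩ := stageRank_watch (M := M) e1
    show s'.stageRank M < s.stageRank M
    rcases hid : s.idle
    · rw [e3, e4] at q2 q3
      by_cases hg : ∀ g ∈ s.gaps, g.2 ≤ M
      · rw [q2 e2 hg, r2 hid hg]; omega
      · rw [q3 e2 hg, r3 hid hg]; omega
    · have := stageRank_watch_le (M := M) e1 e2 (by rw [e3]; exact hp.gaps.sorted)
      rw [r1 hid, show maxFailures M + 2 = maxFailures M + 1 + 1 from rfl,
        Nat.add_mul (maxFailures M + 1)]
      omega
  rw [if_neg hempty] at hi ⊢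
  by_cases hok : s.StillOk k (speakers S) (answers ε nd S)
  · rw [if_pos hok]
    -- reports that do not refute the threshold occur only in the first round of a time step
    have hidle : s.idle = true := by
      by_contra hcon
      rcases tooHigh_or_tooLow hs hc hS (hw.quiet (by simpa using hcon)) hempty
        (answers ε nd S) (k := k) with h | h
      exacts [hok.1 h, hok.2.1 h]
    rw [r1 hidle, show maxFailures M + 2 = maxFailures M + 1 + 1 from rfl,
      Nat.add_mul (maxFailures M + 1)]
    refine (stageRank_watch_le (l := l) (s := { s.ask (.watch l) with
      fell := s.newFell (speakers S) (answers ε nd S)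
      rose := s.newRose (speakers S) (answers ε nd S) }) rfl rfl hp.gaps.sorted).trans_lt ?_
    simp only [Server.ask]
    omega
  · rw [if_neg hok]
    show shrinks (min (weight (s.trimmed k l (speakers S) (answers ε nd S))) (M + 1)) *
      blockLength n + lastRound n + 3 < s.stageRank M
    have h3 := Nat.mul_le_mul_right (blockLength n)
      (shrinks_min_le (weight (s.trimmed k l (speakers S) (answers ε nd S))) M)
    rcases hid : s.idle
    · by_cases hg : ∀ g ∈ s.gaps, g.2 ≤ M
      · rw [r2 hid hg]
        -- the weight shrinks to three quarters, which pays for a whole block of rounds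
        have h4 := weight_trimmed hw.pick hp.gaps.sorted (tooHigh_or_tooLow hs hc hS
          (hw.quiet hid) hempty (answers ε nd S) (k := k))
        have h5 := shrinks_lt h4 (one_le_weight hp.gaps.sorted hw.pick.ne_nil)
        have h6 := shrinks_mono (min_le_left
          (weight (s.trimmed k l (speakers S) (answers ε nd S))) (M + 1))
        have h7 := Nat.mul_le_mul_right (blockLength n) ((Nat.add_le_add_right h6 1).trans h5)
        rw [Nat.add_mul] at h7
        omega
      · rw [r3 hid hg, Nat.add_mul]
        omega
    · rw [r1 hid, Nat.add_mul]
      omega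

/-- Every round in which the server does not become idle lowers the rank. -/
lemma Inv.rank_step (h : Inv ε k v s₀ nd₀ s nd) (hS : Possible (fun i => (nd i).prob) S)
    (h0 : 0 < ε) (hε : ε < 1) (hk : 1 ≤ k) (hn : k ≤ n)
    (hi : (s.step ε k (speakers S) (answers ε nd S)).1.idle = false) :
    (s.step ε k (speakers S) (answers ε nd S)).1.rank (maxValue v) s₀.phases <
      s.rank (maxValue v) s₀.phases := by
  have hb : blockLength n = lastRound n + 4 := rfl
  set M := maxValue v with hM
  unfold Server.step at *
  rcases hc : s.cmd with l | - | b | ⟨r, t⟩ | ⟨z, w | w⟩ <;> rw [hc] at hi <;> simp only at hi ⊢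
  · refine rank_lt ?_ (h.rank_watchStep hc hS hi)
    unfold Server.watchStep
    split_ifs <;> rfl
  · refine rank_lt rfl ?_
    simp only [Server.stageRank, hc, Server.lowStep, Server.ask]
    omega
  · obtain ⟨hp, ⟨hlen, p, hpick, hpend⟩, hh⟩ :
        PhaseOk ε k s nd ∧ PendOk ε s nd ∧ HighOk k b s nd := by
      have := h.stage; unfold StageOk at this; rwa [hc] at this
    have hy : ∀ i ∈ s.mid, answers ε nd S i = min (scaleDown ε (nd i).high) (b + 1) :=
      fun i hi => HighOk.answers hp.roles h.synced hc hS hi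
    obtain ⟨u1, u2, -, u4⟩ := Server.update_spec (k := k) hp.gaps hh.1 hy hlen hpick hpend
    unfold Server.highStep
    split_ifs with hnil
    -- a time step contains at most one restart, so that the rank falls by its first summand
    · have hph : s.phases = s₀.phases := by
        have h1 := (h.highStep h0 hε hk hn hc hS).since
        unfold Server.highStep at h1
        rw [if_pos hnil] at h1
        exact Nat.succ_injective (h1.of_early trivial).1
      unfold Server.rank
      simp only [Server.ask, Server.stageRank]
      rw [if_neg (by omega), if_pos hph, Nat.add_mul, Nat.add_mul]
      omega
    · refine rank_lt rfl ?_
      have hbM := h.askHigh_le hc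
      have hg : ∀ g ∈ (s.update k b (answers ε nd S)).1, g.2 ≤ M := fun g hg => by
        have := ((u4 g.2).1 ⟨g, hg, u1.sorted.1 g hg, le_rfl⟩).2.1
        omega
      have h1 := weight_le u1.sorted hg
      have h2 := Nat.mul_le_mul_right (blockLength n) (shrinks_mono (le_min u2 h1))
      rw [(stageRank_watch rfl).2.1 rfl hg]
      simp only [Server.stageRank, hc, Server.ask]
      omega
  · refine rank_lt ?_ ?_
    · unfold Server.sampleStep
      dsimp only
      split_ifs <;> rfl
    · have hr : r ≤ lastRound n := by
        have := h.stage; unfold StageOk at this; rw [hc] at this; exact this.1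
      unfold Server.sampleStep
      dsimp only
      split_ifs <;> simp only [Server.stageRank, hc, Server.ask] <;> omega
  · obtain ⟨e1, -⟩ := h.since.of_early (by rw [hc]; trivial)
    refine rank_lt ?_ ?_
    · unfold Server.classifyStep Server.lowStep
      dsimp only
      split_ifs <;> rfl
    · rw [show s.stageRank M = (maxFailures M + 1) * blockLength n + 4 by
        unfold Server.stageRank; rw [hc], Nat.add_mul]
      unfold Server.classifyStep Server.lowStep
      dsimp only
      split_ifs with hsep
      · have hne : (speakers S).Nonempty := by
          obtain ⟨-, htop, -⟩ : ClassifyOk ε k z v s nd := by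
            have := h.stage; unfold StageOk at this; rwa [hc] at this
          have := card_clearlyLarger_lt h0 hε hk hn v
          rw [htop] at hsep
          exact Finset.card_pos.1 (by omega)
        obtain ⟨x, hx, hxw⟩ := Finset.exists_mem_eq_sup (speakers S) hne fun i => (i : ℕ) + 1
        simp only [hxw, Server.stageRank, Server.ask]
        rw [Nat.add_mul]
        omega
      · have h3 := Nat.mul_le_mul_right (blockLength n)
          (shrinks_min_le (weight [firstGap ε z]) M)
        simp only [Server.stageRank, Server.ask]
        omega
  · refine rank_lt rfl ?_
    simp only [Server.stageRank, hc, Server.lowStep, Server.ask]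
    have h3 := Nat.mul_le_mul_right (blockLength n) (shrinks_min_le (weight s.gaps) M)
    rw [Nat.add_mul]
    omega

end Rank

lemma stageRank_le_of_idle {M l : ℕ} {s : Server n} (hc : s.cmd = .watch l) (hi : s.idle = true)
    (p : ℕ) : s.rank M p < roundLimit 120 2 n M := by
  have h1 : maxFailures M ≤ 3 * (Nat.log 2 M + 2) := by
    refine shrinks_le ?_
    have := add_one_le_two_pow_log M
    exact this.trans_lt (Nat.pow_lt_pow_right (by norm_num) (Nat.lt_succ_self _))
  have h2 : lastRound n ≤ Nat.log 2 n + 1 := by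
    refine Nat.clog_le_of_le_pow ?_
    exact (Nat.le_succ n).trans (add_one_le_two_pow_log n)
  have h3 : s.rank M p ≤ (maxFailures M + 4) * blockLength n + lastRound n + 10 +
      (maxFailures M + 2) * blockLength n := by
    unfold Server.rank
    rw [(stageRank_watch hc).1 hi]
    split_ifs <;> omega
  refine h3.trans_lt ?_
  unfold roundLimit blockLength
  set X := Nat.log 2 n + Nat.log 2 M + 1 with hX
  have h4 : maxFailures M ≤ 6 * X := by omega
  have h5 : lastRound n ≤ X := by omega
  have h6 : 1 ≤ X := by omega
  have h7 : (maxFailures M + 4) * (lastRound n + 4) ≤ (6 * X + 4) * (X + 4) :=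
    Nat.mul_le_mul (by omega) (by omega)
  have h8 : (maxFailures M + 2) * (lastRound n + 4) ≤ (6 * X + 2) * (X + 4) :=
    Nat.mul_le_mul (by omega) (by omega)
  have h9 : X ≤ X ^ 2 := Nat.le_self_pow (by norm_num) X
  have h10 : (6 * X + 4) * (X + 4) = 6 * X ^ 2 + 28 * X + 16 := by ring
  have h11 : (6 * X + 2) * (X + 4) = 6 * X ^ 2 + 26 * X + 8 := by ring
  rw [h10] at h7
  rw [h11] at h8
  clear_value X
  omega

/-! ### Executions -/

section Execution
variable {ε : ℝ} {k : ℕ}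

/-- The server of a state of the system. -/
def serverOf (c : (monitor n k ε).Config) : Server n := c.server

/-- The nodes of a state of the system. -/
def nodeOf (c : (monitor n k ε).Config) : Fin n → Node n := c.node

lemma mem_runRounds_succ {L : ℕ} {c : (monitor n k ε).Config} {rs}
    (h : rs ∈ (Online.runRounds (L + 1) c).support) : ∃ S, Possible (coins c) S ∧
      (((serverOf (next c S)).idle = true ∧ rs = [roundOf c S]) ∨
      ((serverOf (next c S)).idle = false ∧ ∃ rs' ∈ (Online.runRounds L (next c S)).support,
        rs = roundOf c S :: rs')) := by
  rw [Online.runRounds, PMF.mem_support_bind_iff] at h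
  obtain ⟨r, hr, h⟩ := h
  obtain ⟨S, hS, rfl⟩ := exists_coins_of_mem_runRound hr
  refine ⟨S, hS, ?_⟩
  split_ifs at h with hd
  · rw [PMF.mem_support_pure_iff] at h
    exact .inl ⟨hd, h⟩
  · rw [PMF.mem_support_bind_iff] at h
    obtain ⟨rs', hrs', h⟩ := h
    rw [PMF.mem_support_pure_iff] at h
    rw [final_roundOf] at hrs'
    exact .inr ⟨by simpa using (show ¬ (serverOf (next c S)).idle = true from hd), rs', hrs', h⟩

section Rounds
variable {v : Values n} {s₀ : Server n} {nd₀ : Fin n → Node n}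

/-- The communication of a time step ends well within the limit for the number of rounds. -/
lemma runRounds_ok (h0 : 0 < ε) (hε : ε < 1) (hk : 1 ≤ k) (hn : k ≤ n) :
    ∀ {L : ℕ} {c : (monitor n k ε).Config}, Inv ε k v s₀ nd₀ (serverOf c) (nodeOf c) →
    (serverOf c).rank (maxValue v) s₀.phases < L → ∀ rs ∈ (Online.runRounds L c).support,
    (∃ r, rs.getLast? = some r ∧ (monitor n k ε).done r.server ∧
      EndOk ε k v (serverOf r.final) (nodeOf r.final) ∧
      Since ε k v s₀ nd₀ (serverOf r.final) (nodeOf r.final)) ∧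
    ∀ r ∈ rs, r.SizeAtMost (sizeLimit 120 n (maxValue v)) := by
  intro L
  induction L with
  | zero => intro c _ h; omega
  | succ L ih =>
    intro c h hL rs hrs
    obtain ⟨S, hS, ⟨hi, rfl⟩ | ⟨hi, rs', hrs', rfl⟩⟩ := mem_runRounds_succ hrs
    · refine ⟨⟨roundOf c S, rfl, hi, ?_⟩, ?_⟩
      · rw [final_roundOf]
        exact (h.step h0 hε hk hn hS).2 hi
      · simpa using h.sizeAtMost h0 hε hk hn hS
    · have h1 := (h.step h0 hε hk hn hS).1 hi
      have h2 := h.rank_step hS h0 hε hk hn hi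
      obtain ⟨⟨r, e1, e2⟩, e3⟩ := ih (c := next c S) h1 (lt_of_lt_of_le h2 (by omega)) rs' hrs'
      refine ⟨⟨r, ?_, e2⟩, ?_⟩
      · rw [List.getLast?_cons, e1]; rfl
      · intro r hr
        rcases List.mem_cons.1 hr with rfl | hr
        exacts [h.sizeAtMost h0 hε hk hn hS, e3 r hr]

/-- No messages are sent while no node violates its filter. -/
lemma runRounds_silent {l : ℕ} : ∀ {L : ℕ} {c : (monitor n k ε).Config}, (serverOf c).cmd = .watch l →
    (∀ i, (nodeOf c i).cmd = .watch l ∧ (nodeOf c i).filt.Contains (nodeOf c i).val) →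
    ∀ rs ∈ (Online.runRounds L c).support, ∀ r ∈ rs, r.messages = 0 := by
  intro L
  induction L with
  | zero =>
    intro c _ _ rs hrs
    rw [Online.runRounds, PMF.mem_support_pure_iff] at hrs
    simp [hrs]
  | succ L ih =>
    intro c hc hq rs hrs
    obtain ⟨S, hS, h⟩ := mem_runRounds_succ hrs
    have hsp : speakers S = ∅ := by
      rw [Finset.eq_empty_iff_forall_notMem]
      intro i hi
      rw [mem_speakers] at hi
      have : coins c i = 0 := by
        show (nodeOf c i).prob = 0
        unfold Node.prob
        rw [(hq i).1]
        exact if_pos (hq i).2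
      have := hS.of_eq_zero this
      simp [hi] at this
    have hre : reaction c S = (serverOf c).watchStep k l ∅ (answers ε (nodeOf c) S) := by
      show Server.step ε k (serverOf c) (speakers S) _ = _
      unfold Server.step
      rw [hc, hsp]
      rfl
    have hno : (reaction c S).2 = none := by
      rw [hre]; unfold Server.watchStep; rw [if_pos rfl]
    have hm : (roundOf c S).messages = 0 := by
      rw [messages_roundOf, hsp, hno]; rfl
    rcases h with ⟨-, rfl⟩ | ⟨-, rs', hrs', rfl⟩
    · simpa using hm
    · intro r hr
      rcases List.mem_cons.1 hr with rfl | hr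
      · exact hm
      · refine ih (c := next c S) ?_ (fun i => ?_) rs' hrs' r hr
        · show (reaction c S).1.cmd = _
          rw [hre]; unfold Server.watchStep; rw [if_pos rfl]; exact hc
        · show ((nodeOf c i).react ε (reaction c S).2).cmd = _ ∧
            ((nodeOf c i).react ε (reaction c S).2).filt.Contains
              ((nodeOf c i).react ε (reaction c S).2).val
          rw [hno]
          exact hq i

end Rounds

/-- The states after the nodes have observed new values. -/
def startOf (c : (monitor n k ε).Config) (v : Values n) : (monitor n k ε).Config where
  server := c.server
  node := fun i => (nodeOf c i).see (v i)

lemma values_cons_castSucc (s : (monitor n k ε).Step) (h : (monitor n k ε).History)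
    (t : Fin h.length) : Online.values (s :: h) t.castSucc = Online.values h t := by
  unfold Online.values
  rw [show (Fin.castSucc t).rev = t.rev.succ from Fin.rev_castSucc t]
  rfl

lemma values_cons_last (s : (monitor n k ε).Step) (h : (monitor n k ε).History) :
    Online.values (s :: h) (Fin.last h.length) = s.values := by
  unfold Online.values
  rw [show (Fin.last h.length).rev = 0 from Fin.rev_last h.length]
  rfl

/-- The invariant of an execution. -/
structure HistoryOk (h : (monitor n k ε).History) : Prop where
  good : ∃ v, EndOk ε k v (serverOf (Online.current h)) (nodeOf (Online.current h))
  tracks : Tracks ε k (Online.values h) (serverOf (Online.current h)).phases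
    (fun i => (nodeOf (Online.current h) i).low) fun i => (nodeOf (Online.current h) i).high
  paid : ∀ B, (∀ t, phaseCost n k ε (kthLargest k (Online.values h t))
    (neighborhood ε k (Online.values h t)).card ≤ B) →
    (serverOf (Online.current h)).paid ≤
      searchCost n k + 41 + (serverOf (Online.current h)).phases * B

lemma historyOk_nil (hk : 1 ≤ k) (hn : k ≤ n) : HistoryOk (ε := ε) (n := n) (k := k) [] where
  good := ⟨_, endOk_init ε hk hn⟩
  tracks := fun S => .inr ⟨Nat.zero_le _, fun t => t.elim0⟩
  paid := fun B _ => by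
    show searchCost n k + 41 ≤ searchCost n k + 41 + 0 * B
    omega

lemma HistoryOk.inv (hε : ε < 1) {h : (monitor n k ε).History} (hh : HistoryOk h) (v : Values n) :
    Inv ε k v (serverOf (startOf (Online.current h) v)) (nodeOf (startOf (Online.current h) v))
      (serverOf (startOf (Online.current h) v)) (nodeOf (startOf (Online.current h) v)) := by
  obtain ⟨_, hg⟩ := hh.good
  exact hg.start hε v

lemma HistoryOk.rank_lt {h : (monitor n k ε).History} (hh : HistoryOk h) (v : Values n) :
    (serverOf (startOf (Online.current h) v)).rank (maxValue v)
      (serverOf (startOf (Online.current h) v)).phases < roundLimit 120 2 n (maxValue v) := by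
  obtain ⟨_, hg⟩ := hh.good
  obtain ⟨l, hc, -⟩ := hg.watch
  exact stageRank_le_of_idle hc hg.idle _

/-- A time step preserves the invariant and meets all requirements. -/
lemma HistoryOk.step (h0 : 0 < ε) (hε : ε < 1) (hk : 1 ≤ k) (hn : k ≤ n)
    {h : (monitor n k ε).History} (hh : HistoryOk h) (v : Values n) {rs}
    (hrs : rs ∈ (Online.runRounds (roundLimit 120 2 n (maxValue v))
      (startOf (Online.current h) v)).support) :
    let s : (monitor n k ε).Step := ⟨v, startOf (Online.current h) v, rs⟩
    HistoryOk (s :: h) ∧ s.IsCorrect ε k (sizeLimit 120 n (maxValue v)) := by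
  intro s
  have hinv := hh.inv hε v
  obtain ⟨⟨r, e1, e2, e3, e4⟩, e5⟩ := runRounds_ok h0 hε hk hn hinv (hh.rank_lt v) rs hrs
  have hfin : s.final = r.final := by
    unfold Online.Step.final
    rw [show s.rounds.getLast? = some r from e1]
  have hcur : Online.current (s :: h) = r.final := hfin
  have hval : (fun t : Fin h.length => Online.values (s :: h) t.castSucc) = Online.values h :=
    funext fun t => values_cons_castSucc s h t
  have hlast : Online.values (s :: h) (Fin.last h.length) = v := values_cons_last s h
  have hT := hh.tracks
  rw [← hval] at hT
  have hpaid := hh.paid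
  refine ⟨⟨⟨v, ?_⟩, ?_, ?_⟩, ⟨⟨r, e1, e2⟩, e5, fun hq => ?_, ?_, ?_⟩⟩
  · rw [hcur]; exact e3
  · rw [hcur]
    rcases e4 with ⟨f1, -, -, f4⟩ | ⟨f1, f2, f3, -⟩
    · rw [f1]
      simp only [fun i => (f4 i).1, fun i => (f4 i).2]
      have := Tracks.extend hT
      rw [hlast] at this
      exact this
    · rw [f1]
      simp only [fun i => (f2 i).1, fun i => (f2 i).2]
      have := Tracks.restart hε hk hT (by rw [hlast]; exact f3)
      rw [hlast] at this
      exact this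
  · intro B hB
    rw [hcur]
    have hB' := hpaid B fun t => by
      rw [← values_cons_castSucc s h t]; exact hB _
    have hB'' := hB (Fin.last h.length)
    rw [hlast] at hB''
    rcases e4 with ⟨f1, f2, -, -⟩ | ⟨f1, -, -, f4⟩
    · rw [f1, f2]; exact hB'
    · rw [f1, f4, Nat.add_mul]
      have f5 : (serverOf (startOf (Online.current h) v)).paid ≤ _ := hB'
      have f6 : (serverOf (startOf (Online.current h) v)).phases =
        (serverOf (Online.current h)).phases := rfl
      rw [f6]
      split_ifs <;> omega
  · obtain ⟨_, hg⟩ := hh.good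
    obtain ⟨l, hc, -⟩ := hg.watch
    have := runRounds_silent (c := startOf (Online.current h) v) hc
      (fun i => ⟨(hg.cmd i).trans hc, hq i⟩) rs hrs
    unfold Online.Step.messages
    exact List.sum_eq_zero fun m hm => by
      obtain ⟨r, hr, rfl⟩ := List.mem_map.1 hm
      exact this r hr
  all_goals
    rw [hfin]
    obtain ⟨f1, f2, f3⟩ := Classical.epsilon_spec e3.exists_output
    have := e3.correct h0 hε hk hn f1 f2 f3
  exacts [this.1, this.2]

lemma mem_run_succ {L : ℕ → ℕ} {adv : (monitor n k ε).Adversary} {T : ℕ} {h}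
    (hm : h ∈ (Online.run L adv (T + 1)).support) : ∃ h' ∈ (Online.run L adv T).support,
      ∃ rs ∈ (Online.runRounds (L (maxValue (adv h')))
        (startOf (Online.current h') (adv h'))).support,
      h = ⟨adv h', startOf (Online.current h') (adv h'), rs⟩ :: h' := by
  rw [Online.run, PMF.mem_support_bind_iff] at hm
  obtain ⟨h', hh', hm⟩ := hm
  refine ⟨h', hh', ?_⟩
  rw [PMF.mem_support_bind_iff] at hm
  obtain ⟨rs, hrs, hm⟩ := hm
  rw [PMF.mem_support_pure_iff] at hm
  exact ⟨rs, hrs, hm⟩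

lemma historyOk_of_mem_run (h0 : 0 < ε) (hε : ε < 1) (hk : 1 ≤ k) (hn : k ≤ n)
    (adv : (monitor n k ε).Adversary) : ∀ {T : ℕ} {h},
    h ∈ (Online.run (roundLimit 120 2 n) adv T).support → HistoryOk h ∧ h.length = T ∧
      ∀ s ∈ h, s.IsCorrect ε k (sizeLimit 120 n (maxValue s.values)) := by
  intro T
  induction T with
  | zero =>
    intro h hm
    rw [Online.run, PMF.mem_support_pure_iff] at hm
    subst hm
    exact ⟨historyOk_nil hk hn, rfl, by simp⟩
  | succ T ih =>
    intro h hm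
    obtain ⟨h', hh', rs, hrs, rfl⟩ := mem_run_succ hm
    obtain ⟨e1, e2, e3⟩ := ih hh'
    obtain ⟨f1, f2⟩ := e1.step h0 hε hk hn (adv h') hrs
    refine ⟨f1, by simp [e2], fun s hs => ?_⟩
    rcases List.mem_cons.1 hs with rfl | hs
    exacts [f2, e3 s hs]

lemma monitor_solves (h0 : 0 < ε) (hε : ε < 1) (hk : 1 ≤ k) (hn : k ≤ n) :
    (monitor n k ε).Solves ε k 120 2 := fun adv _ _ hm =>
  (historyOk_of_mem_run h0 hε hk hn adv hm).2.2

end Execution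

/-! ### The debt of a state -/

/-- The expected number of messages that the search among `m` decided nodes with violated filters
still costs in round `r`. -/
def reserve (n m r : ℕ) : ℝ := if m = 0 then 3 else m * (sendProb n r : ℝ) + 2

open Classical in
/-- The decided nodes that violate their filters. -/
def outsiders (s : Server n) (nd : Fin n → Node n) : Finset (Fin n) :=
  Finset.univ.filter fun i => i ∉ s.mid ∧ Violates nd i

lemma mem_outsiders {s : Server n} {nd : Fin n → Node n} {i : Fin n} :
    i ∈ outsiders s nd ↔ i ∉ s.mid ∧ Violates nd i := by simp [outsiders]

/-- The number of thresholds that can still fail in the present phase. -/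
def Server.supply (s : Server n) : ℕ := potential s.width s.mid s.gaps s.holed

/-- The number of messages for which a threshold has to pay when it fails. -/
def Server.price (s : Server n) : ℕ := 8 * s.mid.card + 8

/-- An upper bound for the expected number of messages that the present phase still causes, including
the search at the start of the next phase. Every failure of a threshold is paid by `Server.price`: the
reports of the undecided nodes on their least and largest values, three broadcasts, a credit of three
messages for each of the two possible violations of an undecided node (the report, the broadcast that
answers it, and the search that starts anew), and the search among the decided nodes. -/
def debt (k : ℕ) (s : Server n) (nd : Fin n → Node n) : ℝ :=
  match s.cmd with
  | .watch _ => searchCost n k + s.price * s.supply +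
      3 * (2 * s.mid.card - s.fell.card - s.rose.card) + reserve n (outsiders s nd).card s.rnd
  | .askLow => searchCost n k + s.price * (s.supply - s.pend.length : ℕ) + 8 * s.mid.card + 6
  | .askHigh _ => searchCost n k + s.price * (s.supply - s.pend.length : ℕ) + 7 * s.mid.card + 5
  | .sample r t => (Finset.univ.filter fun i => t ≤ keyOf (nd i).id (nd i).val).card *
      (sendProb n r : ℝ) + (2 * k + 1) * (lastRound n + 1 - r : ℕ)
  | .classify _ 0 => 0
  | .classify _ (_ + 1) =>
      searchCost n k + s.price * (s.supply - s.pend.length : ℕ) + 8 * s.mid.card + 6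

/-- The number of messages in a round. -/
def spent (T : Finset (Fin n)) (p : Server n × Option Cmd) : ℕ :=
  T.card + if p.2.isSome then 1 else 0

lemma sendProb_nonneg (n r : ℕ) : (0 : ℝ) ≤ sendProb n r := (sendProb n r).2.1

lemma sendProb_le_one (n r : ℕ) : (sendProb n r : ℝ) ≤ 1 := (sendProb n r).2.2

lemma sendProb_succ {r : ℕ} (h : r < lastRound n) :
    (sendProb n (r + 1) : ℝ) = 2 * sendProb n r := by
  show (1 / 2 : ℝ) ^ (lastRound n - (r + 1)) = 2 * (1 / 2) ^ (lastRound n - r)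
  rw [show lastRound n - r = lastRound n - (r + 1) + 1 by omega, pow_succ]
  ring

lemma card_mul_sendProb_zero (T : Finset (Fin n)) : (T.card : ℝ) * sendProb n 0 ≤ 1 := by
  have h1 : T.card ≤ 2 ^ lastRound n :=
    (T.card_le_univ.trans_eq (Fintype.card_fin n)).trans (Nat.le_pow_clog (by norm_num) n)
  have h2 : (T.card : ℝ) ≤ 2 ^ lastRound n := by exact_mod_cast h1
  show (T.card : ℝ) * (1 / 2) ^ (lastRound n - 0) ≤ 1
  rw [Nat.sub_zero, one_div, inv_pow, ← div_eq_mul_inv, div_le_one (by positivity)]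
  exact h2

lemma reserve_zero_le (T : Finset (Fin n)) : reserve n T.card 0 ≤ 3 := by
  unfold reserve
  split_ifs
  · exact le_rfl
  · linarith [card_mul_sendProb_zero T]

lemma reserve_nonneg (n m r : ℕ) : 0 ≤ reserve n m r := by
  unfold reserve
  have := mul_nonneg (Nat.cast_nonneg (α := ℝ) m) (sendProb_nonneg n r)
  split_ifs <;> linarith

section Debt
variable {ε : ℝ} {k : ℕ} {v : Values n} {s₀ s : Server n} {nd₀ nd : Fin n → Node n}

lemma WatchOk.credit {l : ℕ} (h : WatchOk ε k l v s nd) :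
    (0 : ℝ) ≤ 2 * s.mid.card - s.fell.card - s.rose.card := by
  have h1 : (s.fell.card : ℝ) ≤ s.mid.card := by exact_mod_cast Finset.card_le_card h.fell_sub
  have h2 : (s.rose.card : ℝ) ≤ s.mid.card := by exact_mod_cast Finset.card_le_card h.rose_sub
  linarith

lemma debt_watch {l : ℕ} (hc : s.cmd = .watch l) : debt k s nd =
    searchCost n k + s.price * s.supply +
      3 * (2 * s.mid.card - s.fell.card - s.rose.card) + reserve n (outsiders s nd).card s.rnd := by
  unfold debt; rw [hc]

lemma debt_askLow (hc : s.cmd.AsksLow) : debt k s nd =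
    searchCost n k + s.price * (s.supply - s.pend.length : ℕ) + 8 * s.mid.card + 6 := by
  unfold debt
  rcases h : s.cmd with l | - | b | ⟨r, t⟩ | ⟨z, w | w⟩ <;> rw [h] at hc <;>
    first | rfl | exact hc.elim

lemma Inv.debt_nonneg (h : Inv ε k v s₀ nd₀ s nd) : 0 ≤ debt k s nd := by
  rcases hc : s.cmd with l | - | b | ⟨r, t⟩ | ⟨z, w | w⟩
  · have hw : WatchOk ε k l v s nd := by
      have := h.stage; unfold StageOk at this; rw [hc] at this; exact this.2
    rw [debt_watch hc]
    have := hw.credit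
    have := reserve_nonneg n (outsiders s nd).card s.rnd
    positivity
  all_goals simp only [debt, hc, le_refl]
  · positivity
  · positivity
  · have := sendProb_nonneg n r
    positivity
  · positivity

/-- The failure of a threshold lowers the number of thresholds that can still fail. -/
lemma supply_trimmed {l : ℕ} {T : Finset (Fin n)} {a : Fin n → ℕ} (hp : IsPick s.gaps l)
    (hok : ¬ s.StillOk k T a) :
    potential s.width s.mid (s.trimmed k l T a) s.holed - (s.culprit k T a).length + 1 ≤ s.supply := by
  have h1 := listPot_pick_below hp le_rfl
  have h2 := listPot_pick_above hp (Nat.lt_succ_self l)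
  have h3 := listPot_above_le (l + 1) (below l s.gaps)
  unfold Server.supply potential Server.trimmed Server.culprit
  by_cases h4 : s.TooHigh k T a <;> by_cases h5 : s.TooLow k T a
  · rw [if_pos h5, if_pos h4, if_pos (.inl h4)]
    simp only [List.length_nil]; omega
  · rw [if_neg h5, if_pos h4, if_pos (.inl h4)]
    simp only [List.length_nil]; omega
  · rw [if_pos h5, if_neg h4, if_pos (.inr h5)]
    simp only [List.length_nil, Nat.succ_eq_add_one] at *; omega
  · rw [if_neg h5, if_neg h4, if_neg (by tauto)]
    have hd : ¬ Disjoint (s.newFell T a) (s.newRose T a) := fun h => hok ⟨h4, h5, h⟩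
    have hne : (s.newFell T a ∩ s.newRose T a).Nonempty := by
      rwa [Finset.nonempty_iff_ne_empty, ne_eq, ← Finset.disjoint_iff_inter_eq_empty]
    have := hne.card_pos
    rw [List.length_take, Finset.length_toList]
    omega

/-- The decided nodes do not notice that the filters of undecided nodes change. -/
lemma outsiders_congr {l : ℕ} {s' : Server n} {nd' : Fin n → Node n} (h : WatchOk ε k l v s nd)
    (h' : WatchOk ε k l v s' nd') (hm : s'.mid = s.mid) (ht : s'.top = s.top)
    (hv : ∀ i, (nd' i).val = (nd i).val) : outsiders s' nd' = outsiders s nd := by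
  ext i
  rw [mem_outsiders, mem_outsiders, hm]
  refine and_congr_right fun hi => ?_
  have h1 := h.lo i
  have h2 := h.hi i
  have h1' := h'.lo i
  have h2' := h'.hi i
  have h3 : i ∉ s.rose := fun h3 => hi (h.rose_sub h3)
  have h3' : i ∉ s'.rose := fun h3 => hi (hm ▸ h'.rose_sub h3)
  simp only [hm, ht, hi, h3, h3', false_and, or_false] at h1 h2 h1' h2'
  unfold Violates Interval.Contains
  rw [hv i, h1, h2, h1', h2']

/-- The costs of a round of the search for violations in terms of the number of decided nodes that
report: if there are any, the threshold fails and pays for everything else. -/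
lemma Inv.spent_watchStep (h0 : 0 < ε) (hε : ε < 1) (h : Inv ε k v s₀ nd₀ s nd) {l : ℕ}
    (hc : s.cmd = .watch l) {S : Fin n → Bool} (hS : Possible (fun i => (nd i).prob) S) :
    let p := s.watchStep k l (speakers S) (answers ε nd S)
    (spent (speakers S) p : ℝ) + debt k p.1 (fun i => (nd i).react ε p.2) ≤
      (searchCost n k + s.price * s.supply + 3 * (2 * s.mid.card - s.fell.card - s.rose.card)) +
      (((outsiders s nd).filter fun i => S i).card +
      (if (outsiders s nd).card = 0 then 3 else
        (2 * ((outsiders s nd).card * (sendProb n s.rnd : ℝ)) + 2) *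
          if ∀ i ∈ outsiders s nd, S i = false then 1 else 0)) := by
  intro p
  obtain ⟨hp, hw⟩ : PhaseOk ε k s nd ∧ WatchOk ε k l v s nd := by
    have := h.stage; unfold StageOk at this; rwa [hc] at this
  have hs := h.synced
  have hr := hp.roles
  have hnext := h.watchStep h0 hε hc hS
  set O := outsiders s nd with hO
  have hX : speakers S \ s.mid = O.filter fun i => S i := by
    ext i
    simp only [hO, Finset.mem_sdiff, Finset.mem_filter, mem_outsiders, mem_speakers]
    exact ⟨fun h => ⟨⟨h.2, violates_of_speaks hs hc hS h.1⟩, h.1⟩, fun h => ⟨h.2, h.1.1⟩⟩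
  have hcard : (speakers S).card = (O.filter fun i => S i).card + (speakers S ∩ s.mid).card := by
    rw [← hX, Finset.card_sdiff_add_card_inter]
  have hcredit := hw.credit
  have hOq : (0 : ℝ) ≤ O.card * (sendProb n s.rnd : ℝ) :=
    mul_nonneg (Nat.cast_nonneg _) (sendProb_nonneg _ _)
  set c : ℝ := if O.card = 0 then 3 else (2 * (O.card * (sendProb n s.rnd : ℝ)) + 2) *
          if ∀ i ∈ O, S i = false then 1 else 0 with hcdef
  have hc0 : 0 ≤ c := by rw [hcdef]; split_ifs <;> linarith
  have hc2 : (O.filter fun i => S i) = ∅ → 2 ≤ c := by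
    intro he
    rw [Finset.filter_eq_empty_iff] at he
    have he' : ∀ i ∈ O, S i = false := fun i hi => by simpa using he hi
    rw [hcdef, if_pos he']
    split_ifs <;> linarith
  have hpdef : p = s.watchStep k l (speakers S) (answers ε nd S) := rfl
  unfold Server.watchStep at hpdef
  by_cases hempty : speakers S = ∅
  -- silence costs nothing, but doubles the sending probability
  · have hno : ∀ i, S i = false := fun i => by
      by_contra hi
      have : i ∈ speakers S := by simpa using hi
      rw [hempty] at this; simp at this
    rw [if_pos hempty] at hpdef
    have hcmd : p.1.cmd = .watch l := by rw [hpdef]; exact hc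
    have hp2 : p.2 = none := by rw [hpdef]
    have hOO : outsiders p.1 (fun i => (nd i).react ε p.2) = O := by
      unfold outsiders
      rw [hO, hp2, hpdef]
      rfl
    have hres : reserve n O.card p.1.rnd ≤ c := by
      unfold reserve
      rw [hcdef, if_pos fun i _ => hno i]
      split_ifs with hz
      · exact le_rfl
      · have hlt : ¬ lastRound n ≤ s.rnd := fun hle => by
          obtain ⟨i, hi⟩ := Finset.card_pos.1 (Nat.pos_of_ne_zero hz)
          have := speaks_of_last hs hc hS hle (mem_outsiders.1 hi).2
          simp [hno i] at this
        have hrnd : p.1.rnd = s.rnd + 1 := by rw [hpdef]; exact if_neg hlt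
        rw [hrnd, sendProb_succ (not_le.1 hlt)]
        linarith
    rw [debt_watch hcmd, hOO]
    have e1 : spent (speakers S) p = 0 := by unfold spent; rw [hempty, hp2]; rfl
    have e2 : p.1.price = s.price ∧ p.1.supply = s.supply ∧ p.1.mid = s.mid ∧ p.1.fell = s.fell ∧
        p.1.rose = s.rose := by rw [hpdef]; exact ⟨rfl, rfl, rfl, rfl, rfl⟩
    rw [e1, e2.1, e2.2.1, e2.2.2.1, e2.2.2.2.1, e2.2.2.2.2]
    push_cast
    have : (0 : ℝ) ≤ (O.filter fun i => S i).card := Nat.cast_nonneg _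
    linarith
  have hreports := card_reports hε hs hc hr hw hS
  rw [if_neg hempty] at hpdef
  by_cases hok : s.StillOk k (speakers S) (answers ε nd S)
  · rw [if_pos hok] at hpdef
    -- a report of a decided node refutes the threshold, so that only undecided nodes have reported
    have hX0 : (O.filter fun i => S i) = ∅ := by
      rw [← hX, Finset.eq_empty_iff_forall_notMem]
      intro i hi
      rw [Finset.mem_sdiff] at hi
      by_cases ht : i ∈ s.top
      · exact hok.1 (.inl ⟨i, Finset.mem_inter.2 ⟨hi.1, ht⟩⟩)
      · exact hok.2.1 (.inl ⟨i, Finset.mem_sdiff.2 ⟨hi.1, fun h =>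
          (Finset.mem_union.1 h).elim ht hi.2⟩⟩)
    have ha : 1 ≤ (speakers S ∩ s.mid).card := by
      have := (Finset.nonempty_iff_ne_empty.2 hempty).card_pos
      rw [hX0, Finset.card_empty] at hcard
      omega
    have hcmd : p.1.cmd = .watch l := by rw [hpdef]; rfl
    have hidle : p.1.idle = false := by rw [hpdef]; rfl
    have hw' : WatchOk ε k l v p.1 (fun i => (nd i).react ε p.2) := by
      have := (hnext.1 hidle).stage
      unfold StageOk at this
      rw [show (s.watchStep k l (speakers S) (answers ε nd S)).1.cmd = .watch l from hcmd] at this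
      exact this.2
    have e2 : p.1.price = s.price ∧ p.1.supply = s.supply ∧ p.1.mid = s.mid ∧ p.1.top = s.top ∧
        p.1.fell = s.newFell (speakers S) (answers ε nd S) ∧
        p.1.rose = s.newRose (speakers S) (answers ε nd S) ∧ p.1.rnd = 0 := by
      rw [hpdef]; exact ⟨rfl, rfl, rfl, rfl, rfl, rfl, rfl⟩
    have hOO : outsiders p.1 (fun i => (nd i).react ε p.2) = O :=
      outsiders_congr hw hw' e2.2.2.1 e2.2.2.2.1 fun i => by rw [hpdef]; rfl
    rw [debt_watch hcmd, hOO, e2.1, e2.2.1, e2.2.2.1, e2.2.2.2.2.1, e2.2.2.2.2.2.1,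
      e2.2.2.2.2.2.2]
    have e1 : spent (speakers S) p = (speakers S ∩ s.mid).card + 1 := by
      unfold spent; rw [hcard, hX0, hpdef]; simp
    have hres := reserve_zero_le O
    have hc2 := hc2 hX0
    rw [e1, hX0]
    have h1 : (s.fell.card : ℝ) + s.rose.card + (speakers S ∩ s.mid).card ≤
      (s.newFell (speakers S) (answers ε nd S)).card +
        (s.newRose (speakers S) (answers ε nd S)).card := by exact_mod_cast hreports
    have h2 : (1 : ℝ) ≤ (speakers S ∩ s.mid).card := by exact_mod_cast ha
    push_cast [Finset.card_empty]
    linarith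
  · rw [if_neg hok] at hpdef
    have hcmd : p.1.cmd = .askLow := by rw [hpdef]; rfl
    rw [debt_askLow (by rw [hcmd]; trivial)]
    -- the threshold fails and its price becomes available
    have hsup := supply_trimmed hw.pick hok
    have e2 : p.1.price = s.price ∧ p.1.mid = s.mid ∧ p.1.supply - p.1.pend.length + 1 ≤ s.supply := by
      rw [hpdef]; exact ⟨rfl, rfl, hsup⟩
    have e1 : spent (speakers S) p = (speakers S).card + 1 := by
      unfold spent; rw [hpdef]; simp
    have h1 : ((p.1.supply - p.1.pend.length : ℕ) : ℝ) + 1 ≤ s.supply := by exact_mod_cast e2.2.2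
    have h2 : (s.price : ℝ) = 8 * s.mid.card + 8 := by unfold Server.price; push_cast; ring
    have h3 : (s.price : ℝ) * ((p.1.supply - p.1.pend.length : ℕ) + 1) ≤ s.price * s.supply :=
      mul_le_mul_of_nonneg_left h1 (Nat.cast_nonneg _)
    have h4 : (s.fell.card : ℝ) + s.rose.card + (speakers S ∩ s.mid).card ≤ 2 * s.mid.card := by
      have h5 := Finset.card_le_card (newFell_spec (S := S) hs hc hr hw).1
      have h6 := Finset.card_le_card (newRose_spec (S := S) hε hs hc hr hw hS).1
      have : s.fell.card + s.rose.card + (speakers S ∩ s.mid).card ≤ 2 * s.mid.card := by omega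
      exact_mod_cast this
    rw [e1, hcard, e2.1, e2.2.1]
    push_cast
    rw [mul_add, mul_one, h2] at h3
    rw [h2] at *
    linarith

end Debt

/-! ### The average debt after a round -/

lemma avg_nonneg {q : Fin n → unitInterval} {f : (Fin n → Bool) → ℝ} (h : ∀ S, 0 ≤ f S) :
    0 ≤ avg q f :=
  Finset.sum_nonneg fun S _ => mul_nonneg (prod_coinWeight_nonneg q S) (h S)

lemma avg_le_of_forall {q : Fin n → unitInterval} {f : (Fin n → Bool) → ℝ} {c : ℝ}
    (h : ∀ S, Possible q S → f S ≤ c) : avg q f ≤ c := by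
  rw [← avg_const q c]
  exact avg_mono h

lemma keyOf_injective (v : Values n) : Function.Injective fun i => keyOf i (v i) := by
  intro i j h
  have h' : keyOf i (v i) % n = keyOf j (v j) % n := congrArg (· % n) h
  unfold keyOf at h'
  rw [Nat.mul_add_mod', Nat.mul_add_mod', Nat.mod_eq_of_lt i.2, Nat.mod_eq_of_lt j.2] at h'
  exact Fin.ext h'

section Debt
variable {ε : ℝ} {k : ℕ} {v : Values n} {s₀ s : Server n} {nd₀ nd : Fin n → Node n}

/-- A search for violations lasts a constant number of messages: by `silence_bound`, the doubled sending
probability is balanced by the probability of silence. -/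
lemma Inv.avg_watchStep (h0 : 0 < ε) (hε : ε < 1) (h : Inv ε k v s₀ nd₀ s nd) {l : ℕ}
    (hc : s.cmd = .watch l) :
    avg (fun i => (nd i).prob) (fun S => (spent (speakers S)
      (s.watchStep k l (speakers S) (answers ε nd S)) : ℝ) +
      debt k (s.watchStep k l (speakers S) (answers ε nd S)).1
        fun i => (nd i).react ε (s.watchStep k l (speakers S) (answers ε nd S)).2) ≤
      debt k s nd := by
  have hr : RolesOk k s nd := by
    have := h.stage; unfold StageOk at this; rw [hc] at this; exact this.1.roles
  have hq : ∀ i ∈ outsiders s nd, ((nd i).prob : ℝ) = sendProb n s.rnd := fun i hi => by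
    obtain ⟨hm, hv⟩ := mem_outsiders.1 hi
    rw [(prob_watch h.synced hc i).2.2 hv fun e => hm ((hr.mid i).1 e)]
  refine (avg_mono fun S hS => h.spent_watchStep h0 hε hc hS).trans ?_
  rw [avg_add, avg_const, avg_add, avg_card, Finset.sum_congr rfl hq, Finset.sum_const,
    nsmul_eq_mul, debt_watch hc]
  refine add_le_add le_rfl ?_
  unfold reserve
  split_ifs with hm
  · rw [avg_const, hm]
    simp
  · rw [avg_const_mul, avg_none, Finset.prod_congr rfl fun i hi => by rw [hq i hi],
      Finset.prod_const]
    have := silence_bound (sendProb_nonneg n s.rnd) (sendProb_le_one n s.rnd)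
      (outsiders s nd).card
    rw [mul_comm] at this
    linarith

lemma Inv.spent_lowStep (h : Inv ε k v s₀ nd₀ s nd) (hc : s.cmd.AsksLow) {S : Fin n → Bool}
    (hS : Possible (fun i => (nd i).prob) S) (a : Fin n → ℕ) (nd' : Fin n → Node n) :
    (spent (speakers S) (s.lowStep k a) : ℝ) + debt k (s.lowStep k a).1 nd' = debt k s nd := by
  have hp := (hc.stageOk h.stage).1
  rw [debt_askLow hc]
  unfold spent
  rw [speakers_eq_of_asksMid h.synced hc.asksMid.1 hp.roles.mid hS]
  simp only [debt, Server.lowStep, Server.ask, Option.isSome_some, if_true]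
  show _ + ((searchCost n k : ℝ) + s.price * (s.supply - s.pend.length : ℕ) + _ + _) = _
  push_cast
  ring

/-- At the start of a phase all nodes take part, with a probability of at most `1 / n` each. -/
lemma debt_restart {s' : Server n} (hc : s'.cmd = .sample 0 0) (nd' : Fin n → Node n) :
    debt k s' nd' ≤ searchCost n k - 1 := by
  have := card_mul_sendProb_zero (Finset.univ.filter fun i => 0 ≤ keyOf (nd' i).id (nd' i).val)
  unfold debt searchCost
  rw [hc]
  push_cast
  linarith

lemma Inv.spent_highStep (h : Inv ε k v s₀ nd₀ s nd) {b : ℕ} (hc : s.cmd = .askHigh b)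
    {S : Fin n → Bool} (hS : Possible (fun i => (nd i).prob) S) (nd' : Fin n → Node n) :
    (spent (speakers S) (s.highStep k b (answers ε nd S)) : ℝ) +
      debt k (s.highStep k b (answers ε nd S)).1 nd' ≤ debt k s nd := by
  obtain ⟨hp, ⟨hlen, p, hpick, hpend⟩, hh⟩ : PhaseOk ε k s nd ∧ PendOk ε s nd ∧ HighOk k b s nd := by
    have := h.stage; unfold StageOk at this; rwa [hc] at this
  have hr := hp.roles
  have hy : ∀ i ∈ s.mid, answers ε nd S i = min (scaleDown ε (nd i).high) (b + 1) :=
    fun i hi => HighOk.answers hr h.synced hc hS hi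
  obtain ⟨-, -, u3, -⟩ := Server.update_spec (k := k) hp.gaps hh.1 hy hlen hpick hpend
  have hold : debt k s nd =
      searchCost n k + s.price * (s.supply - s.pend.length : ℕ) + 7 * s.mid.card + 5 := by
    unfold debt; rw [hc]
  have hsp := speakers_eq_of_asksMid h.synced (by rw [hc]; trivial) hr.mid hS
  rw [hold]
  unfold Server.highStep
  split_ifs with hnil
  · have h1 := debt_restart (k := k) (s' := { s.ask (.sample 0 0) with phases := s.phases + 1 })
      rfl nd'
    have h2 : (0 : ℝ) ≤ s.price * (s.supply - s.pend.length : ℕ) := by positivity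
    have h3 : (0 : ℝ) ≤ s.mid.card := by positivity
    unfold spent
    rw [hsp]
    simp only [Option.isSome_some, if_true]
    push_cast
    linarith
  · dsimp only
    generalize Classical.epsilon (IsPick (s.update k b (answers ε nd S)).1) = l
    rw [debt_watch (l := l) rfl]
    unfold spent
    rw [hsp]
    have h1 : (({ s.ask (.watch l) with
        gaps := (s.update k b (answers ε nd S)).1
        holed := (s.update k b (answers ε nd S)).2
        fell := s.mid.filter fun i => s.lows i < l
        rose := s.mid.filter fun i => l < answers ε nd S i } : Server n).supply : ℝ) ≤
        (s.supply - s.pend.length : ℕ) := by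
      have : potential s.width s.mid (s.update k b (answers ε nd S)).1
        (s.update k b (answers ε nd S)).2 ≤ s.supply - s.pend.length := by
        unfold Server.supply; omega
      exact_mod_cast this
    have h2 := mul_le_mul_of_nonneg_left h1 (Nat.cast_nonneg (α := ℝ) s.price)
    refine le_trans (add_le_add le_rfl (add_le_add (add_le_add (add_le_add le_rfl h2) le_rfl)
      (reserve_zero_le _))) ?_
    simp only [Option.isSome_some, if_true, Server.ask]
    push_cast
    have h4 : (0 : ℝ) ≤ (s.mid.filter fun i => s.lows i < l).card := Nat.cast_nonneg _
    have h5 : (0 : ℝ) ≤ (s.mid.filter fun i => l < answers ε nd S i).card := Nat.cast_nonneg _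
    linarith

/-- The budget of a phase covers the debt that the phase starts with. -/
lemma Inv.spent_classifyStep (h0 : 0 < ε) (hε : ε < 1) (hk : 1 ≤ k) (hn : k ≤ n)
    (h : Inv ε k v s₀ nd₀ s nd) {z : ℕ} (hc : s.cmd = .classify z 0)
    {S : Fin n → Bool} (a : Fin n → ℕ) (nd' : Fin n → Node n) :
    (spent (speakers S) (s.classifyStep ε k z (speakers S) a) : ℝ) +
      debt k (s.classifyStep ε k z (speakers S) a).1 nd' ≤
      ((s.classifyStep ε k z (speakers S) a).1.paid - s.paid : ℕ) := by
  obtain ⟨rfl, htop, -⟩ : ClassifyOk ε k z v s nd := by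
    have := h.stage; unfold StageOk at this; rwa [hc] at this
  set z := kthLargest k v
  set T := speakers S
  have c1 := card_clearlyLarger_lt h0 hε hk hn v
  rw [← htop] at c1
  unfold Server.classifyStep
  by_cases hsep : s.top.card + T.card = k
  · rw [if_pos hsep]
    obtain ⟨x, hx, hxw⟩ := Finset.exists_mem_eq_sup T (Finset.card_pos.1 (by omega))
      fun i => (i : ℕ) + 1
    dsimp only
    rw [hxw]
    have hmx : T.filter (fun i : Fin n => (i : ℕ) + 1 = (x : ℕ) + 1) = {x} := by
      ext i
      simp only [Finset.mem_filter, Finset.mem_singleton, add_left_inj, ← Fin.ext_iff]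
      exact ⟨fun h => h.2, fun h => ⟨h ▸ hx, h⟩⟩
    rw [hmx]
    simp only [debt, spent, Server.supply, Server.price, potential, Server.ask, listPot, phaseCost,
      Option.isSome_some, if_true, Finset.card_singleton, Finset.card_empty, List.map_cons,
      List.map_nil, List.sum_cons, List.sum_nil, List.length_nil, add_zero, Nat.sub_zero,
      Nat.add_sub_cancel_left]
    -- the summands `32 * intervalPot (0, z)` and `14` pay for a single undecided node
    have : T.card + 1 + (searchCost n k + (8 * 1 + 8) * (intervalPot (0, z) + 1 * intervalPot (0, z))
        + 8 * 1 + 6) ≤ searchCost n k + (8 * T.card + 8) * ((T.card + 1) *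
        intervalPot (firstGap ε z)) + 8 * T.card + 6 + 32 * intervalPot (0, z) + 14 := by
      omega
    exact_mod_cast this
  · rw [if_neg hsep]
    simp only [debt, spent, Server.lowStep, Server.supply, Server.price, potential, Server.ask,
      listPot, phaseCost, Option.isSome_some, if_true, Finset.card_empty, List.map_cons,
      List.map_nil, List.sum_cons, List.sum_nil, List.length_nil, add_zero, Nat.sub_zero,
      Nat.add_sub_cancel_left]
    have e : intervalPot (firstGap ε z) + T.card * intervalPot (firstGap ε z) =
      (T.card + 1) * intervalPot (firstGap ε z) := by ring
    have : T.card + 1 + (searchCost n k + (8 * T.card + 8) * (intervalPot (firstGap ε z) +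
        T.card * intervalPot (firstGap ε z)) + 7 * T.card + 5) ≤ searchCost n k +
        (8 * T.card + 8) * ((T.card + 1) * intervalPot (firstGap ε z)) + 8 * T.card + 6 +
        32 * intervalPot (0, z) + 14 := by
      rw [e]; omega
    exact_mod_cast this

/-- In a round of the search for the `k`-th largest value, the nodes that stay in the game are preceded by
fewer than `k` senders; by `avg_preceded`, at most `2 k` of them are expected to speak next. -/
lemma Inv.avg_sampleStep (hk : 1 ≤ k) (h : Inv ε k v s₀ nd₀ s nd) {r t : ℕ}
    (hc : s.cmd = .sample r t) :
    avg (fun i => (nd i).prob) (fun S => (spent (speakers S)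
      (s.sampleStep ε k r t (speakers S) (answers ε nd S)) : ℝ) +
      debt k (s.sampleStep ε k r t (speakers S) (answers ε nd S)).1
        fun i => (nd i).react ε (s.sampleStep ε k r t (speakers S) (answers ε nd S)).2) ≤
      debt k s nd := by
  have hs := h.synced
  have hrl : r ≤ lastRound n := by
    have := h.stage; unfold StageOk at this; rw [hc] at this; exact this.1
  set P := Finset.univ.filter fun i => t ≤ keyOf i (v i) with hP
  have hold : debt k s nd = P.card * (sendProb n r : ℝ) +
      (2 * k + 1) * (lastRound n + 1 - r : ℕ) := by
    unfold debt
    rw [hc]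
    simp only [hs.id, hs.val]
    rfl
  have hq : ∀ i ∈ P, ((nd i).prob : ℝ) = sendProb n r := fun i hi => by
    rw [prob_sample hs hc, if_pos (Finset.mem_filter.1 hi).2]
  have hsp : ∀ S, Possible (fun i => (nd i).prob) S → speakers S = P.filter fun i => S i := by
    intro S hS
    ext i
    rw [Finset.mem_filter, ← mem_speakers]
    exact ⟨fun hi => ⟨speakers_sample hs hc hS hi, hi⟩, fun hi => hi.2⟩
  have hcard : avg (fun i => (nd i).prob) (fun S => ((P.filter fun i => S i).card : ℝ)) =
      P.card * (sendProb n r : ℝ) := by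
    rw [avg_card, Finset.sum_congr rfl hq, Finset.sum_const, nsmul_eq_mul]
  rw [hold]
  by_cases hlt : r < lastRound n
  · have hpre := avg_preceded (fun i => (nd i).prob) k P (keyOf_injective v) hq
    have e1 : ((lastRound n + 1 - r : ℕ) : ℝ) = (lastRound n + 1 - (r + 1) : ℕ) + 1 := by
      have : lastRound n + 1 - r = lastRound n + 1 - (r + 1) + 1 := by omega
      rw [this]; push_cast; ring
    refine (avg_mono (g := fun S => ((P.filter fun i => S i).card : ℝ) +
      (2 * (sendProb n r : ℝ) * ((preceded k P (fun i => keyOf i (v i)) S).card : ℝ) +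
        (1 + (2 * k + 1) * (lastRound n + 1 - (r + 1) : ℕ)))) fun S hS => ?_).trans ?_
    · have hkey : kth k (speakers S) (fun i => keyOf i (answers ε nd S i)) =
          kth k (speakers S) fun i => keyOf i (v i) :=
        kth_congr fun i hi => by rw [answers_sample hs hc hi]
      unfold Server.sampleStep
      dsimp only
      rw [hkey, if_pos hlt]
      simp only [spent, debt, Server.ask, Node.react, Option.isSome_some, if_true, hs.id, hs.val]
      rw [sendProb_succ hlt, ← hsp S hS]
      generalize ht' : (if k ≤ (speakers S).card then
        kth k (speakers S) fun i => keyOf i (v i) else t) = t'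
      -- whoever reaches the new bound `t'` has fewer than `k` senders above
      have hsub : (Finset.univ.filter fun i => t' ≤ keyOf i (v i)) ⊆
          preceded k P (fun i => keyOf i (v i)) S := by
        intro i hi
        have hi' := (Finset.mem_filter.1 hi).2
        unfold preceded
        split_ifs at ht' with hks
        · have ht : t ≤ t' := by
            rw [← ht']
            refine le_kth hk (hks.trans (Finset.card_le_card fun j hj => ?_))
            exact Finset.mem_filter.2 ⟨hj,
              (Finset.mem_filter.1 (speakers_sample hs hc hS hj)).2⟩
          refine Finset.mem_filter.2 ⟨Finset.mem_filter.2 ⟨Finset.mem_univ i, ht.trans hi'⟩, ?_⟩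
          by_contra! hcon
          have h1 : t' + 1 ≤ kth k (speakers S) fun i => keyOf i (v i) := by
            refine le_kth hk (hcon.trans (Finset.card_le_card fun j hj => ?_))
            obtain ⟨-, hj1, hj2⟩ := Finset.mem_filter.1 hj
            exact Finset.mem_filter.2 ⟨mem_speakers.2 hj1, lt_of_le_of_lt hi' hj2⟩
          omega
        · subst ht'
          refine Finset.mem_filter.2 ⟨hi, ?_⟩
          refine lt_of_le_of_lt (Finset.card_le_card fun j hj => ?_) (not_le.1 hks)
          exact mem_speakers.2 (Finset.mem_filter.1 hj).2.1
      have h1 : ((Finset.univ.filter fun i => t' ≤ keyOf i (v i)).card : ℝ) ≤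
          (preceded k P (fun i => keyOf i (v i)) S).card := by
        exact_mod_cast Finset.card_le_card hsub
      have h2 := mul_le_mul_of_nonneg_right h1 (sendProb_nonneg n r)
      push_cast
      linarith
    · rw [avg_add, hcard, avg_add, avg_const, avg_const_mul, e1]
      linarith
  · have hr : r = lastRound n := by omega
    refine (avg_mono (g := fun S => ((P.filter fun i => S i).card : ℝ) + 1)
      fun S hS => ?_).trans ?_
    · unfold Server.sampleStep
      dsimp only
      rw [if_neg hlt]
      simp only [spent, debt, Server.ask, Option.isSome_some, if_true]
      rw [← hsp S hS]
      push_cast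
      linarith
    · rw [avg_add, hcard, avg_const, hr, Nat.add_sub_cancel_left]
      have : (0 : ℝ) ≤ k := Nat.cast_nonneg k
      push_cast
      linarith

/-- On average, the debt pays for the messages of a round, except that the search at the start of a
phase draws on the budget of the phase. -/
lemma Inv.avg_step (h0 : 0 < ε) (hε : ε < 1) (hk : 1 ≤ k) (hn : k ≤ n)
    (h : Inv ε k v s₀ nd₀ s nd) :
    avg (fun i => (nd i).prob) (fun S => (spent (speakers S)
      (s.step ε k (speakers S) (answers ε nd S)) : ℝ) +
      debt k (s.step ε k (speakers S) (answers ε nd S)).1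
        fun i => (nd i).react ε (s.step ε k (speakers S) (answers ε nd S)).2) ≤
      debt k s nd + avg (fun i => (nd i).prob)
        fun S => (((s.step ε k (speakers S) (answers ε nd S)).1.paid - s.paid : ℕ) : ℝ) := by
  have hnn := avg_nonneg (q := fun i => (nd i).prob)
    (f := fun S => (((s.step ε k (speakers S) (answers ε nd S)).1.paid - s.paid : ℕ) : ℝ))
    fun S => Nat.cast_nonneg _
  unfold Server.step at *
  rcases hc : s.cmd with l | - | b | ⟨r, t⟩ | ⟨z, w | w⟩ <;> rw [hc] at hnn <;> dsimp only at hnn ⊢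
  · exact (h.avg_watchStep h0 hε hc).trans (le_add_of_nonneg_right hnn)
  · exact (avg_le_of_forall fun S hS => (h.spent_lowStep (by rw [hc]; trivial) hS _ _).le).trans
      (le_add_of_nonneg_right hnn)
  · exact (avg_le_of_forall fun S hS => h.spent_highStep hc hS _).trans
      (le_add_of_nonneg_right hnn)
  · exact (h.avg_sampleStep hk hc).trans (le_add_of_nonneg_right hnn)
  · have hz : debt k s nd = 0 := by unfold debt; rw [hc]
    rw [hz, zero_add]
    exact avg_mono fun S _ => h.spent_classifyStep h0 hε hk hn hc _ _
  · exact (avg_le_of_forall fun S hS => (h.spent_lowStep (by rw [hc]; trivial) hS _ _).le).trans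
      (le_add_of_nonneg_right hnn)

lemma paid_le_step (ε : ℝ) (k : ℕ) (s : Server n) (T : Finset (Fin n)) (a : Fin n → ℕ) :
    s.paid ≤ (s.step ε k T a).1.paid := by
  unfold Server.step
  rcases hc : s.cmd with l | - | b | ⟨r, t⟩ | ⟨z, w | w⟩ <;> dsimp only
  · unfold Server.watchStep; split_ifs <;> exact le_rfl
  · exact le_rfl
  · unfold Server.highStep; dsimp only; split_ifs <;> exact le_rfl
  · unfold Server.sampleStep; dsimp only; split_ifs <;> exact le_rfl
  · unfold Server.classifyStep; dsimp only; split_ifs <;> exact Nat.le_add_right _ _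
  · exact le_rfl

/-- Between time steps the debt covers the search for any number of new violations. -/
lemma EndOk.debt_start (h : EndOk ε k v s nd) (v' : Values n) :
    debt k s (fun i => (nd i).see (v' i)) ≤ debt k s nd := by
  obtain ⟨l, hc, hw⟩ := h.watch
  rw [debt_watch hc, debt_watch hc, h.rnd]
  -- `reserve` of no violators is three, which covers a new search as well
  have h0 : (outsiders s nd).card = 0 := by
    rw [Finset.card_eq_zero, Finset.eq_empty_iff_forall_notMem]
    intro i hi
    have := (mem_outsiders.1 hi).2
    unfold Violates at this
    rw [h.val i] at this
    exact this (h.contains i)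
  refine add_le_add le_rfl ((reserve_zero_le _).trans ?_)
  unfold reserve
  rw [if_pos h0]

end Debt

/-! ### The expected number of messages -/

section Cost
variable {ε : ℝ} {k : ℕ} {v : Values n} {s₀ s : Server n} {nd₀ nd : Fin n → Node n}

lemma EndOk.debt_nonneg (h : EndOk ε k v s nd) : 0 ≤ debt k s nd := by
  obtain ⟨l, hc, hw⟩ := h.watch
  rw [debt_watch hc]
  have := hw.credit
  have := reserve_nonneg n (outsiders s nd).card s.rnd
  positivity

/-- The debt in a state of the system. -/
def debtOf (c : (monitor n k ε).Config) : ℝ≥0∞ := ENNReal.ofReal (debt k (serverOf c) (nodeOf c))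

/-- The states after rounds that have started in the states `c`. -/
def finalOf (c : (monitor n k ε).Config) (rs : List (monitor n k ε).Round) :
    (monitor n k ε).Config :=
  match rs.getLast? with
  | none => c
  | some r => r.final

lemma finalOf_cons (c : (monitor n k ε).Config) (r) (rs : List (monitor n k ε).Round) :
    finalOf c (r :: rs) = finalOf r.final rs := by
  unfold finalOf
  rw [List.getLast?_cons]
  cases rs.getLast? <;> rfl

lemma messages_eq_spent (c : (monitor n k ε).Config) (S : Fin n → Bool) :
    (roundOf c S).messages = spent (speakers S)
      ((serverOf c).step ε k (speakers S) (answers ε (nodeOf c) S)) := messages_roundOf c S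

/-- The one-round estimate `Inv.avg_step` in terms of the law of the coins. -/
lemma expect_step (h0 : 0 < ε) (hε : ε < 1) (hk : 1 ≤ k) (hn : k ≤ n)
    {c : (monitor n k ε).Config} (h : Inv ε k v s₀ nd₀ (serverOf c) (nodeOf c)) :
    expect (independent fun i => coin (coins c i))
      (fun S => ((roundOf c S).messages : ℝ≥0∞) + debtOf (next c S)) ≤
    debtOf c + expect (independent fun i => coin (coins c i))
      fun S => (((serverOf (next c S)).paid - (serverOf c).paid : ℕ) : ℝ≥0∞) := by
  set f : (Fin n → Bool) → ℝ := fun S => max 0 (((roundOf c S).messages : ℝ) +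
    debt k (serverOf (next c S)) (nodeOf (next c S))) with hf
  have h1 : expect (independent fun i => coin (coins c i))
      (fun S => ((roundOf c S).messages : ℝ≥0∞) + debtOf (next c S)) ≤
      expect (independent fun i => coin (coins c i)) fun S => ENNReal.ofReal (f S) := by
    refine expect_mono fun S hS => ?_
    have hS' := possible_of_mem_support hS
    have hd : 0 ≤ debt k (serverOf (next c S)) (nodeOf (next c S)) := by
      have := h.step h0 hε hk hn hS'
      rcases hi : (serverOf (next c S)).idle
      · exact (this.1 hi).debt_nonneg
      · exact (this.2 hi).1.debt_nonneg
    rw [← ENNReal.ofReal_natCast, debtOf, ← ENNReal.ofReal_add (Nat.cast_nonneg _) hd]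
    exact ENNReal.ofReal_le_ofReal (le_max_right _ _)
  refine h1.trans ?_
  rw [expect_coins _ fun S => le_max_left _ _]
  have h2 : (fun S => (((serverOf (next c S)).paid - (serverOf c).paid : ℕ) : ℝ≥0∞)) =
      fun S => ENNReal.ofReal (((serverOf (next c S)).paid - (serverOf c).paid : ℕ) : ℝ) := by
    funext S; rw [ENNReal.ofReal_natCast]
  rw [h2, expect_coins _ fun S => Nat.cast_nonneg _, debtOf,
    ← ENNReal.ofReal_add h.debt_nonneg (avg_nonneg fun S => Nat.cast_nonneg _)]
  refine ENNReal.ofReal_le_ofReal (le_trans (avg_mono fun S hS => ?_) (h.avg_step h0 hε hk hn))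
  have hd : 0 ≤ debt k (serverOf (next c S)) (nodeOf (next c S)) := by
    have := h.step h0 hε hk hn hS
    rcases hi : (serverOf (next c S)).idle
    · exact (this.1 hi).debt_nonneg
    · exact (this.2 hi).1.debt_nonneg
  show max 0 (((roundOf c S).messages : ℝ) + debt k (serverOf (next c S)) (nodeOf (next c S))) ≤ _
  rw [max_eq_right (add_nonneg (Nat.cast_nonneg _) hd), messages_eq_spent]
  exact le_rfl

lemma paid_le_next (c : (monitor n k ε).Config) (S : Fin n → Bool) :
    (serverOf c).paid ≤ (serverOf (next c S)).paid := paid_le_step ε k (serverOf c) _ _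

lemma paid_le_finalOf : ∀ {L : ℕ} {c : (monitor n k ε).Config},
    ∀ rs ∈ (Online.runRounds L c).support, (serverOf c).paid ≤ (serverOf (finalOf c rs)).paid := by
  intro L
  induction L with
  | zero =>
    intro c rs hrs
    rw [Online.runRounds, PMF.mem_support_pure_iff] at hrs
    rw [hrs]; exact le_rfl
  | succ L ih =>
    intro c rs hrs
    obtain ⟨S, hS, ⟨-, rfl⟩ | ⟨-, rs', hrs', rfl⟩⟩ := mem_runRounds_succ hrs
    · rw [finalOf_cons, final_roundOf]
      exact paid_le_next c S
    · rw [finalOf_cons, final_roundOf]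
      exact (paid_le_next c S).trans (ih rs' hrs')

lemma expect_runRounds_succ (L : ℕ) (c : (monitor n k ε).Config)
    (F : List (monitor n k ε).Round → ℝ≥0∞) :
    expect (Online.runRounds (L + 1) c) F = expect (independent fun i => coin (coins c i)) fun S =>
      if (serverOf (next c S)).idle = true then F [roundOf c S] else
        expect (Online.runRounds L (next c S)) fun rs => F (roundOf c S :: rs) := by
  classical
  rw [Online.runRounds, expect_bind, runRound_eq, expect_map]
  congr 1
  funext S
  by_cases hd : (serverOf (next c S)).idle = true
  · rw [if_pos hd, if_pos (show (monitor n k ε).done (roundOf c S).server from hd), expect_pure]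
  · rw [if_neg hd, if_neg (show ¬ (monitor n k ε).done (roundOf c S).server from hd), expect_bind,
      final_roundOf]
    simp only [expect_pure]

/-- The expected number of messages in a time step. -/
lemma expect_runRounds (h0 : 0 < ε) (hε : ε < 1) (hk : 1 ≤ k) (hn : k ≤ n) :
    ∀ {L : ℕ} {c : (monitor n k ε).Config}, Inv ε k v s₀ nd₀ (serverOf c) (nodeOf c) →
    expect (Online.runRounds L c) (fun rs => ((rs.map Online.Round.messages).sum : ℝ≥0∞) +
      debtOf (finalOf c rs)) ≤
    debtOf c + expect (Online.runRounds L c)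
      fun rs => (((serverOf (finalOf c rs)).paid - (serverOf c).paid : ℕ) : ℝ≥0∞) := by
  intro L
  induction L with
  | zero =>
    intro c _
    simp only [Online.runRounds, expect_pure]
    simp [finalOf]
  | succ L ih =>
    intro c h
    rw [expect_runRounds_succ, expect_runRounds_succ]
    set R : (Fin n → Bool) → ℝ≥0∞ := fun S => if (serverOf (next c S)).idle = true then 0 else
      expect (Online.runRounds L (next c S)) fun rs =>
        (((serverOf (finalOf (next c S) rs)).paid - (serverOf (next c S)).paid : ℕ) : ℝ≥0∞) with hR
    calc _ ≤ expect (independent fun i => coin (coins c i)) (fun S =>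
          (((roundOf c S).messages : ℝ≥0∞) + debtOf (next c S)) + R S) := by
          refine expect_mono fun S hS => ?_
          have hS' := possible_of_mem_support hS
          rw [hR]
          dsimp only
          split_ifs with hi
          · rw [finalOf_cons, final_roundOf]
            simp [finalOf]
          · have hi' : (serverOf (next c S)).idle = false := by simpa using hi
            have h1 := ih (c := next c S) ((h.step h0 hε hk hn hS').1 hi')
            simp only [finalOf_cons, final_roundOf, List.map_cons, List.sum_cons, Nat.cast_add,
              add_assoc]
            rw [expect_add, expect_const]
            exact add_le_add le_rfl h1
      _ ≤ debtOf c + expect (independent fun i => coin (coins c i)) (fun S =>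
          (((serverOf (next c S)).paid - (serverOf c).paid : ℕ) : ℝ≥0∞) + R S) := by
          refine (expect_add _ _ _).le.trans ?_
          refine (add_le_add (expect_step h0 hε hk hn h) le_rfl).trans_eq ?_
          rw [add_assoc, ← expect_add]
      _ ≤ _ := by
          refine add_le_add le_rfl (expect_mono fun S _ => ?_)
          rw [hR]
          dsimp only
          split_ifs with hi
          · rw [finalOf_cons, final_roundOf]
            simp [finalOf]
          · rw [← expect_const (Online.runRounds L (next c S))
              (((serverOf (next c S)).paid - (serverOf c).paid : ℕ) : ℝ≥0∞), ← expect_add]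
            refine expect_mono fun rs hrs => ?_
            have h1 := paid_le_finalOf rs hrs
            have h2 := paid_le_next c S
            rw [finalOf_cons, final_roundOf]
            exact_mod_cast (by omega)

/-- The initial budget covers the debt of the initial state. -/
lemma debt_init (hk : 1 ≤ k) (hn : k ≤ n) :
    debt k (serverInit n k) (nodeInit ε k) ≤ (serverInit n k).paid := by
  have c2 : (serverInit n k).mid.card = 1 := by
    show (Finset.univ.filter fun i : Fin n => (i : ℕ) + 1 = k).card = 1
    rw [Finset.card_eq_one]
    refine ⟨⟨k - 1, by omega⟩, ?_⟩
    ext i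
    simp only [Finset.mem_filter, Finset.mem_univ, true_and, Finset.mem_singleton, Fin.ext_iff]
    omega
  have h1 : (serverInit n k).supply = 2 := by
    unfold Server.supply potential
    rw [c2]
    simp [serverInit, listPot, intervalPot]
  have h2 : (serverInit n k).price = 16 := by unfold Server.price; rw [c2]
  have h3 := reserve_zero_le (outsiders (serverInit n k) (nodeInit ε k))
  rw [debt_watch rfl, h1, h2, c2]
  have h4 : (serverInit n k).paid = searchCost n k + 41 := rfl
  have h5 : (serverInit n k).fell = ∅ := rfl
  have h6 : (serverInit n k).rose = ∅ := rfl
  have h7 : (serverInit n k).rnd = 0 := rfl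
  rw [h4, h5, h6, h7]
  push_cast [Finset.card_empty]
  linarith

lemma current_cons (v : Values n) (c : (monitor n k ε).Config) (rs : List (monitor n k ε).Round)
    (h : (monitor n k ε).History) : Online.current (⟨v, c, rs⟩ :: h) = finalOf c rs := by
  show Online.Step.final _ = _
  unfold Online.Step.final finalOf
  dsimp only
  cases rs.getLast? <;> rfl

lemma expect_run_succ (L : ℕ → ℕ) (adv : (monitor n k ε).Adversary) (T : ℕ)
    (F : (monitor n k ε).History → ℝ≥0∞) :
    expect (Online.run L adv (T + 1)) F = expect (Online.run L adv T) fun h =>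
      expect (Online.runRounds (L (maxValue (adv h))) (startOf (Online.current h) (adv h)))
        fun rs => F (⟨adv h, startOf (Online.current h) (adv h), rs⟩ :: h) := by
  rw [Online.run, expect_bind]
  congr 1
  funext h
  dsimp only
  rw [expect_bind]
  simp only [expect_pure]
  rfl

/-- The expected number of messages is at most the expected budget of all phases. -/
lemma expect_messages_le (h0 : 0 < ε) (hε : ε < 1) (hk : 1 ≤ k) (hn : k ≤ n)
    (adv : (monitor n k ε).Adversary) (T : ℕ) :
    expect (Online.run (roundLimit 120 2 n) adv T)
      (fun h => (Online.messages h : ℝ≥0∞) + debtOf (Online.current h)) ≤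
    expect (Online.run (roundLimit 120 2 n) adv T)
      fun h => ((serverOf (Online.current h)).paid : ℝ≥0∞) := by
  induction T with
  | zero =>
    simp only [Online.run, expect_pure]
    have h1 : Online.messages ([] : (monitor n k ε).History) = 0 := rfl
    rw [h1, Nat.cast_zero, zero_add, ← ENNReal.ofReal_natCast]
    exact ENNReal.ofReal_le_ofReal (debt_init hk hn)
  | succ T ih =>
    rw [expect_run_succ, expect_run_succ]
    set R : (monitor n k ε).History → ℝ≥0∞ := fun h =>
      expect (Online.runRounds (roundLimit 120 2 n (maxValue (adv h)))
        (startOf (Online.current h) (adv h))) fun rs =>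
          (((serverOf (finalOf (startOf (Online.current h) (adv h)) rs)).paid -
            (serverOf (Online.current h)).paid : ℕ) : ℝ≥0∞) with hR
    calc _ ≤ expect (Online.run (roundLimit 120 2 n) adv T) (fun h =>
          ((Online.messages h : ℝ≥0∞) + debtOf (Online.current h)) + R h) := by
          refine expect_mono fun h hh => ?_
          have hok := (historyOk_of_mem_run h0 hε hk hn adv hh).1
          obtain ⟨_, hg⟩ := hok.good
          have h1 := expect_runRounds h0 hε hk hn (hok.inv hε (adv h))
            (L := roundLimit 120 2 n (maxValue (adv h)))
          have h2 : debtOf (startOf (Online.current h) (adv h)) ≤ debtOf (Online.current h) :=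
            ENNReal.ofReal_le_ofReal (hg.debt_start (adv h))
          have h3 : ∀ rs, ((Online.messages ((⟨adv h, startOf (Online.current h) (adv h), rs⟩ ::
              h : (monitor n k ε).History)) : ℕ) : ℝ≥0∞) +
              debtOf (Online.current ((⟨adv h, startOf (Online.current h) (adv h), rs⟩ ::
              h : (monitor n k ε).History))) = (Online.messages h : ℝ≥0∞) +
              (((rs.map Online.Round.messages).sum : ℝ≥0∞) +
              debtOf (finalOf (startOf (Online.current h) (adv h)) rs)) := by
            intro rs
            have : Online.messages ((⟨adv h, startOf (Online.current h) (adv h), rs⟩ ::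
              h : (monitor n k ε).History)) = (rs.map Online.Round.messages).sum +
                Online.messages h := rfl
            rw [this, Nat.cast_add, add_comm ((rs.map Online.Round.messages).sum : ℝ≥0∞), add_assoc,
              current_cons]
          simp only [h3]
          rw [expect_add, expect_const, add_assoc]
          exact add_le_add le_rfl (h1.trans (add_le_add h2 le_rfl))
      _ ≤ expect (Online.run (roundLimit 120 2 n) adv T) (fun h =>
          ((serverOf (Online.current h)).paid : ℝ≥0∞) + R h) := by
          rw [expect_add _ (fun h => (Online.messages h : ℝ≥0∞) + debtOf (Online.current h)),
            expect_add _ (fun h => ((serverOf (Online.current h)).paid : ℝ≥0∞))]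
          exact add_le_add ih le_rfl
      _ ≤ _ := by
          refine expect_mono fun h _ => ?_
          rw [hR]
          dsimp only
          rw [← expect_const (Online.runRounds (roundLimit 120 2 n (maxValue (adv h)))
            (startOf (Online.current h) (adv h))) ((serverOf (Online.current h)).paid : ℝ≥0∞),
            ← expect_add]
          refine expect_mono fun rs hrs => ?_
          have h1 : (serverOf (Online.current h)).paid ≤
              (serverOf (finalOf (startOf (Online.current h) (adv h)) rs)).paid :=
            paid_le_finalOf (c := startOf (Online.current h) (adv h)) rs hrs
          have h2 : (serverOf (Online.current h)).paid +
              ((serverOf (finalOf (startOf (Online.current h) (adv h)) rs)).paid -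
              (serverOf (Online.current h)).paid) ≤
              (serverOf (finalOf (startOf (Online.current h) (adv h)) rs)).paid := by omega
          rw [current_cons]
          exact_mod_cast h2

end Cost

/-! ### Competitiveness -/

section Bounds

lemma one_le_lg (x : ℝ) : 1 ≤ lg x := le_max_left _ _

lemma logb_le_lg (x : ℝ) : Real.logb 2 x ≤ lg x := le_max_right _ _

lemma lg_mono {x y : ℝ} (hx : 0 ≤ x) (h : x ≤ y) : lg x ≤ lg y := by
  rcases hx.eq_or_lt with rfl | hx
  · refine max_le (one_le_lg _) ?_
    rw [Real.logb_zero]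
    exact zero_le_one.trans (one_le_lg _)
  · exact max_le_max le_rfl (Real.logb_le_logb_of_le (by norm_num) hx h)

lemma logb_le_two_add_lg {x : ℝ} (hx : 0 ≤ x) : Real.logb 2 (1 + 2 * x) ≤ 2 + lg x := by
  have h4 : Real.logb 2 4 = 2 := by
    rw [show (4 : ℝ) = 2 ^ (2 : ℕ) by norm_num, Real.logb_pow, Real.logb_self_eq_one (by norm_num)]
    norm_num
  rcases le_total x 1 with h | h
  · have := Real.logb_le_logb_of_le (b := 2) (by norm_num) (by linarith) (by linarith : 1 + 2 * x ≤ 4)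
    linarith [one_le_lg x]
  · have h1 := Real.logb_le_logb_of_le (b := 2) (by norm_num) (by linarith)
      (by linarith : 1 + 2 * x ≤ 4 * x)
    rw [Real.logb_mul (by norm_num) (by linarith), h4] at h1
    linarith [logb_le_lg x]

lemma intervalPot_firstGap_le {ε : ℝ} (h0 : 0 < ε) (hε : ε < 1) (z : ℕ) :
    (intervalPot (firstGap ε z) : ℝ) ≤ 4 * lg (ε * z) := by
  have h1 := firstGap_le h0 hε z
  have h2 : (1 - ε) ^ 2 * (z : ℝ) ≤ ((firstGap ε z).1 : ℝ) := Nat.le_ceil _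
  have hz : (0 : ℝ) ≤ z := Nat.cast_nonneg z
  -- there are at most `1 + 2 ε z` candidates, since `1 - (1 - ε)² ≤ 2 ε`
  have h3 : (((firstGap ε z).2 + 1 - (firstGap ε z).1 : ℕ) : ℝ) ≤ 1 + 2 * (ε * z) := by
    rw [Nat.cast_sub (by omega)]
    have : (((firstGap ε z).2 : ℕ) : ℝ) = z := rfl
    push_cast
    nlinarith [mul_nonneg (sq_nonneg ε) hz]
  have h4 : (0 : ℝ) < ((firstGap ε z).2 + 1 - (firstGap ε z).1 : ℕ) := by
    exact_mod_cast (by omega : 0 < (firstGap ε z).2 + 1 - (firstGap ε z).1)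
  have h5 := Real.natLog_le_logb ((firstGap ε z).2 + 1 - (firstGap ε z).1) 2
  have h6 := Real.logb_le_logb_of_le (b := 2) (by norm_num) h4 h3
  have h7 := logb_le_two_add_lg (x := ε * z) (by positivity)
  have h8 := one_le_lg (ε * z)
  unfold intervalPot
  push_cast at h5 ⊢
  linarith

lemma intervalPot_zero_le {ε : ℝ} (h0 : 0 < ε) (z : ℕ) :
    (intervalPot (0, z) : ℝ) ≤ 3 * lg (ε * z) + lg (1 / ε) := by
  have h8 := one_le_lg (ε * z)
  have h9 := one_le_lg (1 / ε)
  unfold intervalPot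
  rcases Nat.eq_zero_or_pos z with rfl | hz
  · simp only [Nat.sub_zero, Nat.zero_add, Nat.log_one_right, Nat.cast_one, Nat.add_zero]
    push_cast at h8
    linarith
  · have hz' : (1 : ℝ) ≤ z := by exact_mod_cast hz
    have h5 := Real.natLog_le_logb (z + 1) 2
    -- `log z = log (ε z) + log (1 / ε)`
    have h6 := Real.logb_le_logb_of_le (b := 2) (by norm_num) (by positivity)
      (show (z : ℝ) + 1 ≤ 2 * ((ε * z) * (1 / ε)) by
        rw [show (ε * z) * (1 / ε) = (z : ℝ) by field_simp]; linarith)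
    rw [Real.logb_mul (by norm_num) (by positivity), Real.logb_mul (by positivity) (by positivity),
      Real.logb_self_eq_one (by norm_num)] at h6
    have := logb_le_lg (ε * z)
    have := logb_le_lg (1 / ε)
    simp only [Nat.sub_zero]
    push_cast at h5 ⊢
    linarith

lemma lastRound_le_lg (n : ℕ) : (lastRound n : ℝ) ≤ 2 * lg n := by
  have h1 : lastRound n ≤ Nat.log 2 n + 1 := by
    unfold lastRound
    exact Nat.clog_le_of_le_pow (Nat.lt_pow_succ_log_self (by norm_num) n).le
  have h2 : (lastRound n : ℝ) ≤ Nat.log 2 n + 1 := by exact_mod_cast h1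
  have h3 := Real.natLog_le_logb n 2
  have := logb_le_lg n
  have := one_le_lg n
  push_cast at h3
  linarith

/-- The search for the `k`-th largest value costs `O(k log n)`. -/
lemma searchCost_le {k : ℕ} (hk : 1 ≤ k) :
    (searchCost n k : ℝ) ≤ 11 * (k * lg n) := by
  have h1 := lastRound_le_lg n
  have h2 := one_le_lg n
  have hk' : (1 : ℝ) ≤ k := by exact_mod_cast hk
  unfold searchCost
  push_cast
  have : (2 * (k : ℝ) + 1) * (lastRound n + 1) ≤ (3 * k) * (3 * lg n) :=
    mul_le_mul (by linarith) (by linarith) (by positivity) (by positivity)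
  nlinarith

/-- The budget of a phase in terms of upper bounds for the parameters. -/
lemma phaseCost_le {ε : ℝ} (h0 : 0 < ε) (hε : ε < 1) {k : ℕ} (hk : 1 ≤ k)
    {z s : ℕ} (hs : 1 ≤ s) :
    (phaseCost n k ε z s : ℝ) ≤
      252 * ((s : ℝ) ^ 2 * lg (ε * z)) + 11 * (k * lg n) + 32 * lg (1 / ε) := by
  have h1 := searchCost_le (n := n) hk
  have h2 := intervalPot_firstGap_le h0 hε z
  have h3 := intervalPot_zero_le h0 z
  have h4 := one_le_lg (ε * z)
  have hs' : (1 : ℝ) ≤ s := by exact_mod_cast hs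
  unfold phaseCost
  push_cast
  have h5 : (8 * (s : ℝ) + 8) * ((s + 1) * intervalPot (firstGap ε z)) ≤
      (16 * s) * ((2 * s) * (4 * lg (ε * z))) := by gcongr <;> linarith
  have h6 : (s : ℝ) ≤ s ^ 2 * lg (ε * z) := by nlinarith
  have h7 : lg (ε * z) ≤ s ^ 2 * lg (ε * z) := le_mul_of_one_le_left (by linarith)
    (one_le_pow₀ hs')
  nlinarith

lemma one_le_card_neighborhood {ε : ℝ} (h0 : 0 < ε) (hε : ε < 1) {k : ℕ} (hk : 1 ≤ k) (hn : k ≤ n)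
    (v : Values n) : 1 ≤ (neighborhood ε k v).card := by
  -- fewer than `k` nodes are clearly larger, but `k` nodes are at least as large as the `k`-th one
  have h1 := le_card_neighborhood h0 hk hn (ε := ε) v
  have h2 := card_clearlyLarger_lt h0 hε hk hn v
  omega

lemma lg_le_self (hn : 1 ≤ n) : lg n ≤ n := by
  refine max_le (by exact_mod_cast hn) ?_
  rw [Real.logb_le_iff_le_rpow (by norm_num) (by exact_mod_cast hn), Real.rpow_natCast]
  exact_mod_cast Nat.lt_two_pow_self.le

/-- The competitive ratio in terms of `σ` and `v_k`, up to a constant factor. -/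
def ratio (ε : ℝ) (k : ℕ) {T : ℕ} (v : Fin T → Values n) : ℝ :=
  (sigma ε k v : ℝ) ^ 2 * lg (ε * (maxKth k v : ℝ)) +
    (sigma ε k v : ℝ) * lg (ε * (maxKth k v : ℝ)) ^ 2 +
    (k : ℝ) * lg (n : ℝ) + lg (lg (delta v : ℝ)) + lg (1 / ε)

lemma phaseCost_le_ratio {ε : ℝ} (h0 : 0 < ε) (hε : ε < 1) {k : ℕ} (hk : 1 ≤ k) (hn : k ≤ n)
    {T : ℕ} (v : Fin T → Values n) (t : Fin T) :
    (phaseCost n k ε (kthLargest k (v t)) (neighborhood ε k (v t)).card : ℝ) ≤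
      252 * ratio ε k v := by
  have h1 := phaseCost_le (n := n) h0 hε hk (one_le_card_neighborhood h0 hε hk hn (v t))
    (z := kthLargest k (v t))
  have h2 : (neighborhood ε k (v t)).card ≤ sigma ε k v :=
    Finset.le_sup (f := fun t => (neighborhood ε k (v t)).card) (Finset.mem_univ t)
  have h3 : kthLargest k (v t) ≤ maxKth k v :=
    Finset.le_sup (f := fun t => kthLargest k (v t)) (Finset.mem_univ t)
  have h4 : lg (ε * kthLargest k (v t)) ≤ lg (ε * maxKth k v) := by
    refine lg_mono (by positivity) ?_
    gcongr
  have h5 := zero_le_one.trans (one_le_lg (ε * kthLargest k (v t)))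
  have h6 : ((neighborhood ε k (v t)).card : ℝ) ^ 2 * lg (ε * kthLargest k (v t)) ≤
      (sigma ε k v : ℝ) ^ 2 * lg (ε * maxKth k v) := by gcongr
  have h7 : 0 ≤ (sigma ε k v : ℝ) * lg (ε * (maxKth k v : ℝ)) ^ 2 := by positivity
  have h8 : 0 ≤ (k : ℝ) * lg (n : ℝ) := mul_nonneg (Nat.cast_nonneg _) (zero_le_one.trans (one_le_lg _))
  have h9 := one_le_lg (lg (delta v : ℝ))
  have h10 := one_le_lg (1 / ε)
  unfold ratio
  linarith

lemma searchCost_le_ratio (ε : ℝ) {k : ℕ} (hk : 1 ≤ k)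
    {T : ℕ} (v : Fin T → Values n) : (searchCost n k : ℝ) + 41 ≤ 52 * ratio ε k v := by
  have h1 := searchCost_le (n := n) hk
  have h2 := one_le_lg (ε * (maxKth k v : ℝ))
  have h3 : 0 ≤ (sigma ε k v : ℝ) ^ 2 * lg (ε * (maxKth k v : ℝ)) := by positivity
  have h7 : 0 ≤ (sigma ε k v : ℝ) * lg (ε * (maxKth k v : ℝ)) ^ 2 := by positivity
  have h8 : 0 ≤ (k : ℝ) * lg (n : ℝ) := mul_nonneg (Nat.cast_nonneg _) (zero_le_one.trans (one_le_lg _))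
  have h9 := one_le_lg (lg (delta v : ℝ))
  have h10 := one_le_lg (1 / ε)
  unfold ratio
  linarith

/-- The ratio in terms of `n` and `Δ` is weaker: `σ ≤ n`, `v_k ≤ Δ` and `k log n ≤ n²`. -/
lemma ratio_le {ε : ℝ} (h0 : 0 < ε) {k : ℕ} (hk : 1 ≤ k) (hn : k ≤ n)
    {T : ℕ} (v : Fin T → Values n) :
    ratio ε k v ≤ 2 * ((n : ℝ) ^ 2 * lg (ε * (delta v : ℝ)) + (n : ℝ) * lg (ε * (delta v : ℝ)) ^ 2 +
      lg (lg (delta v : ℝ)) + lg (1 / ε)) := by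
  have h2 : sigma ε k v ≤ n := Finset.sup_le fun t _ => (Finset.card_le_univ _).trans (by simp)
  have h3 : maxKth k v ≤ delta v :=
    Finset.sup_mono_fun fun t _ => kthLargest_le_maxValue hk hn (v t)
  have h4 : lg (ε * maxKth k v) ≤ lg (ε * delta v) := by
    refine lg_mono (by positivity) ?_
    gcongr
  have h5 := one_le_lg (ε * (maxKth k v : ℝ))
  have h6 : (sigma ε k v : ℝ) ^ 2 * lg (ε * maxKth k v) ≤ (n : ℝ) ^ 2 * lg (ε * delta v) := by gcongr
  have h7 : (sigma ε k v : ℝ) * lg (ε * maxKth k v) ^ 2 ≤ (n : ℝ) * lg (ε * delta v) ^ 2 := by gcongr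
  have hk' : (k : ℝ) ≤ n := by exact_mod_cast hn
  have h8 : (k : ℝ) * lg n ≤ n * n := mul_le_mul hk' (lg_le_self (hk.trans hn))
    (zero_le_one.trans (one_le_lg _)) (Nat.cast_nonneg n)
  have h9 := one_le_lg (lg (delta v : ℝ))
  have h10 := one_le_lg (1 / ε)
  have h11 := one_le_lg (ε * (delta v : ℝ))
  have h12 : (n : ℝ) * n ≤ (n : ℝ) ^ 2 * lg (ε * delta v) := by nlinarith [sq_nonneg (n : ℝ)]
  have h13 : 0 ≤ (n : ℝ) * lg (ε * delta v) ^ 2 := by positivity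
  unfold ratio
  linarith

end Bounds

section Final
variable {ε : ℝ} {k : ℕ}

/-- The total budget is a multiple of the optimal cost, since an optimal offline algorithm updates its
filters in every phase; the budget of the initial state is charged to the first assignment. -/
lemma HistoryOk.paid_le_opt (h0 : 0 < ε) (hε : ε < 1) (hk : 1 ≤ k) (hn : k ≤ n)
    {h : (monitor n k ε).History} (hh : HistoryOk h) (hne : h ≠ []) :
    ((serverOf (Online.current h)).paid : ℝ) ≤
      304 * (ratio ε k (Online.values h) * opt ε k (Online.values h)) := by
  obtain ⟨T, hT⟩ : ∃ T, h.length = T + 1 := Nat.exists_eq_succ_of_ne_zero (by simpa using hne)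
  have h1 : 1 ≤ opt ε k (Online.values h) := by
    -- the length is generalized because `one_le_opt` needs it in the form `T + 1`
    have key : ∀ {m : ℕ} (v : Fin m → Values n), m = T + 1 → 1 ≤ opt ε k v := by
      rintro _ v rfl
      exact one_le_opt h0 hε hk hn v
    exact key _ hT
  have h2 := hh.tracks.le_opt h0 hε hk hn
  set X := ratio ε k (Online.values h)
  have h4 : (searchCost n k : ℝ) + 41 ≤ 52 * X := searchCost_le_ratio ε hk (Online.values h)
  have h3 : 0 ≤ X := by
    have : (0 : ℝ) ≤ searchCost n k := Nat.cast_nonneg _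
    linarith
  have h5 := hh.paid ⌊252 * X⌋₊ fun t => Nat.le_floor (phaseCost_le_ratio h0 hε hk hn _ t)
  have h6 : ((serverOf (Online.current h)).paid : ℝ) ≤ searchCost n k + 41 +
      (serverOf (Online.current h)).phases * (⌊252 * X⌋₊ : ℝ) := by exact_mod_cast h5
  have h7 : (⌊252 * X⌋₊ : ℝ) ≤ 252 * X := Nat.floor_le (by positivity)
  have h8 : ((serverOf (Online.current h)).phases : ℝ) ≤ opt ε k (Online.values h) := by
    exact_mod_cast h2
  have h9 : (1 : ℝ) ≤ opt ε k (Online.values h) := by exact_mod_cast h1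
  have h10 : ((serverOf (Online.current h)).phases : ℝ) * (⌊252 * X⌋₊ : ℝ) ≤
      opt ε k (Online.values h) * (252 * X) := by gcongr
  nlinarith

/-- Every function of the input that dominates `ratio` up to a constant is a competitive ratio. -/
lemma monitor_competitive (h0 : 0 < ε) (hε : ε < 1) (hk : 1 ≤ k) (hn : k ≤ n)
    {c : (T : ℕ) → (Fin T → Values n) → ℝ} (hc : ∀ T v, 304 * ratio ε k v ≤ c T v) :
    (monitor n k ε).Competitive ε k 120 2 c := by
  intro adv T
  cases T with
  | zero =>
    simp only [Online.run, expect_pure]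
    have h1 : Online.messages ([] : (monitor n k ε).History) = 0 := rfl
    rw [h1, Nat.cast_zero]
    exact zero_le
  | succ T =>
    calc _ ≤ expect (Online.run (roundLimit 120 2 n) adv (T + 1))
          (fun h => (Online.messages h : ℝ≥0∞) + debtOf (Online.current h)) :=
          expect_mono fun h _ => le_self_add
      _ ≤ _ := expect_messages_le h0 hε hk hn adv (T + 1)
      _ ≤ _ := by
          refine expect_mono fun h hh => ?_
          obtain ⟨hok, hlen, -⟩ := historyOk_of_mem_run h0 hε hk hn adv hh
          rw [← ENNReal.ofReal_natCast]
          refine ENNReal.ofReal_le_ofReal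
            ((hok.paid_le_opt h0 hε hk hn (by rintro rfl; simp at hlen)).trans ?_)
          rw [← mul_assoc]
          exact mul_le_mul_of_nonneg_right (hc _ _) (Nat.cast_nonneg _)

end Final

end TopK.Monitor

end

theorem mainTheorem1 :
    ∃ (C : ℝ) (c d : ℕ), ∀ (n k : ℕ) (ε : ℝ), 1 ≤ k → k ≤ n → 0 < ε → ε < 1 →
      ∃ A : TopK.Online n, A.Solves ε k c d ∧
        A.Competitive ε k c d (fun _ v => C *
          ((TopK.sigma ε k v : ℝ) ^ 2 * TopK.lg (ε * (TopK.maxKth k v : ℝ)) +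
            (TopK.sigma ε k v : ℝ) * TopK.lg (ε * (TopK.maxKth k v : ℝ)) ^ 2 +
            (k : ℝ) * TopK.lg (n : ℝ) +
            TopK.lg (TopK.lg (TopK.delta v : ℝ)) + TopK.lg (1 / ε))) ∧
        A.Competitive ε k c d (fun _ v => C *
          ((n : ℝ) ^ 2 * TopK.lg (ε * (TopK.delta v : ℝ)) +
            (n : ℝ) * TopK.lg (ε * (TopK.delta v : ℝ)) ^ 2 +
            TopK.lg (TopK.lg (TopK.delta v : ℝ)) + TopK.lg (1 / ε))) := by
  open TopK.Monitor in
  refine ⟨608, 120, 2, fun n k ε hk hn h0 hε => ⟨monitor n k ε, monitor_solves h0 hε hk hn,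
    monitor_competitive h0 hε hk hn fun T v => ?_,
    monitor_competitive h0 hε hk hn fun T v => by linarith [ratio_le h0 hk hn v]⟩⟩
  have h : 0 ≤ ratio ε k v := by
    have h1 := searchCost_le_ratio ε hk v
    have h2 : (0 : ℝ) ≤ searchCost n k := Nat.cast_nonneg _
    linarith
  exact mul_le_mul_of_nonneg_right (by norm_num : (304 : ℝ) ≤ 608) h
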